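/- Let $1\le m<n$, $A\in\mathbb{R}^{m\times n}$, $b\in\mathbb{R}^m$, $c,d,x^0\in\mathbb{R}^n$, $K\in\mathbb{R}$, with $d>0$, $Ax^0=b$, $x^0\ge 0$, $x^0\neq 0$. The problem $(\mathrm{RIOVLP}_1)$ is to minimize $\sum_{j}d_j|\bar c_j-c_j|$ over all $\bar c\in\mathbb{R}^n$ such that $\min\{\bar c x: Ax=b,\ x\ge 0\}=K$ and $\bar c x^0=K$. Put $J=\{j:x^0_j=0\}$, $\bar J=\{j:x^0_j>0\}$, $d_{\max}=\max_j d_j$, $x^0_{\max}=\max_j x^0_j$, $\delta=\sum_{j\in\bar J}c_jx^0_j-K$, $\Delta=(2|\bar J|x^0_{\max})^{-2}$, $Z=(n+|\bar J|)d_{\max}+1$, $\mathcal L=\max\{d_{\max},x^0_{\max},n\}$. For $z\in\mathbb{R}$ let $$(D^z)\quad \psi(z)=\max\{cy:\ Ay=0;\ -d_j\le y_j\le 0\ (j\in J);\ x^0_jz-d_j\le y_j\le x^0_jz+d_j\ (j\in\bar J)\}.$$ Let $(P^z)$ be its dual: minimize $\sum_j d_j(\alpha_j+\beta_j)+z\sum_{j\in\bar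 J}(\beta_j-\alpha_j)x^0_j$ over $(\pi,\alpha,\beta)$ with $\alpha,\beta\ge 0$, $\pi A_j-\alpha_j+\beta_j\le c_j$ for $j\in J$ and $\pi A_j-\alpha_j+\beta_j=c_j$ for $j\in\bar J$. Consider the following algorithm. **Left break point $z_l$.** If $(D^{-Z})$ is feasible, $z_l=-\infty$. Otherwise start with $[\underline z,\bar z]=[-Z,0]$ and, while $\bar z-\underline z\ge\Delta/2$, test $(D^z)$ at the midpoint $z$ for feasibility and set $\bar z:=z$ if it is feasible, $\underline z:=z$ if not. Let $z_0=\bar z$, $z_1=z_0+\Delta/2$, and let $y^0,y^1$ be optimal basic solutions of $(D^{z_0})$, $(D^{z_1})$ that belong to a common basis of the standard form of $(D^z)$ (variables $y=\dot y-\ddot y$, slacks $\xi,\eta$; $A\dot y-A\ddot y=0$; $-y+\xi=d-zx^0$; $y_j+\eta_j=0$ for $j\in J$, $y_j+\eta_j=d_j+zx^0_j$ for $j\in\bar J$; $\dot y,\ddot y,\xi,\eta\ge0$). Let $z_l$ be the smallest $z$ for which the point at parameter $z$ of the line through $(z_0,y^0)$ and $(z_1,y^1)$ satisfies the bounds of $(D^z)$.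 **The right break point $z_r\in\mathbb{R}\cup\{+\infty\}$** is computed symmetrically on $[0,Z]$, with $z_1=z_0-\Delta/2$. **Slope$(z)$.** Let $z'=z+\Delta/2$ if $z=z_l$, $z'=z-\Delta/2$ if $z=z_r$, and $z'=z$ otherwise. Solve $(D^{z'})$, find by complementary slackness a solution $(\pi,\alpha,\beta)$ of $(P^{z'})$, and return $\sum_{j\in\bar J}(\beta_j-\alpha_j)x^0_j$. **Initialization.** If $z_l=-\infty$, let $\underline\tau=-Z$ and report infeasibility and stop if Slope$(\underline\tau)<\delta$. Otherwise let $\underline\tau=z_l$, and $z^*:=z_l$ if Slope$(z_l)\le\delta$. Then, if $z_r=+\infty$, let $\bar\tau=Z$ and report infeasibility and stop if Slope$(\bar\tau)>\delta$. Otherwise let $\bar\tau=z_r$, and $z^*:=z_r$ if Slope$(z_r)\ge\delta$. **Search.** While $\bar\tau-\underline\tau\ge\Delta$ and $z^*$ is not set: let $z=(\underline\tau+\bar\tau)/2$, and let $k^1,k^2,k^3,k^4$ be the difference quotients of $\psi$ between $z$ and $z^1=z-\frac\Delta2$, $z^2=z-\frac\Delta4$, $z^3=z+\frac\Delta4$,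 $z^4=z+\frac\Delta2$. If $k^1=k^2$, $k^3=k^4$ and $k^2\ne k^3$, then set $\underline\tau:=z^4$ if $k^4\ge\delta$; else $\bar\tau:=z^1$ if $k^1<\delta$; else $z^*:=z$. In the other case set $\underline\tau:=z$ if Slope$(z)\ge\delta$, and $\bar\tau:=z$ otherwise. **End.** If $z^*$ is not set, let $\underline k=$ Slope$(\underline\tau)$, $\bar k=$ Slope$(\bar\tau)$ and $z^*:=\dfrac{\psi(\bar\tau)-\psi(\underline\tau)-\bar k\bar\tau+\underline k\,\underline\tau}{\underline k-\bar k}$ (with the convention that a quotient with denominator $0$ is $0$). Solve $(D^{z^*})$, obtaining $y^*$; find a point $(\pi^*,\alpha^*,\beta^*)$ feasible for $(P^{z^*})$ with $\sum_{j\in\bar J}(c_j+\alpha^*_j-\beta^*_j)x^0_j=K$ that satisfies complementary slackness with $(y^*,z^*)$; return $c^*=c+\alpha^*-\beta^*$. **Theorem.** There is an absolute constant $C>0$ such that the following holds for all data as above for which $A$ is unimodular (integer entries, and all minors of order $\operatorname{rank}A$ in $\{0,1,-1\}$) and $x^0,d$ are integral. Whatever solutions the solver for $(D^z)$ and the duality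 steps return where several are possible, the algorithm terminates; if it returns $c^*$, then $c^*$ is an optimal solution of $(\mathrm{RIOVLP}_1)$; if it reports infeasibility, then $(\mathrm{RIOVLP}_1)$ is infeasible; and it solves subproblems $(D^z)$ (feasibility tests included) at most $C\log\mathcal L$ times. -/

import Mathlib

open scoped Matrix

noncomputable section

namespace InverseLP

/-- Data of a restricted inverse optimal value problem: the linear program
`min c x` subject to `A x = b`, `x ≥ 0`, the point `x₀`, the weights `d` and the target value `K`. -/
structure Data (m n : ℕ) where
  A : Matrix (Fin m) (Fin n) ℝ
  b : Fin m → ℝ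
  c : Fin n → ℝ
  d : Fin n → ℝ
  x₀ : Fin n → ℝ
  K : ℝ

/-- Unimodularity of an `m × n` matrix of rank `r`: the entries are integers and every minor of
order `r` is `0`, `1` or `-1`. For full row rank these are the `m × m` minors; every totally
unimodular matrix is unimodular in this sense. -/
def IsUnimodular {m n : ℕ} (A : Matrix (Fin m) (Fin n) ℝ) : Prop :=
  (∀ i j, ∃ k : ℤ, A i j = k) ∧
    ∀ (f : Fin A.rank → Fin m) (g : Fin A.rank → Fin n),
      (A.submatrix f g).det = 0 ∨ (A.submatrix f g).det = 1 ∨ (A.submatrix f g).det = -1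

/-- All entries of a real vector are integers. -/
def IsIntegral {n : ℕ} (v : Fin n → ℝ) : Prop := ∀ j, ∃ k : ℤ, v j = k

/-- A triple `(π, α, β)`. -/
structure DualPoint (m n : ℕ) where
  π : Fin m → ℝ
  α : Fin n → ℝ
  β : Fin n → ℝ

namespace Data

variable {m n : ℕ} (I : Data m n)

/-! ### The inverse problem -/

/-- The feasible region of the linear program. -/
def lpRegion : Set (Fin n → ℝ) := {x | I.A *ᵥ x = I.b ∧ 0 ≤ x}

/-- Feasibility of a cost vector `c'` for the inverse problem: the minimum of `c' x` over the
feasible region of the linear program exists and equals `K`, and `c' x₀ = K`. -/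
def Feasible (c' : Fin n → ℝ) : Prop :=
  IsLeast ((fun x => c' ⬝ᵥ x) '' I.lpRegion) I.K ∧ c' ⬝ᵥ I.x₀ = I.K

/-- The weighted `l₁` distance from `c'` to the original cost vector. -/
def cost (c' : Fin n → ℝ) : ℝ := ∑ j, I.d j * |c' j - I.c j|

/-- `c'` is an optimal solution of the inverse problem. -/
def IsOptimal (c' : Fin n → ℝ) : Prop :=
  I.Feasible c' ∧ ∀ c'', I.Feasible c'' → I.cost c' ≤ I.cost c''

/-! ### Parameters -/

/-- The support of `x₀`. -/
def Jbar : Finset (Fin n) := Finset.univ.filter fun j => 0 < I.x₀ j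

def dMax : ℝ := ⨆ j, I.d j

/-- The largest entry of `x₀` (for `x₀ ≥ 0`, `x₀ ≠ 0`, also the largest entry on the support). -/
def xMax : ℝ := ⨆ j, I.x₀ j

/-- The size parameter `max {d_max, x⁰_max, n}`. -/
def L : ℝ := max (max I.dMax I.xMax) n

def Δ : ℝ := 1 / (2 * (I.Jbar.card : ℝ) * I.xMax) ^ 2

/-- The initial bound `(n + |J̄|) d_max + 1` of the searches. -/
def Z : ℝ := ((n : ℝ) + I.Jbar.card) * I.dMax + 1

def δ : ℝ := (∑ j ∈ I.Jbar, I.c j * I.x₀ j) - I.K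

/-! ### The subproblem `(D^z)` -/

/-- Feasibility for `(D^z)`. -/
def DFeasible (z : ℝ) (y : Fin n → ℝ) : Prop :=
  I.A *ᵥ y = 0 ∧
  (∀ j, I.x₀ j = 0 → -y j ≤ I.d j ∧ y j ≤ I.d j ∧ y j ≤ 0) ∧
  (∀ j, 0 < I.x₀ j → -y j + I.x₀ j * z ≤ I.d j ∧ y j - I.x₀ j * z ≤ I.d j)

/-- `y` is an optimal solution of `(D^z)`: maximize `c y`. -/
def DOptimal (z : ℝ) (y : Fin n → ℝ) : Prop :=
  I.DFeasible z y ∧ ∀ y', I.DFeasible z y' → I.c ⬝ᵥ y' ≤ I.c ⬝ᵥ y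

/-! ### The standard form of `(D^z)`, with variables `X = (y⁺, y⁻, ξ, η)` and `y = y⁺ - y⁻` -/

/-- The coefficient matrix, with rows `(A, -A, 0, 0)`, `(-E, E, E, 0)`, `(E, -E, 0, E)`. -/
def stdMatrix : Matrix (Fin m ⊕ (Fin n ⊕ Fin n)) ((Fin n ⊕ Fin n) ⊕ (Fin n ⊕ Fin n)) ℝ :=
  Matrix.fromBlocks (Matrix.fromCols I.A (-I.A)) 0 (Matrix.fromBlocks (-1) 1 1 (-1)) 1

/-- The right-hand side (on indices with `x₀ j = 0` the second block is `d j`). -/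
def stdRhs (z : ℝ) : Fin m ⊕ (Fin n ⊕ Fin n) → ℝ :=
  Sum.elim 0 (Sum.elim (fun j => I.d j - I.x₀ j * z)
    (fun j => if I.x₀ j = 0 then 0 else I.d j + I.x₀ j * z))

def stdCost : (Fin n ⊕ Fin n) ⊕ (Fin n ⊕ Fin n) → ℝ :=
  Sum.elim (Sum.elim I.c (-I.c)) 0

def StdFeasible (z : ℝ) (X : (Fin n ⊕ Fin n) ⊕ (Fin n ⊕ Fin n) → ℝ) : Prop :=
  I.stdMatrix *ᵥ X = I.stdRhs z ∧ 0 ≤ X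

/-- `S` is a basis: the columns in `S` form a basis of the column space. (If the matrix has
redundant rows this is a basis of the system with the redundant rows deleted.) -/
def IsBasis (S : Finset ((Fin n ⊕ Fin n) ⊕ (Fin n ⊕ Fin n))) : Prop :=
  LinearIndepOn ℝ I.stdMatrix.col (S : Set ((Fin n ⊕ Fin n) ⊕ (Fin n ⊕ Fin n))) ∧
  Submodule.span ℝ (I.stdMatrix.col '' (S : Set ((Fin n ⊕ Fin n) ⊕ (Fin n ⊕ Fin n)))) =
    Submodule.span ℝ (Set.range I.stdMatrix.col)

/-- `X` is the basic solution of the basis `S` at the parameter `z`, and it is optimal. -/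
def IsOptimalBasic (S : Finset ((Fin n ⊕ Fin n) ⊕ (Fin n ⊕ Fin n))) (z : ℝ)
    (X : (Fin n ⊕ Fin n) ⊕ (Fin n ⊕ Fin n) → ℝ) : Prop :=
  I.IsBasis S ∧ (∀ i, i ∉ S → X i = 0) ∧ I.StdFeasible z X ∧
    ∀ X', I.StdFeasible z X' → I.stdCost ⬝ᵥ X' ≤ I.stdCost ⬝ᵥ X

/-- `y⁰`, `y¹` are optimal basic solutions of `(D^{z₀})`, `(D^{z₁})` that belong to the same
basis of the standard form. -/
def OptimalPair (z₀ z₁ : ℝ) (y : (Fin n → ℝ) × (Fin n → ℝ)) : Prop :=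
  ∃ S X₀ X₁, I.IsOptimalBasic S z₀ X₀ ∧ I.IsOptimalBasic S z₁ X₁ ∧
    (∀ j, y.1 j = X₀ (.inl (.inl j)) - X₀ (.inl (.inr j))) ∧
    (∀ j, y.2 j = X₁ (.inl (.inl j)) - X₁ (.inl (.inr j)))

/-! ### Dual solutions by complementary slackness -/

/-- Feasibility for `(P^z)`, the linear programming dual of `(D^z)`. -/
def PFeasible (p : DualPoint m n) : Prop :=
  (∀ j, I.x₀ j = 0 → (p.π ᵥ* I.A) j - p.α j + p.β j ≤ I.c j) ∧
  (∀ j, 0 < I.x₀ j → (p.π ᵥ* I.A) j - p.α j + p.β j = I.c j) ∧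
  (∀ j, 0 ≤ p.α j) ∧ (∀ j, 0 ≤ p.β j)

/-- Complementary slackness of `y` and `(π, α, β)` (recall `x₀ j = 0` off the support). -/
def Complementary (z : ℝ) (y : Fin n → ℝ) (p : DualPoint m n) : Prop :=
  ∀ j, y j * (I.c j - ((p.π ᵥ* I.A) j - p.α j + p.β j)) = 0 ∧
    p.α j * (I.d j + y j - I.x₀ j * z) = 0 ∧
    p.β j * (I.d j - y j + I.x₀ j * z) = 0

/-- `p` is a solution of `(P^z)` obtained from the solution `y` of `(D^z)` by duality. -/
def DualOf (z : ℝ) (y : Fin n → ℝ) (p : DualPoint m n) : Prop :=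
  I.PFeasible p ∧ I.Complementary z y p

/-- `p` is a solution of the linear programming form of the inverse problem
(`min ∑ d_j (α_j + β_j)`, with `c + α - β` as the new cost vector), obtained by duality from the
solution `(y, z)` of the dual of that form. Feasibility for that form is `PFeasible` together
with the equation on the value at `x₀`. -/
def PrimalOf (z : ℝ) (y : Fin n → ℝ) (p : DualPoint m n) : Prop :=
  I.PFeasible p ∧ (∑ j ∈ I.Jbar, (I.c j + p.α j - p.β j) * I.x₀ j = I.K) ∧
    I.Complementary z y p

end Data

/-! ### Computations that count the solved subproblems -/

/-- Partial computations with a counter: the number of subproblems `(D^z)` solved so far. -/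
abbrev Comp (α : Type) : Type := StateT ℕ Part α

/-- Add `k` to the counter and return `a`. -/
def charge {α : Type} (k : ℕ) (a : α) : Comp α := fun t => Part.some (a, t + k)

open Classical in
/-- `while cond do body`; the value is undefined if the loop does not terminate. -/
def whileLoop {σ : Type} (cond : σ → Prop) (body : σ → Comp σ) (s : σ) : Comp σ := fun t =>
  PFun.fix (fun p : σ × ℕ =>
    if cond p.1 then (body p.1 p.2).map Sum.inr else Part.some (Sum.inl p)) (s, t)

/-- The subroutines that the algorithm uses: a solver for `(D^z)`, and the passage to dual
solutions. Each of them returns an object of the requested kind whenever one exists, and is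
arbitrary otherwise. -/
structure Oracle {m n : ℕ} (I : Data m n) where
  /-- an optimal solution of `(D^z)` -/
  solve : ℝ → (Fin n → ℝ)
  solve_spec : ∀ z, (∃ y, I.DOptimal z y) → I.DOptimal z (solve z)
  /-- optimal basic solutions of two subproblems that belong to a common basis -/
  solvePair : ℝ → ℝ → (Fin n → ℝ) × (Fin n → ℝ)
  solvePair_spec : ∀ z₀ z₁, (∃ y, I.OptimalPair z₀ z₁ y) → I.OptimalPair z₀ z₁ (solvePair z₀ z₁)
  dual : ℝ → (Fin n → ℝ) → DualPoint m n
  dual_spec : ∀ z y, (∃ p, I.DualOf z y p) → I.DualOf z y (dual z y)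
  primal : ℝ → (Fin n → ℝ) → DualPoint m n
  primal_spec : ∀ z y, (∃ p, I.PrimalOf z y p) → I.PrimalOf z y (primal z y)

/-- Such subroutines always exist. -/
theorem Oracle.nonempty {m n : ℕ} (I : Data m n) : Nonempty (Oracle I) := by
  have key : ∀ {ι α : Type} [Inhabited α] (P : ι → α → Prop),
      ∃ f : ι → α, ∀ i, (∃ a, P i a) → P i (f i) := by
    intro ι α _ P
    have : ∀ i, ∃ a, (∃ a, P i a) → P i a := by
      intro i
      by_cases h : ∃ a, P i a
      · obtain ⟨a, ha⟩ := h
        exact ⟨a, fun _ => ha⟩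
      · exact ⟨default, fun h' => absurd h' h⟩
    exact Classical.axiomOfChoice this
  have : Inhabited (DualPoint m n) := ⟨⟨0, 0, 0⟩⟩
  obtain ⟨f, hf⟩ := key I.DOptimal
  obtain ⟨g, hg⟩ := key fun (z : ℝ × ℝ) => I.OptimalPair z.1 z.2
  obtain ⟨h, hh⟩ := key fun (z : ℝ × (Fin n → ℝ)) => I.DualOf z.1 z.2
  obtain ⟨k, hk⟩ := key fun (z : ℝ × (Fin n → ℝ)) => I.PrimalOf z.1 z.2
  exact ⟨⟨f, hf, fun a b => g (a, b), fun a b => hg (a, b), fun a b => h (a, b),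
    fun a b => hh (a, b), fun a b => k (a, b), fun a b => hk (a, b)⟩⟩

/-- The answer of the algorithm. -/
inductive Outcome (n : ℕ) where
  | infeasible : Outcome n
  | solution (c' : Fin n → ℝ) : Outcome n

/-- Correctness of an answer for the inverse problem. -/
def Data.Correct {m n : ℕ} (I : Data m n) : Outcome n → Prop
  | .infeasible => ¬ ∃ c', I.Feasible c'
  | .solution c' => I.IsOptimal c'

/-- State of the main search: the interval `[lo, hi]` and the critical value, if found. -/
structure SearchState where
  lo : ℝ
  hi : ℝ
  zstar : Option ℝ

namespace Oracle

variable {m n : ℕ} {I : Data m n} (O : Oracle I)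

open Classical in
/-- Decide whether `(D^z)` is feasible. -/
def test (I : Data m n) (z : ℝ) : Comp Bool := charge 1 (decide (∃ y, I.DFeasible z y))

/-- An optimal solution of `(D^z)`. -/
def sol (z : ℝ) : Comp (Fin n → ℝ) := charge 1 (O.solve z)

/-- The optimal value `ψ(z)` of `(D^z)`. -/
def psi (z : ℝ) : Comp ℝ := do
  let y ← O.sol z
  return I.c ⬝ᵥ y

/-- The least `z` for which the line through `(z₀, y⁰)` and `(z₁, y¹)` satisfies the bounds
of `(D^z)`. A maximum over no indices is `-∞`. -/
def leftTurn (I : Data m n) (z₀ z₁ : ℝ) (y : (Fin n → ℝ) × (Fin n → ℝ)) : EReal :=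
  let k : Fin n → ℝ := fun j => (y.1 j - y.2 j) / (z₀ - z₁)
  (⨆ j : {j // I.x₀ j = 0 ∧ 0 < k j}, (((k j * z₀ - I.d j - y.1 j) / k j : ℝ) : EReal)) ⊔
  (⨆ j : {j // I.x₀ j = 0 ∧ k j < 0}, (((k j * z₀ - y.1 j) / k j : ℝ) : EReal)) ⊔
  (⨆ j : {j // 0 < I.x₀ j ∧ I.x₀ j < k j},
    (((k j * z₀ - I.d j - y.1 j) / (k j - I.x₀ j) : ℝ) : EReal)) ⊔
  (⨆ j : {j // 0 < I.x₀ j ∧ k j < I.x₀ j},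
    (((k j * z₀ + I.d j - y.1 j) / (k j - I.x₀ j) : ℝ) : EReal))

/-- The largest `z` for which the line through `(z₀, y⁰)` and `(z₁, y¹)` satisfies the bounds
of `(D^z)`. A minimum over no indices is `+∞`. -/
def rightTurn (I : Data m n) (z₀ z₁ : ℝ) (y : (Fin n → ℝ) × (Fin n → ℝ)) : EReal :=
  let k : Fin n → ℝ := fun j => (y.1 j - y.2 j) / (z₀ - z₁)
  (⨅ j : {j // I.x₀ j = 0 ∧ 0 < k j}, (((k j * z₀ - y.1 j) / k j : ℝ) : EReal)) ⊓
  (⨅ j : {j // I.x₀ j = 0 ∧ k j < 0}, (((k j * z₀ - I.d j - y.1 j) / k j : ℝ) : EReal)) ⊓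
  (⨅ j : {j // 0 < I.x₀ j ∧ I.x₀ j < k j},
    (((k j * z₀ + I.d j - y.1 j) / (k j - I.x₀ j) : ℝ) : EReal)) ⊓
  (⨅ j : {j // 0 < I.x₀ j ∧ k j < I.x₀ j},
    (((k j * z₀ - I.d j - y.1 j) / (k j - I.x₀ j) : ℝ) : EReal))

/-- The left break point of `ψ` (`-∞` if there is none). -/
def lbp : Comp EReal := do
  if (← test I (-I.Z)) then
    return ⊥
  else
    let s ← whileLoop (fun s : ℝ × ℝ => I.Δ / 2 ≤ s.2 - s.1)
      (fun s => do
        let z := (s.1 + s.2) / 2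
        if (← test I z) then return (s.1, z) else return (z, s.2))
      (-I.Z, 0)
    let z₀ := s.2
    let z₁ := s.2 + I.Δ / 2
    let y ← charge 2 (O.solvePair z₀ z₁)
    return leftTurn I z₀ z₁ y

/-- The right break point of `ψ` (`+∞` if there is none). -/
def rbp : Comp EReal := do
  if (← test I I.Z) then
    return ⊤
  else
    let s ← whileLoop (fun s : ℝ × ℝ => I.Δ / 2 ≤ s.2 - s.1)
      (fun s => do
        let z := (s.1 + s.2) / 2
        if (← test I z) then return (z, s.2) else return (s.1, z))
      (0, I.Z)
    let z₀ := s.1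
    let z₁ := s.1 - I.Δ / 2
    let y ← charge 2 (O.solvePair z₀ z₁)
    return rightTurn I z₀ z₁ y

open Classical in
/-- The slope of `ψ` at `z`: the right slope at the left break point, the left slope at the
right break point. -/
def slope (zl zr : EReal) (z : ℝ) : Comp ℝ := do
  let z' := if (z : EReal) = zl then z + I.Δ / 2 else if (z : EReal) = zr then z - I.Δ / 2 else z
  let y ← O.sol z'
  let p := O.dual z' y
  return ∑ j ∈ I.Jbar, (p.β j - p.α j) * I.x₀ j

open Classical in
/-- Left end of the initial interval, and the critical value if it is found there;
`none` means that the inverse problem is reported infeasible. -/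
def initLeft (zl zr : EReal) : Comp (Option (ℝ × Option ℝ)) := do
  if zl = ⊥ then
    let k ← O.slope zl zr (-I.Z)
    return if k < I.δ then none else some (-I.Z, none)
  else
    let k ← O.slope zl zr zl.toReal
    return some (zl.toReal, if k ≤ I.δ then some zl.toReal else none)

open Classical in
/-- Right end of the initial interval, and the critical value if it has been found (`zs` is the
critical value found so far); `none` means that the inverse problem is reported infeasible. -/
def initRight (zl zr : EReal) (zs : Option ℝ) : Comp (Option (ℝ × Option ℝ)) := do
  if zr = ⊤ then
    let k ← O.slope zl zr I.Z
    return if I.δ < k then none else some (I.Z, zs)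
  else
    let k ← O.slope zl zr zr.toReal
    return some (zr.toReal, if I.δ ≤ k then some zr.toReal else zs)

open Classical in
/-- One iteration of the main search. -/
def searchStep (zl zr : EReal) (s : SearchState) : Comp SearchState := do
  let z := (s.hi + s.lo) / 2
  let z1 := z - I.Δ / 2
  let z2 := z - I.Δ / 4
  let z3 := z + I.Δ / 4
  let z4 := z + I.Δ / 2
  let v ← O.psi z
  let v1 ← O.psi z1
  let v2 ← O.psi z2
  let v3 ← O.psi z3
  let v4 ← O.psi z4
  let k1 := (v - v1) / (z - z1)
  let k2 := (v - v2) / (z - z2)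
  let k3 := (v - v3) / (z - z3)
  let k4 := (v - v4) / (z - z4)
  if k1 = k2 ∧ k3 = k4 ∧ k2 ≠ k3 then
    if I.δ ≤ k4 then return { s with lo := z4 }
    else if k1 < I.δ then return { s with hi := z1 }
    else return { s with zstar := some z }
  else
    let k ← O.slope zl zr z
    if I.δ ≤ k then return { s with lo := z } else return { s with hi := z }

/-- The main search and the computation of the critical value. In the last line a quotient with
denominator `0` is read as `0`. -/
def criticalValue (zl zr : EReal) (s₀ : SearchState) : Comp ℝ := do
  let s ← whileLoop (fun s : SearchState => I.Δ ≤ s.hi - s.lo ∧ s.zstar = none)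
    (O.searchStep zl zr) s₀
  match s.zstar with
  | some z => return z
  | none =>
    let kl ← O.slope zl zr s.lo
    let kh ← O.slope zl zr s.hi
    let vh ← O.psi s.hi
    let vl ← O.psi s.lo
    return (vh - vl - kh * s.hi + kl * s.lo) / (kl - kh)

/-- The algorithm for the restricted inverse optimal value problem. -/
def algorithm : Comp (Outcome n) := do
  let zl ← O.lbp
  let zr ← O.rbp
  match (← O.initLeft zl zr) with
  | none => return .infeasible
  | some (lo, zs) =>
    match (← O.initRight zl zr zs) with
    | none => return .infeasible
    | some (hi, zs') =>
      let z ← O.criticalValue zl zr ⟨lo, hi, zs'⟩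
      let y ← O.sol z
      let p := O.primal z y
      return .solution (I.c + p.α - p.β)

end Oracle

end InverseLP

end

/-!
Put `ψ(z) = max {c y : y feasible for (D^z)}`. The inverse problem is a linear program; dualizing
the single equation on the value at `x₀` with multiplier `z` turns its optimal value into
`max_z (ψ(z) - δ z)`. So a parameter `z` is critical exactly if `δ` is a supergradient of the
concave function `ψ` at `z`, and then complementary slackness with any optimal solution of `(D^z)`
gives an optimal cost vector (`IsSupergradient.exists_primalOf`, `PrimalOf.isOptimal`). All duality
arguments rest on Farkas' lemma (`exists_nonneg_combination_of_forall_nonpos`).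

Unimodularity enters through Cramer's rule: in terms of a column basis every column of `A` has
coordinates `0`, `1`, `-1` (`IsUnimodular.exists_coordinates`). Hence the basic solution of a basis
of the standard form is `P + z Q` with integer vectors `P`, `Q` and `|Q| ≤ |J̄| x⁰_max`
(`IsBasis.exists_affine`), and its entries change sign only at rational numbers with denominator
at most `|J̄| x⁰_max`. Call these the grid; distinct grid points have distance at least `4 Δ`. An
affine minorant that touches a concave function at an interior point of an interval agrees with it
there, so between grid points an optimal basis stays optimal and `ψ` is affine
(`IsOptimalBasic.extend`, `IsSupergradient.value_eq`).

If `b ≠ 0`, the domain of `ψ` is an interval `[zl, zr]` inside `(-Z, Z)` whose ends lie on the grid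
(`exists_isDomain`), and the pairs of basic solutions used by the break point procedures stay on
one affine piece up to `zl` and `zr`. In the search, slopes at least `δ` on the left and less than
`δ` on the right enclose a break point; an interval shorter than `Δ` contains only one grid point
`r`, and the two supporting lines meet above `r` even if one of them was taken at `r` itself
(`isSupergradient_of_intersection`). When the difference quotients reveal a break point at the
midpoint, both of them are supergradients there, and `ψ` is smooth at the neighbouring points.

If `b = 0`, then `y ↦ y + z x₀` identifies the subproblems with each other, `ψ` is affine with slope
`c x₀`, and the inverse problem can be feasible only for `K = 0`. Then `c x₀ = δ`, and every
parameter is critical, whatever the search returns.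

Each loop halves an interval of length at most `2 Z` until it is shorter than `Δ / 2` or `Δ`, and
`Z / Δ` is bounded by a power of `L`.
-/

noncomputable section

namespace InverseLP

/-! ### Farkas' lemma and linear programming duality -/

/-- **Farkas' lemma** for finitely many linear functionals on a real vector space. -/
theorem exists_nonneg_combination_of_forall_nonpos {V ι : Type*} [AddCommGroup V] [Module ℝ V]
    (s : Finset ι) : ∀ (f : ι → V →ₗ[ℝ] ℝ) (g : V →ₗ[ℝ] ℝ),
    (∀ v, (∀ i ∈ s, f i v ≤ 0) → g v ≤ 0) →
    ∃ l : ι → ℝ, (∀ i, 0 ≤ l i) ∧ ∀ v, g v = ∑ i ∈ s, l i * f i v := by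
  classical
  induction s using Finset.induction_on with
  | empty =>
    intro f g h
    refine ⟨0, fun _ => le_rfl, fun v => ?_⟩
    have h1 := h v (by simp)
    have h2 := h (-v) (by simp)
    rw [map_neg] at h2
    simp only [Finset.sum_empty]
    linarith
  | insert a s ha ih =>
    intro f g h
    by_cases hs : ∀ v, (∀ i ∈ s, f i v ≤ 0) → g v ≤ 0
    · obtain ⟨l, hl, hg⟩ := ih f g hs
      refine ⟨fun i => if i = a then 0 else l i, fun i => ?_, fun v => ?_⟩
      · dsimp only
        split_ifs
        exacts [le_rfl, hl i]
      · rw [Finset.sum_insert ha, hg v]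
        simp only [if_pos, zero_mul, zero_add]
        refine Finset.sum_congr rfl fun i hi => ?_
        rw [if_neg (ne_of_mem_of_not_mem hi ha)]
    · -- Project along a vector `w` that violates only the constraint `f a`.
      push Not at hs
      obtain ⟨w, hw, hgw⟩ := hs
      have haw : 0 < f a w := by
        by_contra! hcon
        refine absurd (h w fun i hi => ?_) (not_le.mpr hgw)
        rcases Finset.mem_insert.1 hi with rfl | hi
        exacts [hcon, hw i hi]
      obtain ⟨l, hl, hg⟩ := ih (fun i => f i - (f i w / f a w) • f a) (g - (g w / f a w) • f a) (by
        intro v hv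
        have := h (v - (f a v / f a w) • w) (by
          intro i hi
          rw [map_sub, map_smul, smul_eq_mul]
          rcases Finset.mem_insert.1 hi with rfl | hi
          · rw [div_mul_cancel₀ _ haw.ne', sub_self]
          · have := hv i hi
            simp only [LinearMap.sub_apply, LinearMap.smul_apply, smul_eq_mul] at this
            have e : f i w / f a w * f a v = f a v / f a w * f i w := by ring
            linarith)
        rw [map_sub, map_smul, smul_eq_mul] at this
        simp only [LinearMap.sub_apply, LinearMap.smul_apply, smul_eq_mul]
        have e : g w / f a w * f a v = f a v / f a w * g w := by ring
        linarith)
      refine ⟨fun i => if i = a then (g w - ∑ i ∈ s, l i * f i w) / f a w else l i,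
        fun i => ?_, fun v => ?_⟩
      · dsimp only
        split_ifs
        · refine div_nonneg ?_ haw.le
          have : ∑ i ∈ s, l i * f i w ≤ 0 :=
            Finset.sum_nonpos fun i hi => mul_nonpos_of_nonneg_of_nonpos (hl i) (hw i hi)
          linarith
        · exact hl i
      · rw [Finset.sum_insert ha]
        simp only [if_pos]
        have e : ∑ i ∈ s, (if i = a then (g w - ∑ i ∈ s, l i * f i w) / f a w else l i) * f i v
            = ∑ i ∈ s, l i * f i v :=
          Finset.sum_congr rfl fun i hi => by rw [if_neg (ne_of_mem_of_not_mem hi ha)]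
        rw [e]
        have hv := hg v
        simp only [LinearMap.sub_apply, LinearMap.smul_apply, smul_eq_mul, mul_sub,
          Finset.sum_sub_distrib] at hv
        have e2 : ∑ i ∈ s, l i * (f i w / f a w * f a v)
            = (∑ i ∈ s, l i * f i w) / f a w * f a v := by
          rw [Finset.sum_div, Finset.sum_mul]
          exact Finset.sum_congr rfl fun i _ => by ring
        rw [e2] at hv
        rw [sub_div, sub_mul]
        linarith

namespace Data

variable {m n : ℕ} {I : Data m n}

theorem sum_Jbar (hx : 0 ≤ I.x₀) (f : Fin n → ℝ) :
    ∑ j ∈ I.Jbar, f j * I.x₀ j = ∑ j, f j * I.x₀ j := by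
  unfold Jbar
  rw [Finset.sum_filter]
  refine Finset.sum_congr rfl fun j _ => ?_
  split_ifs with h
  · rfl
  · have := hx j
    simp only [Pi.zero_apply] at this
    rw [le_antisymm (not_lt.1 h) this, mul_zero]

/-- Both cases of the bounds of `(D^z)` imply `|y j - x₀ j * z| ≤ d j`. -/
theorem DFeasible.abs_sub_le (hx : 0 ≤ I.x₀) {z : ℝ} {y : Fin n → ℝ} (h : I.DFeasible z y)
    (j : Fin n) : |y j - I.x₀ j * z| ≤ I.d j := by
  rw [abs_le]
  rcases (hx j).eq_or_lt with h0 | h0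
  · have := h.2.1 j h0.symm
    rw [← h0]
    simp only [Pi.zero_apply]
    constructor <;> linarith
  · have := h.2.2 j h0
    constructor <;> linarith

open Filter Topology in
/-- A direction that respects the active constraints of `(D^z)` can be followed for some time. -/
theorem DFeasible.exists_step (hx : 0 ≤ I.x₀) {z : ℝ} {y : Fin n → ℝ}
    (hy : I.DFeasible z y) {v : Fin n → ℝ} {ζ : ℝ} (hA : I.A *ᵥ v = 0)
    (hlo : ∀ j, I.d j + y j - I.x₀ j * z = 0 → 0 ≤ v j - I.x₀ j * ζ)
    (hhi : ∀ j, I.d j - y j + I.x₀ j * z = 0 → v j - I.x₀ j * ζ ≤ 0)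
    (hJ : ∀ j, I.x₀ j = 0 → y j = 0 → v j ≤ 0) :
    ∃ ε > 0, I.DFeasible (z + ε * ζ) (y + ε • v) := by
  have key : ∀ a b : ℝ, a ≤ 0 → (a = 0 → b ≤ 0) → ∀ᶠ ε in 𝓝[>] (0 : ℝ), a + ε * b ≤ 0 := by
    intro a b ha hab
    rcases ha.eq_or_lt with h0 | h0
    · filter_upwards [self_mem_nhdsWithin] with ε hε
      rw [h0, zero_add]
      exact mul_nonpos_of_nonneg_of_nonpos (le_of_lt hε) (hab h0)
    · have : Tendsto (fun ε : ℝ => a + ε * b) (𝓝 0) (𝓝 (a + 0 * b)) :=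
        (Continuous.tendsto (by fun_prop) 0)
      rw [zero_mul, add_zero] at this
      exact ((this.eventually (gt_mem_nhds h0)).filter_mono nhdsWithin_le_nhds).mono
        fun ε h => le_of_lt h
  have h1 : ∀ᶠ ε in 𝓝[>] (0 : ℝ), ∀ j,
      (-(I.d j + y j - I.x₀ j * z) + ε * -(v j - I.x₀ j * ζ) ≤ 0) ∧
      (-(I.d j - y j + I.x₀ j * z) + ε * (v j - I.x₀ j * ζ) ≤ 0) ∧
      (I.x₀ j = 0 → y j + ε * v j ≤ 0) := by
    rw [eventually_all]
    intro j
    have hb := abs_le.1 (hy.abs_sub_le hx j)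
    refine (key _ _ (by linarith) fun h => ?_).and
      ((key _ _ (by linarith) fun h => ?_).and ?_)
    · have := hlo j (by linarith)
      linarith
    · exact hhi j (by linarith)
    · by_cases h0 : I.x₀ j = 0
      · refine (key _ _ (hy.2.1 j h0).2.2 (hJ j h0)).mono fun ε h _ => h
      · exact Eventually.of_forall fun ε h => absurd h h0
  obtain ⟨ε, h, hε⟩ := (h1.and self_mem_nhdsWithin).exists
  refine ⟨ε, hε, ?_, fun j h0 => ?_, fun j h0 => ?_⟩
  · rw [Matrix.mulVec_add, Matrix.mulVec_smul, hA, hy.1, smul_zero, add_zero]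
  · obtain ⟨ha, hb, hc⟩ := h j
    simp only [h0, zero_mul, sub_zero, add_zero] at ha hb
    simp only [Pi.add_apply, Pi.smul_apply, smul_eq_mul]
    exact ⟨by linarith, by linarith, hc h0⟩
  · obtain ⟨ha, hb, -⟩ := h j
    simp only [Pi.add_apply, Pi.smul_apply, smul_eq_mul]
    exact ⟨by linarith, by linarith⟩

/-- Complementary slackness for the maximization of `c y - κ z` over the feasible pairs `(z, y)`.
If `fixed` holds, the parameter `z` is not allowed to vary and `κ` is irrelevant. -/
theorem exists_dualOf_of_forall_le (hd : ∀ j, 0 < I.d j) (hx : 0 ≤ I.x₀) (fixed : Prop) (κ : ℝ)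
    {z : ℝ} {y : Fin n → ℝ} (hy : I.DFeasible z y)
    (hopt : ∀ w y', (fixed → w = z) → I.DFeasible w y' →
      I.c ⬝ᵥ y' - κ * w ≤ I.c ⬝ᵥ y - κ * z) :
    ∃ p, I.DualOf z y p ∧ (¬ fixed → ∑ j, (p.β j - p.α j) * I.x₀ j = κ) := by
  classical
  let row : Fin m → ((Fin n → ℝ) × ℝ) →ₗ[ℝ] ℝ := fun i =>
    (LinearMap.proj i).comp ((Matrix.mulVecLin I.A).comp (LinearMap.fst ℝ _ _))
  let co : Fin n → ((Fin n → ℝ) × ℝ) →ₗ[ℝ] ℝ := fun j =>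
    (LinearMap.proj j).comp (LinearMap.fst ℝ _ _)
  let pa : ((Fin n → ℝ) × ℝ) →ₗ[ℝ] ℝ := LinearMap.snd ℝ _ _
  let dev : Fin n → ((Fin n → ℝ) × ℝ) →ₗ[ℝ] ℝ := fun j => co j - I.x₀ j • pa
  -- Rows of `A` with either sign, lower bounds, upper bounds, sign constraints off the support,
  -- and the condition on `z` with either sign.
  let f : ((Fin m ⊕ Fin m) ⊕ (Fin n ⊕ (Fin n ⊕ Fin n))) ⊕ Bool → ((Fin n → ℝ) × ℝ) →ₗ[ℝ] ℝ :=
    Sum.elim (Sum.elim (Sum.elim row (-row)) (Sum.elim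
      (fun j => if I.d j + y j - I.x₀ j * z = 0 then -dev j else 0) (Sum.elim
      (fun j => if 0 < I.x₀ j ∧ I.d j - y j + I.x₀ j * z = 0 then dev j else 0)
      (fun j => if I.x₀ j = 0 ∧ y j = 0 then co j else 0))))
      (fun b => if fixed then (if b then pa else -pa) else 0)
  let g : ((Fin n → ℝ) × ℝ) →ₗ[ℝ] ℝ := ∑ j, I.c j • co j - κ • pa
  have hgv : ∀ v ζ, g (v, ζ) = I.c ⬝ᵥ v - κ * ζ := by
    intro v ζ
    simp [g, co, pa, dotProduct]
  obtain ⟨l, hl, hg⟩ := exists_nonneg_combination_of_forall_nonpos Finset.univ f g (by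
    rintro ⟨v, ζ⟩ hv
    have hv' := fun i => hv i (Finset.mem_univ i)
    simp only [Sum.forall] at hv'
    obtain ⟨⟨⟨h1, h2⟩, h3, h4, h5⟩, h6⟩ := hv'
    have hζ : fixed → ζ = 0 := by
      intro hf
      have ht := h6 true
      have ht' := h6 false
      simp [f, hf, pa] at ht ht'
      linarith
    obtain ⟨ε, hε, hfe⟩ := hy.exists_step hx (v := v) (ζ := ζ) (by
        ext i
        have a1 := h1 i
        have a2 := h2 i
        simp [f, row] at a1 a2
        simp only [Pi.zero_apply]
        linarith) (by
        intro j hj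
        have := h3 j
        simp [f, hj, dev, co, pa] at this
        linarith) (by
        intro j hj
        rcases (hx j).eq_or_lt with h0 | h0
        · simp only [Pi.zero_apply] at h0
          have := (hy.2.1 j h0.symm).2.2
          rw [← h0] at hj
          linarith [hd j]
        · have := h4 j
          simp only [Pi.zero_apply] at h0
          simp [f, hj, h0, dev, co, pa] at this
          linarith) (by
        intro j h0 hj
        have := h5 j
        simp [f, hj, h0, co] at this
        linarith)
    have := hopt _ _ (fun hf => by rw [hζ hf]; ring) hfe
    rw [dotProduct_add, dotProduct_smul, smul_eq_mul] at this
    rw [hgv]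
    have : ε * (I.c ⬝ᵥ v - κ * ζ) ≤ 0 := by linarith
    exact nonpos_of_mul_nonpos_right this hε)
  let π : Fin m → ℝ := fun i => l (.inl (.inl (.inl i))) - l (.inl (.inl (.inr i)))
  let α : Fin n → ℝ := fun j => if I.d j + y j - I.x₀ j * z = 0 then
    l (.inl (.inr (.inl j))) else 0
  let β : Fin n → ℝ := fun j => if 0 < I.x₀ j ∧ I.d j - y j + I.x₀ j * z = 0 then
    l (.inl (.inr (.inr (.inl j)))) else 0
  let γ : Fin n → ℝ := fun j => if I.x₀ j = 0 ∧ y j = 0 then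
    l (.inl (.inr (.inr (.inr j)))) else 0
  have hid : ∀ v ζ, I.c ⬝ᵥ v - κ * ζ = π ⬝ᵥ (I.A *ᵥ v) - ∑ j, α j * (v j - I.x₀ j * ζ)
      + ∑ j, β j * (v j - I.x₀ j * ζ) + ∑ j, γ j * v j +
      if fixed then (l (.inr true) - l (.inr false)) * ζ else 0 := by
    intro v ζ
    rw [← hgv, hg (v, ζ)]
    simp only [Fintype.sum_sum_type, Fintype.sum_bool]
    have e1 : π ⬝ᵥ (I.A *ᵥ v) = ∑ i, l (.inl (.inl (.inl i))) * f (.inl (.inl (.inl i))) (v, ζ)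
        + ∑ i, l (.inl (.inl (.inr i))) * f (.inl (.inl (.inr i))) (v, ζ) := by
      rw [← Finset.sum_add_distrib]
      refine Finset.sum_congr rfl fun i _ => ?_
      simp [f, row, π]
      ring
    have e2 : ∑ j, α j * (v j - I.x₀ j * ζ)
        = -∑ j, l (.inl (.inr (.inl j))) * f (.inl (.inr (.inl j))) (v, ζ) := by
      rw [← Finset.sum_neg_distrib]
      refine Finset.sum_congr rfl fun j _ => ?_
      simp only [f, α, dev, co, pa, Sum.elim_inl, Sum.elim_inr]
      split_ifs <;> simp
      ring
    have e3 : ∑ j, β j * (v j - I.x₀ j * ζ)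
        = ∑ j, l (.inl (.inr (.inr (.inl j)))) * f (.inl (.inr (.inr (.inl j)))) (v, ζ) := by
      refine Finset.sum_congr rfl fun j _ => ?_
      simp only [f, β, dev, co, pa, Sum.elim_inl, Sum.elim_inr]
      split_ifs <;> simp
    have e4 : ∑ j, γ j * v j
        = ∑ j, l (.inl (.inr (.inr (.inr j)))) * f (.inl (.inr (.inr (.inr j)))) (v, ζ) := by
      refine Finset.sum_congr rfl fun j _ => ?_
      simp only [f, γ, dev, co, pa, Sum.elim_inl, Sum.elim_inr]
      split_ifs <;> simp
    have e5 : (if fixed then (l (.inr true) - l (.inr false)) * ζ else 0)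
        = l (.inr true) * f (.inr true) (v, ζ) + l (.inr false) * f (.inr false) (v, ζ) := by
      by_cases hf : fixed
      · simp only [f, pa, Sum.elim_inr, hf, if_true, Bool.false_eq_true, if_false,
          LinearMap.snd_apply, LinearMap.neg_apply]
        ring
      · simp [f, hf]
    rw [e1, e2, e3, e4, e5]
    ring
  have hc : ∀ j, I.c j = (π ᵥ* I.A) j - α j + β j + γ j := by
    intro j
    have := hid (Pi.single j 1) 0
    rw [Matrix.dotProduct_mulVec] at this
    simpa [Pi.single_apply, Finset.sum_ite_eq] using this
  have hγ0 : ∀ j, 0 < I.x₀ j → γ j = 0 := fun j h0 => if_neg fun h => h0.ne' h.1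
  have hγ : ∀ j, 0 ≤ γ j := by
    intro j
    simp only [γ]
    split_ifs
    exacts [hl _, le_rfl]
  refine ⟨⟨π, α, β⟩, ⟨⟨fun j _ => ?_, fun j h0 => ?_, fun j => ?_, fun j => ?_⟩, fun j =>
    ⟨?_, ?_, ?_⟩⟩, fun hf => ?_⟩
  · dsimp only
    linarith [hc j, hγ j]
  · dsimp only
    linarith [hc j, hγ0 j h0]
  · simp only [α]
    split_ifs
    exacts [hl _, le_rfl]
  · simp only [β]
    split_ifs
    exacts [hl _, le_rfl]
  · have : I.c j - ((π ᵥ* I.A) j - α j + β j) = γ j := by linarith [hc j]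
    rw [this]
    simp only [γ]
    split_ifs with h
    · rw [h.2, zero_mul]
    · rw [mul_zero]
  · simp only [α]
    split_ifs with h
    · rw [h, mul_zero]
    · rw [zero_mul]
  · simp only [β]
    split_ifs with h
    · rw [h.2, mul_zero]
    · rw [zero_mul]
  · have := hid 0 1
    simp [hf] at this
    simp only [sub_mul, Finset.sum_sub_distrib]
    linarith

theorem DOptimal.exists_dualOf (hd : ∀ j, 0 < I.d j) (hx : 0 ≤ I.x₀) {z : ℝ} {y : Fin n → ℝ}
    (hy : I.DOptimal z y) : ∃ p, I.DualOf z y p := by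
  obtain ⟨p, hp, -⟩ := exists_dualOf_of_forall_le hd hx True 0 hy.1 (by
    rintro w y' hw hy'
    obtain rfl := hw trivial
    linarith [hy.2 y' hy'])
  exact ⟨p, hp⟩

theorem δ_eq (hx : 0 ≤ I.x₀) : I.δ = I.c ⬝ᵥ I.x₀ - I.K := by
  unfold δ
  rw [sum_Jbar hx]
  rfl

theorem primalOf_of_dualOf (hx : 0 ≤ I.x₀) {z : ℝ} {y : Fin n → ℝ} {p : DualPoint m n}
    (hp : I.DualOf z y p) (hs : ∑ j, (p.β j - p.α j) * I.x₀ j = I.δ) : I.PrimalOf z y p := by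
  refine ⟨hp.1, ?_, hp.2⟩
  rw [sum_Jbar hx]
  rw [δ_eq hx, dotProduct] at hs
  simp only [sub_mul, add_mul, Finset.sum_sub_distrib, Finset.sum_add_distrib] at hs ⊢
  linarith

/-- If `(z, y)` maximizes `c y - δ z` over all feasible pairs, the corresponding solution of the
linear programming form of the inverse problem exists. -/
theorem exists_primalOf_of_forall_le (hd : ∀ j, 0 < I.d j) (hx : 0 ≤ I.x₀)
    {z : ℝ} {y : Fin n → ℝ} (hy : I.DFeasible z y)
    (hopt : ∀ w y', I.DFeasible w y' → I.c ⬝ᵥ y' - I.δ * w ≤ I.c ⬝ᵥ y - I.δ * z) :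
    ∃ p, I.PrimalOf z y p := by
  obtain ⟨p, hp, hs⟩ := exists_dualOf_of_forall_le hd hx False I.δ hy
    fun w y' _ h => hopt w y' h
  exact ⟨p, primalOf_of_dualOf hx hp (hs id)⟩

theorem PFeasible.forall_le (hx : 0 ≤ I.x₀) {p : DualPoint m n} (hp : I.PFeasible p)
    (j : Fin n) : (p.π ᵥ* I.A) j - p.α j + p.β j ≤ I.c j := by
  rcases (hx j).eq_or_lt with h0 | h0
  · exact hp.1 j h0.symm
  · exact (hp.2.1 j h0).le

/-- Weak duality between `(D^w)` and `(P^w)`. -/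
theorem PFeasible.dotProduct_le (hx : 0 ≤ I.x₀) {p : DualPoint m n} (hp : I.PFeasible p)
    {w : ℝ} {y : Fin n → ℝ} (hy : I.DFeasible w y) :
    I.c ⬝ᵥ y ≤ ∑ j, I.d j * (p.α j + p.β j) + w * ∑ j, (p.β j - p.α j) * I.x₀ j := by
  have h0 : ∑ j, (p.π ᵥ* I.A) j * y j = 0 := by
    have : p.π ⬝ᵥ (I.A *ᵥ y) = 0 := by rw [hy.1, dotProduct_zero]
    rwa [Matrix.dotProduct_mulVec] at this
  have : I.c ⬝ᵥ y - ∑ j, (p.π ᵥ* I.A) j * y j ≤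
      ∑ j, (I.d j * (p.α j + p.β j) + w * ((p.β j - p.α j) * I.x₀ j)) := by
    rw [dotProduct, ← Finset.sum_sub_distrib]
    refine Finset.sum_le_sum fun j _ => ?_
    have hb := abs_le.1 (hy.abs_sub_le hx j)
    have h1 := mul_nonneg (hp.2.2.1 j) (by linarith [hb.1] : 0 ≤ I.d j + (y j - I.x₀ j * w))
    have h2 := mul_nonneg (hp.2.2.2 j) (by linarith [hb.2] : 0 ≤ I.d j - (y j - I.x₀ j * w))
    have h3 : (I.c j - ((p.π ᵥ* I.A) j - p.α j + p.β j)) * y j ≤ 0 := by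
      rcases (hx j).eq_or_lt with h0 | h0
      · exact mul_nonpos_of_nonneg_of_nonpos (by linarith [hp.1 j h0.symm]) (hy.2.1 j h0.symm).2.2
      · rw [hp.2.1 j h0, sub_self, zero_mul]
    nlinarith
  rw [Finset.sum_add_distrib, ← Finset.mul_sum] at this
  linarith

theorem Complementary.dotProduct_eq {p : DualPoint m n}
    {z : ℝ} {y : Fin n → ℝ} (hA : I.A *ᵥ y = 0) (hc : I.Complementary z y p) :
    I.c ⬝ᵥ y = ∑ j, I.d j * (p.α j + p.β j) + z * ∑ j, (p.β j - p.α j) * I.x₀ j := by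
  have h0 : ∑ j, (p.π ᵥ* I.A) j * y j = 0 := by
    have : p.π ⬝ᵥ (I.A *ᵥ y) = 0 := by rw [hA, dotProduct_zero]
    rwa [Matrix.dotProduct_mulVec] at this
  have : I.c ⬝ᵥ y - ∑ j, (p.π ᵥ* I.A) j * y j =
      ∑ j, (I.d j * (p.α j + p.β j) + z * ((p.β j - p.α j) * I.x₀ j)) := by
    rw [dotProduct, ← Finset.sum_sub_distrib]
    refine Finset.sum_congr rfl fun j _ => ?_
    obtain ⟨h1, h2, h3⟩ := hc j
    linear_combination h1 - h2 - h3
  rw [Finset.sum_add_distrib, ← Finset.mul_sum] at this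
  linarith

/-- The sum returned by the slope procedure is a supergradient of the value function of `(D^z)`. -/
theorem DualOf.dotProduct_le (hx : 0 ≤ I.x₀) {p : DualPoint m n} {z w : ℝ} {y y' : Fin n → ℝ}
    (hy : I.DFeasible z y) (hp : I.DualOf z y p) (hy' : I.DFeasible w y') :
    I.c ⬝ᵥ y' ≤ I.c ⬝ᵥ y + (∑ j, (p.β j - p.α j) * I.x₀ j) * (w - z) := by
  have h1 := hp.1.dotProduct_le hx hy'
  have h2 := hp.2.dotProduct_eq hy.1
  linarith

/-- Every cost vector that is feasible for the inverse problem bounds `c y - δ z` from above. -/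
theorem Feasible.dotProduct_sub_le (hx : I.x₀ ∈ I.lpRegion)
    {c' : Fin n → ℝ} (hc : I.Feasible c') {z : ℝ} {y : Fin n → ℝ} (hy : I.DFeasible z y) :
    I.c ⬝ᵥ y - I.δ * z ≤ I.cost c' := by
  -- `x₀ - ε y` is feasible for the linear program for small `ε > 0`, hence `c' y ≤ 0`.
  have h1 : c' ⬝ᵥ y ≤ 0 := by
    have hstep : ∃ ε > (0 : ℝ), ∀ j, 0 ≤ I.x₀ j - ε * y j := by
      have : ∀ᶠ ε in nhdsWithin (0 : ℝ) (Set.Ioi 0), ∀ j, 0 ≤ I.x₀ j - ε * y j := by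
        rw [Filter.eventually_all]
        intro j
        rcases (hx.2 j).eq_or_lt with h0 | h0
        · filter_upwards [self_mem_nhdsWithin] with ε hε
          have := (hy.2.1 j h0.symm).2.2
          rw [← h0]
          simp only [Pi.zero_apply]
          linarith [mul_nonpos_of_nonneg_of_nonpos (le_of_lt hε) this]
        · have ht : Filter.Tendsto (fun ε : ℝ => I.x₀ j - ε * y j) (nhds 0)
              (nhds (I.x₀ j - 0 * y j)) := Continuous.tendsto (by fun_prop) 0
          rw [zero_mul, sub_zero] at ht
          exact ((ht.eventually (lt_mem_nhds h0)).filter_mono nhdsWithin_le_nhds).mono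
            fun ε h => le_of_lt h
      obtain ⟨ε, h, hε⟩ := (this.and self_mem_nhdsWithin).exists
      exact ⟨ε, hε, h⟩
    obtain ⟨ε, hε, hpos⟩ := hstep
    have hmem : I.x₀ - ε • y ∈ I.lpRegion := by
      refine ⟨?_, hpos⟩
      rw [Matrix.mulVec_sub, Matrix.mulVec_smul, hy.1, hx.1, smul_zero, sub_zero]
    have := hc.1.2 ⟨_, hmem, rfl⟩
    dsimp only at this
    rw [dotProduct_sub, dotProduct_smul, hc.2, smul_eq_mul] at this
    exact nonpos_of_mul_nonpos_right (by linarith : ε * (c' ⬝ᵥ y) ≤ 0) hε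
  have h2 : ∑ j, (I.c j - c' j) * (y j - I.x₀ j * z) ≤ I.cost c' := by
    refine Finset.sum_le_sum fun j _ => ?_
    calc (I.c j - c' j) * (y j - I.x₀ j * z)
      _ ≤ |(I.c j - c' j) * (y j - I.x₀ j * z)| := le_abs_self _
      _ = |c' j - I.c j| * |y j - I.x₀ j * z| := by rw [abs_mul, abs_sub_comm]
      _ ≤ |c' j - I.c j| * I.d j := mul_le_mul_of_nonneg_left (hy.abs_sub_le hx.2 j) (abs_nonneg _)
      _ = _ := mul_comm _ _
  have h3 : ∑ j, (I.c j - c' j) * (y j - I.x₀ j * z) =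
      I.c ⬝ᵥ y - c' ⬝ᵥ y - z * (I.c ⬝ᵥ I.x₀ - c' ⬝ᵥ I.x₀) := by
    simp only [dotProduct, Finset.mul_sum, ← Finset.sum_sub_distrib]
    exact Finset.sum_congr rfl fun j _ => by ring
  rw [h3, hc.2, ← δ_eq hx.2] at h2
  linarith

/-- By complementary slackness the cost of `c + α - β` attains the bound of
`Feasible.dotProduct_sub_le`. -/
theorem PrimalOf.isOptimal (hd : ∀ j, 0 < I.d j) (hx : I.x₀ ∈ I.lpRegion)
    {z : ℝ} {y : Fin n → ℝ} {p : DualPoint m n} (hy : I.DFeasible z y) (hp : I.PrimalOf z y p) :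
    I.IsOptimal (I.c + p.α - p.β) := by
  obtain ⟨hf, hK, hcs⟩ := hp
  have hKx : (I.c + p.α - p.β) ⬝ᵥ I.x₀ = I.K := by
    rw [sum_Jbar hx.2] at hK
    exact hK
  have hπ : p.π ⬝ᵥ I.b = I.K := by
    rw [← hKx, ← hx.1, Matrix.dotProduct_mulVec]
    refine Finset.sum_congr rfl fun j _ => ?_
    rcases (hx.2 j).eq_or_lt with h0 | h0
    · simp only [Pi.zero_apply] at h0
      rw [← h0, mul_zero, mul_zero]
    · have := hf.2.1 j h0
      simp only [Pi.add_apply, Pi.sub_apply, ← this]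
      ring
  refine ⟨⟨⟨⟨I.x₀, hx, hKx⟩, ?_⟩, hKx⟩, fun c'' hc'' => ?_⟩
  · rintro _ ⟨x, hx', rfl⟩
    rw [← hπ, ← hx'.1, Matrix.dotProduct_mulVec]
    refine Finset.sum_le_sum fun j _ => mul_le_mul_of_nonneg_right ?_ (hx'.2 j)
    have := hf.forall_le hx.2 j
    simp only [Pi.add_apply, Pi.sub_apply]
    linarith
  · refine le_trans ?_ (hc''.dotProduct_sub_le hx hy)
    have hs : ∑ j, (p.β j - p.α j) * I.x₀ j = I.δ := by
      have e : (I.c + p.α - p.β) ⬝ᵥ I.x₀ = I.c ⬝ᵥ I.x₀ - ∑ j, (p.β j - p.α j) * I.x₀ j := by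
        simp only [dotProduct, ← Finset.sum_sub_distrib]
        exact Finset.sum_congr rfl fun j _ => by simp only [Pi.add_apply, Pi.sub_apply]; ring
      rw [δ_eq hx.2]
      linarith
    have := hcs.dotProduct_eq hy.1
    rw [hs] at this
    have h : I.cost (I.c + p.α - p.β) ≤ ∑ j, I.d j * (p.α j + p.β j) := by
      refine Finset.sum_le_sum fun j _ => mul_le_mul_of_nonneg_left ?_ (hd j).le
      have ha := hf.2.2.1 j
      have hb := hf.2.2.2 j
      simp only [Pi.add_apply, Pi.sub_apply]
      rw [abs_le]
      constructor <;> linarith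
    linarith

end Data

/-! ### Column bases and unimodular matrices -/

section Columns

variable {ι κ : Type*} [Fintype κ]

theorem mulVec_eq_sum_col (A : Matrix ι κ ℝ) (v : κ → ℝ) : A *ᵥ v = ∑ j, v j • A.col j := by
  ext i
  simp only [Matrix.mulVec, dotProduct, Finset.sum_apply, Pi.smul_apply, smul_eq_mul,
    Matrix.col_apply]
  exact Finset.sum_congr rfl fun j _ => mul_comm _ _

theorem mulVec_eq_sum_col_of_support (A : Matrix ι κ ℝ) {s : Finset κ} {v : κ → ℝ}
    (hv : ∀ j, j ∉ s → v j = 0) : A *ᵥ v = ∑ j ∈ s, v j • A.col j := by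
  rw [mulVec_eq_sum_col]
  refine (Finset.sum_subset (Finset.subset_univ s) fun j _ hj => ?_).symm
  rw [hv j hj, zero_smul]

theorem linearIndepOn_col_iff {A : Matrix ι κ ℝ} {s : Finset κ} :
    LinearIndepOn ℝ A.col (s : Set κ) ↔
      ∀ v : κ → ℝ, (∀ j, j ∉ s → v j = 0) → A *ᵥ v = 0 → v = 0 := by
  classical
  rw [linearIndepOn_finset_iff]
  constructor
  · intro h v hv h0
    rw [mulVec_eq_sum_col_of_support A hv] at h0
    ext j
    by_cases hj : j ∈ s
    exacts [h v h0 j hj, hv j hj]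
  · intro h f hf j hj
    have hsupp : ∀ j, j ∉ s → (fun j => if j ∈ s then f j else 0) j = 0 := fun j hj => if_neg hj
    have := h _ hsupp (by
      rw [mulVec_eq_sum_col_of_support A hsupp, ← hf]
      exact Finset.sum_congr rfl fun j hj => by rw [if_pos hj])
    have := congrFun this j
    simpa only [if_pos hj, Pi.zero_apply] using this

theorem exists_mulVec_eq_of_mem_span {A : Matrix ι κ ℝ} {s : Finset κ} {x : ι → ℝ}
    (hx : x ∈ Submodule.span ℝ (A.col '' (s : Set κ))) :
    ∃ v : κ → ℝ, (∀ j, j ∉ s → v j = 0) ∧ A *ᵥ v = x := by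
  classical
  obtain ⟨c, hc⟩ := (Submodule.mem_span_image_finset_iff_exists_fun ℝ).1 hx
  have hsupp : ∀ j, j ∉ s → (fun j => if h : j ∈ s then c ⟨j, h⟩ else 0) j = 0 :=
    fun j hj => dif_neg hj
  refine ⟨_, hsupp, ?_⟩
  rw [mulVec_eq_sum_col_of_support A hsupp, ← hc, ← Finset.sum_coe_sort s]
  exact Finset.sum_congr rfl fun j _ => by rw [dif_pos j.2]

theorem mulVec_mem_span (A : Matrix ι κ ℝ) (v : κ → ℝ) :
    A *ᵥ v ∈ Submodule.span ℝ (Set.range A.col) := by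
  rw [mulVec_eq_sum_col]
  exact Submodule.sum_mem _ fun j _ => Submodule.smul_mem _ _ (Submodule.subset_span ⟨j, rfl⟩)

/-- Every independent set of columns extends to a column basis. -/
theorem exists_column_basis {A : Matrix ι κ ℝ} {s : Finset κ}
    (hs : LinearIndepOn ℝ A.col (s : Set κ)) :
    ∃ B : Finset κ, s ⊆ B ∧ LinearIndepOn ℝ A.col (B : Set κ) ∧
      Submodule.span ℝ (A.col '' (B : Set κ)) = Submodule.span ℝ (Set.range A.col) := by
  classical
  refine ⟨(hs.extend (Set.subset_univ _)).toFinset, ?_, ?_, ?_⟩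
  · intro j hj
    rw [Set.mem_toFinset]
    exact hs.subset_extend (Set.subset_univ _) hj
  · rw [Set.coe_toFinset]
    exact hs.linearIndepOn_extend _
  · rw [Set.coe_toFinset, hs.span_image_extend_eq_span_image, Set.image_univ]

/-- A matrix with independent columns has a nonsingular square submatrix of the same width. -/
theorem exists_submatrix_isUnit {r : ℕ} [Finite ι] {N : Matrix ι (Fin r) ℝ}
    (hN : LinearIndependent ℝ N.col) : ∃ f : Fin r → ι, IsUnit (N.submatrix f id) := by
  classical
  have := Fintype.ofFinite ι
  obtain ⟨κ', a, ha, hspan, hli⟩ := exists_linearIndependent' ℝ N.row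
  have := Fintype.ofInjective a ha
  have hcard : Fintype.card κ' = r := by
    rw [← finrank_span_eq_card hli, hspan, ← Matrix.rank_eq_finrank_span_row,
      Matrix.rank_eq_finrank_span_cols, finrank_span_eq_card hN, Fintype.card_fin]
  let e : Fin r ≃ κ' := (Fintype.equivFinOfCardEq hcard).symm
  refine ⟨a ∘ e, ?_⟩
  rw [← Matrix.linearIndependent_rows_iff_isUnit]
  exact hli.comp e e.injective

end Columns

/-- In a unimodular matrix the coordinates of the columns with respect to a column basis are
`0`, `1` or `-1`. -/
theorem IsUnimodular.exists_coordinates {m n : ℕ} {A : Matrix (Fin m) (Fin n) ℝ}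
    (hA : IsUnimodular A) {B : Finset (Fin n)} (hB : LinearIndepOn ℝ A.col (B : Set (Fin n)))
    (hspan : Submodule.span ℝ (A.col '' (B : Set (Fin n))) =
      Submodule.span ℝ (Set.range A.col)) :
    ∃ t : Fin n → Fin n → ℤ, (∀ j k, |t j k| ≤ 1) ∧
      ∀ k, A.col k = ∑ j ∈ B, (t j k : ℝ) • A.col j := by
  classical
  have hrange : Set.range (fun j : B => A.col j) = A.col '' (B : Set (Fin n)) := by
    rw [Set.image_eq_range]
    rfl
  have hcard : Fintype.card B = A.rank := by
    rw [Matrix.rank_eq_finrank_span_cols, ← hspan, ← hrange]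
    exact (finrank_span_eq_card hB).symm
  let e : Fin A.rank ≃ B := (Fintype.equivFinOfCardEq hcard).symm
  let g : Fin A.rank → Fin n := fun i => e i
  obtain ⟨f, hf⟩ := exists_submatrix_isUnit (N := A.submatrix id g) (hB.comp e e.injective)
  rw [Matrix.submatrix_submatrix, Function.id_comp, Function.comp_id,
    Matrix.isUnit_iff_isUnit_det, isUnit_iff_ne_zero] at hf
  have key : ∀ k, ∃ s : Fin n → ℤ, (∀ j, |s j| ≤ 1) ∧ A.col k = ∑ j ∈ B, (s j : ℝ) • A.col j := by
    intro k
    have hk : A.col k ∈ Submodule.span ℝ (Set.range fun i => A.col (g i)) := by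
      have : (Set.range fun i => A.col (g i)) = Set.range (fun j : B => A.col j) :=
        e.surjective.range_comp (fun j : B => A.col j)
      rw [this, hrange, hspan]
      exact Submodule.subset_span ⟨k, rfl⟩
    obtain ⟨s, hs⟩ := (Submodule.mem_span_range_iff_exists_fun ℝ).1 hk
    have hmul : A.submatrix f g *ᵥ s = fun i => A (f i) k := by
      ext i
      have := congrFun hs (f i)
      simp only [Finset.sum_apply, Pi.smul_apply, smul_eq_mul, Matrix.col_apply] at this
      rw [← this]
      simp only [Matrix.mulVec, dotProduct, Matrix.submatrix_apply, mul_comm]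
    -- Cramer's rule: the coordinates are quotients of two minors of full order.
    have hcr : ∀ i, (A.submatrix f g).det * s i = (A.submatrix f (Function.update g i k)).det := by
      intro i
      have h1 : (A.submatrix f g).cramer (fun i => A (f i) k) i = (A.submatrix f g).det * s i := by
        rw [Matrix.cramer_eq_adjugate_mulVec, ← hmul, Matrix.mulVec_mulVec, Matrix.adjugate_mul,
          Matrix.smul_mulVec, Matrix.one_mulVec]
        rfl
      rw [← h1, Matrix.cramer_apply]
      congr 1
      ext a b
      by_cases hb : b = i
      · subst hb
        simp
      · simp [hb]
    have hs1 : ∀ i, ∃ a : ℤ, |a| ≤ 1 ∧ s i = a := by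
      intro i
      have h1 := hA.2 f g
      have h2 := hA.2 f (Function.update g i k)
      rw [← hcr i] at h2
      rcases h1 with h1 | h1 | h1
      · exact absurd h1 hf
      · rw [h1, one_mul] at h2
        rcases h2 with h2 | h2 | h2
        exacts [⟨0, by simp, by simpa using h2⟩, ⟨1, by simp, by simpa using h2⟩,
          ⟨-1, by simp, by simpa using h2⟩]
      · rw [h1] at h2
        rcases h2 with h2 | h2 | h2
        exacts [⟨0, by simp, by push_cast; linarith⟩, ⟨-1, by simp, by push_cast; linarith⟩,
          ⟨1, by simp, by push_cast; linarith⟩]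
    choose a ha hsa using hs1
    refine ⟨fun j => if h : j ∈ B then a (e.symm ⟨j, h⟩) else 0, fun j => ?_, ?_⟩
    · dsimp only
      split_ifs
      exacts [ha _, by simp]
    · rw [← hs, ← Finset.sum_coe_sort B, ← e.sum_comp]
      refine Finset.sum_congr rfl fun i _ => ?_
      dsimp only
      rw [dif_pos (e i).2, hsa i]
      simp only [Subtype.coe_eta, Equiv.symm_apply_apply, g]
  choose t ht hcol using key
  exact ⟨fun j k => t k j, fun j k => ht k j, hcol⟩

/-- The kernel of a unimodular matrix: with respect to any column basis containing a given
independent set, the basic coordinates are combinations of the nonbasic ones with coefficients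
`0`, `1` or `-1`. -/
theorem IsUnimodular.exists_reduction {m n : ℕ} {A : Matrix (Fin m) (Fin n) ℝ}
    (hA : IsUnimodular A) {F : Finset (Fin n)} (hF : LinearIndepOn ℝ A.col (F : Set (Fin n))) :
    ∃ (B : Finset (Fin n)) (t : Fin n → Fin n → ℤ), F ⊆ B ∧ (∀ j k, |t j k| ≤ 1) ∧
      ∀ y, A *ᵥ y = 0 ↔ ∀ j ∈ B, y j + ∑ k ∈ Bᶜ, t j k * y k = 0 := by
  classical
  obtain ⟨B, hFB, hB, hspan⟩ := exists_column_basis hF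
  obtain ⟨t, ht, hcol⟩ := hA.exists_coordinates hB hspan
  refine ⟨B, t, hFB, ht, fun y => ?_⟩
  have hy : A *ᵥ y = ∑ j ∈ B, (y j + ∑ k ∈ Bᶜ, t j k * y k) • A.col j := by
    have h1 : ∑ k ∈ Bᶜ, y k • A.col k = ∑ j ∈ B, (∑ k ∈ Bᶜ, (t j k : ℝ) * y k) • A.col j := by
      simp only [Finset.sum_smul]
      rw [Finset.sum_comm]
      refine Finset.sum_congr rfl fun k _ => ?_
      conv_lhs => rw [hcol k, Finset.smul_sum]
      exact Finset.sum_congr rfl fun j _ => by rw [smul_smul, mul_comm]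
    rw [mulVec_eq_sum_col, ← Finset.sum_add_sum_compl B, h1, ← Finset.sum_add_distrib]
    exact Finset.sum_congr rfl fun j _ => by rw [add_smul]
  rw [hy]
  constructor
  · exact fun h => linearIndepOn_finset_iff.1 hB _ h
  · exact fun h => Finset.sum_eq_zero fun j hj => by rw [h j hj, zero_smul]

namespace Data

variable {m n : ℕ} {I : Data m n}

/-! ### The standard form and its basic solutions -/

/-- The vector `y = y⁺ - y⁻` encoded by the variables `(y⁺, y⁻, ξ, η)` of the standard form. -/
def netPart (X : (Fin n ⊕ Fin n) ⊕ (Fin n ⊕ Fin n) → ℝ) (j : Fin n) : ℝ :=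
  X (.inl (.inl j)) - X (.inl (.inr j))

theorem stdMatrix_mulVec_eq_iff {X : (Fin n ⊕ Fin n) ⊕ (Fin n ⊕ Fin n) → ℝ} {l u : Fin n → ℝ} :
    I.stdMatrix *ᵥ X = Sum.elim (0 : Fin m → ℝ) (Sum.elim l u) ↔ I.A *ᵥ netPart X = 0 ∧
      ∀ j, X (.inr (.inl j)) = l j + netPart X j ∧ X (.inr (.inr j)) = u j - netPart X j := by
  have h0 : netPart X = X ∘ Sum.inl ∘ Sum.inl - X ∘ Sum.inl ∘ Sum.inr := rfl
  have h : I.stdMatrix *ᵥ X = Sum.elim (I.A *ᵥ netPart X) (Sum.elim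
      (fun j => X (.inr (.inl j)) - netPart X j) (fun j => X (.inr (.inr j)) + netPart X j)) := by
    unfold stdMatrix
    rw [Matrix.fromBlocks_mulVec, Matrix.fromCols_mulVec, Matrix.fromBlocks_mulVec, h0,
      Matrix.mulVec_sub]
    ext (i | j | j)
    · simp [Matrix.neg_mulVec, Function.comp_def, sub_eq_add_neg]
    · simp [Matrix.neg_mulVec, Function.comp_def]
      ring
    · simp [Matrix.neg_mulVec, Function.comp_def]
      ring
  rw [h]
  constructor
  · intro h
    refine ⟨funext fun i => congrFun h (.inl i), fun j => ⟨?_, ?_⟩⟩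
    · have := congrFun h (.inr (.inl j))
      simp only [Sum.elim_inl, Sum.elim_inr] at this
      linarith
    · have := congrFun h (.inr (.inr j))
      simp only [Sum.elim_inr] at this
      linarith
  · rintro ⟨h1, h2⟩
    ext (i | j | j)
    · exact congrFun h1 i
    · simp only [Sum.elim_inl, Sum.elim_inr]
      linarith [(h2 j).1]
    · simp only [Sum.elim_inr]
      linarith [(h2 j).2]

theorem stdFeasible_iff {z : ℝ} {X : (Fin n ⊕ Fin n) ⊕ (Fin n ⊕ Fin n) → ℝ} :
    I.StdFeasible z X ↔ (I.A *ᵥ netPart X = 0 ∧ ∀ j,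
      X (.inr (.inl j)) = I.d j - I.x₀ j * z + netPart X j ∧
      X (.inr (.inr j)) = (if I.x₀ j = 0 then 0 else I.d j + I.x₀ j * z) - netPart X j) ∧
      0 ≤ X :=
  and_congr_left' stdMatrix_mulVec_eq_iff

theorem stdCost_dotProduct (X : (Fin n ⊕ Fin n) ⊕ (Fin n ⊕ Fin n) → ℝ) :
    I.stdCost ⬝ᵥ X = I.c ⬝ᵥ netPart X := by
  simp only [stdCost, dotProduct, Fintype.sum_sum_type, Sum.elim_inl, Sum.elim_inr, netPart,
    Pi.zero_apply, zero_mul, Finset.sum_const_zero, add_zero, Pi.neg_apply]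
  rw [← Finset.sum_add_distrib]
  exact Finset.sum_congr rfl fun j _ => by ring

theorem StdFeasible.dFeasible (hd : ∀ j, 0 < I.d j) {z : ℝ}
    {X : (Fin n ⊕ Fin n) ⊕ (Fin n ⊕ Fin n) → ℝ} (h : I.StdFeasible z X) :
    I.DFeasible z (netPart X) := by
  obtain ⟨⟨hA, hX⟩, hpos⟩ := stdFeasible_iff.1 h
  refine ⟨hA, fun j h0 => ?_, fun j h0 => ?_⟩
  · obtain ⟨h1, h2⟩ := hX j
    rw [h0, if_pos rfl] at *
    have p1 := hpos (.inr (.inl j))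
    have p2 := hpos (.inr (.inr j))
    simp only [Pi.zero_apply] at p1 p2
    have := hd j
    exact ⟨by linarith, by linarith, by linarith⟩
  · obtain ⟨h1, h2⟩ := hX j
    rw [if_neg h0.ne'] at h2
    have p1 := hpos (.inr (.inl j))
    have p2 := hpos (.inr (.inr j))
    simp only [Pi.zero_apply] at p1 p2
    exact ⟨by linarith, by linarith⟩

theorem DFeasible.exists_stdFeasible (hx : 0 ≤ I.x₀) {z : ℝ} {y : Fin n → ℝ}
    (h : I.DFeasible z y) : ∃ X, I.StdFeasible z X ∧ netPart X = y := by
  let X : (Fin n ⊕ Fin n) ⊕ (Fin n ⊕ Fin n) → ℝ :=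
    Sum.elim (Sum.elim (fun j => max (y j) 0) (fun j => max (-y j) 0))
      (Sum.elim (fun j => I.d j - I.x₀ j * z + y j)
        (fun j => (if I.x₀ j = 0 then 0 else I.d j + I.x₀ j * z) - y j))
  have hX : netPart X = y := by
    ext j
    simp only [netPart, X, Sum.elim_inl, Sum.elim_inr]
    rcases le_total (y j) 0 with h | h
    · rw [max_eq_right h, max_eq_left (by linarith)]
      ring
    · rw [max_eq_left h, max_eq_right (by linarith)]
      ring
  refine ⟨X, stdFeasible_iff.2 ⟨⟨by rw [hX]; exact h.1, fun j => ?_⟩, ?_⟩, hX⟩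
  · rw [hX]
    exact ⟨rfl, rfl⟩
  · rintro ((j | j) | (j | j))
    · exact le_max_right _ _
    · exact le_max_right _ _
    · have := (abs_le.1 (h.abs_sub_le hx j)).1
      simp only [Pi.zero_apply, X, Sum.elim_inl, Sum.elim_inr]
      linarith
    · simp only [Pi.zero_apply, X, Sum.elim_inr]
      split_ifs with h0
      · linarith [(h.2.1 j h0).2.2]
      · linarith [(abs_le.1 (h.abs_sub_le hx j)).2]

theorem isClosed_dFeasible : IsClosed {p : ℝ × (Fin n → ℝ) | I.DFeasible p.1 p.2} := by
  have h : {p : ℝ × (Fin n → ℝ) | I.DFeasible p.1 p.2} =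
      {p | I.A *ᵥ p.2 = 0} ∩
      ((⋂ j, ⋂ (_ : I.x₀ j = 0), {p | -p.2 j ≤ I.d j} ∩ ({p | p.2 j ≤ I.d j} ∩ {p | p.2 j ≤ 0})) ∩
      (⋂ j, ⋂ (_ : 0 < I.x₀ j), {p | -p.2 j + I.x₀ j * p.1 ≤ I.d j} ∩
        {p | p.2 j - I.x₀ j * p.1 ≤ I.d j})) := by
    ext p
    simp only [DFeasible, Set.mem_ofPred_eq, Set.mem_inter_iff, Set.mem_iInter]
  rw [h]
  refine IsClosed.inter (isClosed_eq ?_ continuous_const) (IsClosed.inter ?_ ?_)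
  · exact Continuous.matrix_mulVec continuous_const continuous_snd
  · refine isClosed_iInter fun j => isClosed_iInter fun _ => ?_
    exact (isClosed_le (by fun_prop) (by fun_prop)).inter
      ((isClosed_le (by fun_prop) (by fun_prop)).inter (isClosed_le (by fun_prop) (by fun_prop)))
  · refine isClosed_iInter fun j => isClosed_iInter fun _ => ?_
    exact (isClosed_le (by fun_prop) (by fun_prop)).inter
      (isClosed_le (by fun_prop) (by fun_prop))

theorem DFeasible.exists_dOptimal (hx : 0 ≤ I.x₀) {z : ℝ} {y : Fin n → ℝ}
    (h : I.DFeasible z y) : ∃ y, I.DOptimal z y := by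
  have hcl : IsClosed {y | I.DFeasible z y} :=
    isClosed_dFeasible.preimage (by fun_prop : Continuous fun y : Fin n → ℝ => (z, y))
  have hcomp : IsCompact {y | I.DFeasible z y} := by
    refine (isCompact_Icc (a := fun j => I.x₀ j * z - I.d j)
      (b := fun j => I.x₀ j * z + I.d j)).of_isClosed_subset hcl fun y hy => ?_
    refine ⟨fun j => ?_, fun j => ?_⟩
    · have := (abs_le.1 (hy.abs_sub_le hx j)).1
      dsimp only
      linarith
    · have := (abs_le.1 (hy.abs_sub_le hx j)).2
      dsimp only
      linarith
  obtain ⟨y', hy', hmax⟩ := hcomp.exists_isMaxOn ⟨y, h⟩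
    (f := fun y => I.c ⬝ᵥ y) (by unfold dotProduct; fun_prop)
  exact ⟨y', hy', fun y'' hy'' => hmax hy''⟩

/-- An optimal basic solution of the standard form exists whenever `(D^z)` is feasible: an
optimal solution of minimal support has independent columns. -/
theorem DFeasible.exists_isOptimalBasic (hd : ∀ j, 0 < I.d j) (hx : 0 ≤ I.x₀) {z : ℝ}
    {y : Fin n → ℝ} (h : I.DFeasible z y) : ∃ S X, I.IsOptimalBasic S z X := by
  classical
  let Opt : Set ((Fin n ⊕ Fin n) ⊕ (Fin n ⊕ Fin n) → ℝ) :=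
    {X | I.StdFeasible z X ∧ ∀ X', I.StdFeasible z X' → I.stdCost ⬝ᵥ X' ≤ I.stdCost ⬝ᵥ X}
  have hne : Opt.Nonempty := by
    obtain ⟨y', hy', hmax⟩ := h.exists_dOptimal hx
    obtain ⟨X, hX, rfl⟩ := hy'.exists_stdFeasible hx
    refine ⟨X, hX, fun X' hX' => ?_⟩
    rw [stdCost_dotProduct, stdCost_dotProduct]
    exact hmax _ (hX'.dFeasible hd)
  let supp : ((Fin n ⊕ Fin n) ⊕ (Fin n ⊕ Fin n) → ℝ) → Finset _ :=
    fun X => Finset.univ.filter fun i => X i ≠ 0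
  obtain ⟨X, hX, hmin⟩ := (measure fun X => (supp X).card).wf.has_min Opt hne
  have hind : LinearIndepOn ℝ I.stdMatrix.col (supp X : Set _) := by
    rw [linearIndepOn_col_iff]
    by_contra hcon
    push Not at hcon
    obtain ⟨V, hV, hV0, hVne⟩ := hcon
    have hfeas : ∀ (W : _) (t : ℝ), I.stdMatrix *ᵥ W = 0 → 0 ≤ X + t • W →
        I.StdFeasible z (X + t • W) := by
      intro W t hW hpos
      refine ⟨?_, hpos⟩
      rw [Matrix.mulVec_add, Matrix.mulVec_smul, hW, smul_zero, add_zero, hX.1.1]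
    -- A direction in the kernel that does not decrease the objective and has a negative entry.
    obtain ⟨W, hWs, hW0, hWc, hWneg⟩ : ∃ W, (∀ i, i ∉ supp X → W i = 0) ∧ I.stdMatrix *ᵥ W = 0 ∧
        0 ≤ I.stdCost ⬝ᵥ W ∧ ∃ i, W i < 0 := by
      have main : ∀ V, (∀ i, i ∉ supp X → V i = 0) → I.stdMatrix *ᵥ V = 0 → V ≠ 0 →
          0 ≤ I.stdCost ⬝ᵥ V → ∃ W, (∀ i, i ∉ supp X → W i = 0) ∧ I.stdMatrix *ᵥ W = 0 ∧
          0 ≤ I.stdCost ⬝ᵥ W ∧ ∃ i, W i < 0 := by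
        intro V hV hV0 hVne hc
        by_cases hneg : ∃ i, V i < 0
        · exact ⟨V, hV, hV0, hc, hneg⟩
        · push Not at hneg
          refine ⟨-V, fun i hi => by simp [hV i hi], by simp [Matrix.mulVec_neg, hV0], ?_, ?_⟩
          · have := hX.2 _ (hfeas V 1 hV0 (by
              rw [one_smul]
              exact add_nonneg hX.1.2 hneg))
            rw [one_smul, dotProduct_add] at this
            rw [dotProduct_neg]
            linarith
          · obtain ⟨i, hi⟩ := Function.ne_iff.1 hVne
            exact ⟨i, by simpa using lt_of_le_of_ne (hneg i) (Ne.symm hi)⟩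
      rcases le_total 0 (I.stdCost ⬝ᵥ V) with hc | hc
      · exact main V hV hV0 hVne hc
      · exact main (-V) (fun i hi => by simp [hV i hi]) (by simp [Matrix.mulVec_neg, hV0])
          (neg_ne_zero.2 hVne) (by rw [dotProduct_neg]; linarith)
    obtain ⟨i₁, hi₁⟩ := hWneg
    obtain ⟨i₀, hi₀, hmin₀⟩ := Finset.exists_min_image (Finset.univ.filter fun i => W i < 0)
      (fun i => X i / -W i) ⟨i₁, by simpa using hi₁⟩
    have hW₀ : W i₀ < 0 := by simpa using hi₀
    set t := X i₀ / -W i₀ with ht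
    have ht0 : 0 ≤ t := div_nonneg (hX.1.2 i₀) (by linarith)
    have hpos : 0 ≤ X + t • W := by
      intro i
      simp only [Pi.zero_apply, Pi.add_apply, Pi.smul_apply, smul_eq_mul]
      have hXi := hX.1.2 i
      simp only [Pi.zero_apply] at hXi
      rcases le_or_gt 0 (W i) with hi | hi
      · exact add_nonneg hXi (mul_nonneg ht0 hi)
      · have := hmin₀ i (by simpa using hi)
        rw [le_div_iff₀ (by linarith)] at this
        linarith
    have hopt : X + t • W ∈ Opt := by
      refine ⟨hfeas W t hW0 hpos, fun X' hX' => (hX.2 X' hX').trans ?_⟩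
      rw [dotProduct_add, dotProduct_smul, smul_eq_mul]
      linarith [mul_nonneg ht0 hWc]
    refine hmin _ hopt (Finset.card_lt_card ?_)
    rw [Finset.ssubset_iff_of_subset]
    · refine ⟨i₀, ?_, ?_⟩
      · by_contra hi
        exact hW₀.ne (hWs i₀ hi)
      · simp only [supp, Finset.mem_filter, Finset.mem_univ, true_and, not_not, Pi.add_apply,
          Pi.smul_apply, smul_eq_mul, ht]
        field_simp [hW₀.ne]
        ring
    · intro i hi
      by_contra hcon
      have h1 := hWs i hcon
      have h2 : X i = 0 := by simpa [supp] using hcon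
      simp [supp, h1, h2] at hi
  obtain ⟨S, hsub, hS, hspan⟩ := exists_column_basis hind
  refine ⟨S, X, ⟨hS, hspan⟩, fun i hi => ?_, hX.1, hX.2⟩
  by_contra hne
  exact hi (hsub (by simpa [supp] using hne))

end Data

/-- The standing assumptions on the data. -/
structure Data.Regular {m n : ℕ} (I : Data m n) : Prop where
  pos : 0 < m
  lt : m < n
  unimodular : IsUnimodular I.A
  integral_x₀ : IsIntegral I.x₀
  integral_d : IsIntegral I.d
  d_pos : ∀ j, 0 < I.d j
  mem : I.x₀ ∈ I.lpRegion
  ne_zero : I.x₀ ≠ 0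

namespace Data

variable {m n : ℕ} {I : Data m n}

/-! ### Basic solutions depend on the parameter through small integers -/

theorem le_xMax (j : Fin n) : I.x₀ j ≤ I.xMax :=
  le_ciSup (Set.finite_range I.x₀).bddAbove j

theorem le_dMax (j : Fin n) : I.d j ≤ I.dMax :=
  le_ciSup (Set.finite_range I.d).bddAbove j

theorem sum_x₀_le (hx : 0 ≤ I.x₀) : ∑ j, I.x₀ j ≤ I.Jbar.card * I.xMax := by
  have := sum_Jbar hx (fun _ => 1)
  simp only [one_mul] at this
  rw [← this, ← nsmul_eq_mul]
  exact Finset.sum_le_card_nsmul _ _ _ fun j _ => le_xMax j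

section Basis

variable {S : Finset ((Fin n ⊕ Fin n) ⊕ (Fin n ⊕ Fin n))}

/-- A basis never contains both columns of the pair `(y⁺ j, y⁻ j)`. -/
theorem netPart_cases (hS : LinearIndepOn ℝ I.stdMatrix.col (S : Set _))
    {V : (Fin n ⊕ Fin n) ⊕ (Fin n ⊕ Fin n) → ℝ} (hV : ∀ i, i ∉ S → V i = 0) (j : Fin n) :
    (V (.inl (.inl j)) = netPart V j ∧ V (.inl (.inr j)) = 0) ∨
      (V (.inl (.inl j)) = 0 ∧ V (.inl (.inr j)) = -netPart V j) := by
  classical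
  by_cases h1 : Sum.inl (Sum.inl j) ∈ S
  · by_cases h2 : Sum.inl (Sum.inr j) ∈ S
    · exfalso
      have hind := linearIndepOn_col_iff.1 hS
        (fun i => if i = .inl (.inl j) ∨ i = .inl (.inr j) then 1 else 0) (fun i hi => by
          rw [if_neg]
          rintro (rfl | rfl)
          exacts [hi h1, hi h2])
      have hnet : netPart (n := n)
          (fun i => if i = .inl (.inl j) ∨ i = .inl (.inr j) then (1 : ℝ) else 0) = 0 := by
        ext k
        simp [netPart]
      have := hind (by
        have := (stdMatrix_mulVec_eq_iff (I := I) (l := 0) (u := 0)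
          (X := fun i => if i = .inl (.inl j) ∨ i = .inl (.inr j) then 1 else 0)).2 (by
            rw [hnet]
            exact ⟨Matrix.mulVec_zero _, fun k => by simp⟩)
        rw [this]
        ext (i | i | i) <;> rfl)
      simpa using congrFun this (.inl (.inl j))
    · have := hV _ h2
      exact Or.inl ⟨by rw [netPart, this, sub_zero], this⟩
  · have := hV _ h1
    exact Or.inr ⟨this, by rw [netPart, this, zero_sub, neg_neg]⟩

/-- In a solution supported by a basis, every component of `y` either is pinned (it is `0` or at
a bound) or is a combination of pinned components with coefficients `0`, `1`, `-1`. -/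
theorem exists_pinned (hA : IsUnimodular I.A)
    (hS : LinearIndepOn ℝ I.stdMatrix.col (S : Set _)) :
    ∃ (B : Finset (Fin n)) (t : Fin n → Fin n → ℤ), (∀ j k, |t j k| ≤ 1) ∧
      ∀ (V : (Fin n ⊕ Fin n) ⊕ (Fin n ⊕ Fin n) → ℝ) (l u : Fin n → ℝ),
        (∀ i, i ∉ S → V i = 0) →
        I.stdMatrix *ᵥ V = Sum.elim (0 : Fin m → ℝ) (Sum.elim l u) →
        (∀ j, j ∉ B → netPart V j = 0 ∨ netPart V j = -l j ∨ netPart V j = u j) ∧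
        (∀ j, j ∈ B → netPart V j = -∑ k ∈ Bᶜ, t j k * netPart V k) := by
  classical
  -- The components that are not pinned by the absence of a column from the basis.
  let F : Finset (Fin n) := Finset.univ.filter fun j =>
    (.inl (.inl j) ∈ S ∨ .inl (.inr j) ∈ S) ∧ .inr (.inl j) ∈ S ∧ .inr (.inr j) ∈ S
  have hmem : ∀ j, j ∈ F ↔ (.inl (.inl j) ∈ S ∨ .inl (.inr j) ∈ S) ∧ .inr (.inl j) ∈ S ∧
      .inr (.inr j) ∈ S := fun j => by simp [F]
  have hF : LinearIndepOn ℝ I.A.col (F : Set (Fin n)) := by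
    rw [linearIndepOn_col_iff]
    intro a ha hAa
    let V : (Fin n ⊕ Fin n) ⊕ (Fin n ⊕ Fin n) → ℝ :=
      Sum.elim (Sum.elim (fun j => if .inl (.inl j) ∈ S then a j else 0)
        (fun j => if .inl (.inl j) ∈ S then 0 else -a j)) (Sum.elim a (-a))
    have hnet : netPart V = a := by
      ext j
      simp only [netPart, V, Sum.elim_inl, Sum.elim_inr]
      split_ifs <;> ring
    have hV0 : V = 0 := by
      refine linearIndepOn_col_iff.1 hS V ?_ ?_
      · rintro ((j | j) | (j | j)) hj
        · simp only [V, Sum.elim_inl, if_neg hj]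
        · simp only [V, Sum.elim_inl, Sum.elim_inr]
          split_ifs with h
          · rfl
          · rw [ha j fun hjF => ((hmem j).1 hjF).1.elim h hj, neg_zero]
        · exact ha j fun hjF => hj ((hmem j).1 hjF).2.1
        · change -a j = 0
          rw [ha j fun hjF => hj ((hmem j).1 hjF).2.2, neg_zero]
      · have := (stdMatrix_mulVec_eq_iff (I := I) (X := V) (l := 0) (u := 0)).2
          ⟨by rw [hnet]; exact hAa, fun j => by rw [hnet]; simp [V]⟩
        rw [this]
        ext (i | i | i) <;> rfl
    ext j
    exact congrFun hV0 (.inr (.inl j))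
  obtain ⟨B, t, hFB, ht, hker⟩ := hA.exists_reduction hF
  refine ⟨B, t, ht, fun V l u hV hCV => ?_⟩
  obtain ⟨hAy, hsl⟩ := stdMatrix_mulVec_eq_iff.1 hCV
  refine ⟨fun j hj => ?_, fun j hj => ?_⟩
  · have hjF : j ∉ F := fun h => hj (hFB h)
    rw [hmem, not_and_or, not_and_or, not_or] at hjF
    obtain ⟨h1, h2⟩ := hsl j
    rcases hjF with ⟨ha, hb⟩ | ha | ha
    · left
      rw [netPart, hV _ ha, hV _ hb, sub_zero]
    · right; left
      rw [hV _ ha] at h1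
      linarith
    · right; right
      rw [hV _ ha] at h2
      linarith
  · linarith [(hker _).1 hAy j hj]

theorem IsBasis.exists_solution (hS : I.IsBasis S) (l u : Fin n → ℝ) :
    ∃ V : (Fin n ⊕ Fin n) ⊕ (Fin n ⊕ Fin n) → ℝ, (∀ i, i ∉ S → V i = 0) ∧
      I.stdMatrix *ᵥ V = Sum.elim (0 : Fin m → ℝ) (Sum.elim l u) := by
  apply exists_mulVec_eq_of_mem_span
  rw [hS.2]
  have hnet : netPart (Sum.elim (Sum.elim 0 0) (Sum.elim l u) :
      (Fin n ⊕ Fin n) ⊕ (Fin n ⊕ Fin n) → ℝ) = 0 := by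
    ext j
    simp [netPart]
  have := (stdMatrix_mulVec_eq_iff (I := I) (l := l) (u := u)
    (X := Sum.elim (Sum.elim 0 0) (Sum.elim l u))).2 (by
      rw [hnet]
      exact ⟨Matrix.mulVec_zero _, fun j => by simp⟩)
  rw [← this]
  exact mulVec_mem_span _ _

/-- The basic solution of a basis is an affine function of `z` with integer coefficients, and the
coefficients of `z` are at most `|J̄| x⁰_max`. -/
theorem IsBasis.exists_affine (hI : I.Regular) (hS : I.IsBasis S) :
    ∃ P Q : (Fin n ⊕ Fin n) ⊕ (Fin n ⊕ Fin n) → ℝ, (∀ i, ∃ k : ℤ, P i = k) ∧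
      (∀ i, ∃ k : ℤ, Q i = k) ∧ (∀ i, |Q i| ≤ I.Jbar.card * I.xMax) ∧
      ∀ z X, (∀ i, i ∉ S → X i = 0) ∧ I.stdMatrix *ᵥ X = I.stdRhs z ↔ X = P + z • Q := by
  classical
  let u₀ : Fin n → ℝ := fun j => if I.x₀ j = 0 then 0 else I.d j
  obtain ⟨P, hP, hCP⟩ := hS.exists_solution I.d u₀
  obtain ⟨Q, hQ, hCQ⟩ := hS.exists_solution (-I.x₀) I.x₀
  obtain ⟨B, t, ht, hpin⟩ := exists_pinned hI.unimodular hS.1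
  obtain ⟨hP1, hP2⟩ := hpin P _ _ hP hCP
  obtain ⟨hQ1, hQ2⟩ := hpin Q _ _ hQ hCQ
  have hx := hI.mem.2
  have hu₀ : ∀ j, ∃ k : ℤ, u₀ j = k := by
    intro j
    by_cases h : I.x₀ j = 0
    · exact ⟨0, by simp [u₀, h]⟩
    · simpa only [u₀, if_neg h] using hI.integral_d j
  have extend : ∀ y : Fin n → ℝ, (∀ j, j ∉ B → ∃ k : ℤ, y j = k) →
      (∀ j, j ∈ B → y j = -∑ k ∈ Bᶜ, t j k * y k) → ∀ j, ∃ k : ℤ, y j = k := by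
    intro y h1 h2 j
    by_cases hj : j ∈ B
    · choose! a ha using h1
      refine ⟨-∑ k ∈ Bᶜ, t j k * a k, ?_⟩
      rw [h2 j hj]
      push_cast
      congr 1
      exact Finset.sum_congr rfl fun k hk => by rw [ha k (Finset.mem_compl.1 hk)]
    · exact h1 j hj
  have hPint : ∀ j, ∃ k : ℤ, netPart P j = k := by
    refine extend _ (fun j hj => ?_) hP2
    rcases hP1 j hj with h | h | h
    · exact ⟨0, by simpa using h⟩
    · obtain ⟨k, hk⟩ := hI.integral_d j
      exact ⟨-k, by rw [h, hk]; push_cast; rfl⟩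
    · rw [h]
      exact hu₀ j
  have hQpin : ∀ j, j ∉ B → netPart Q j = 0 ∨ netPart Q j = I.x₀ j := by
    intro j hj
    rcases hQ1 j hj with h | h | h
    · exact Or.inl h
    · exact Or.inr (by rw [h, Pi.neg_apply, neg_neg])
    · exact Or.inr h
  have hQint : ∀ j, ∃ k : ℤ, netPart Q j = k := by
    refine extend _ (fun j hj => ?_) hQ2
    rcases hQpin j hj with h | h
    · exact ⟨0, by simpa using h⟩
    · rw [h]
      exact hI.integral_x₀ j
  have hQle : ∀ j, |netPart Q j| ≤ I.Jbar.card * I.xMax ∧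
      |netPart Q j - I.x₀ j| ≤ I.Jbar.card * I.xMax := by
    intro j
    have hxj := hx j
    simp only [Pi.zero_apply] at hxj
    have hle : I.x₀ j ≤ I.Jbar.card * I.xMax :=
      (Finset.single_le_sum (fun k _ => hx k) (Finset.mem_univ j)).trans (sum_x₀_le hx)
    by_cases hj : j ∈ B
    · have h1 : |netPart Q j| ≤ ∑ k ∈ Bᶜ, I.x₀ k := by
        rw [hQ2 j hj, abs_neg]
        refine (Finset.abs_sum_le_sum_abs _ _).trans (Finset.sum_le_sum fun k hk => ?_)
        have h2 : |(t j k : ℝ)| ≤ 1 := by exact_mod_cast ht j k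
        have h3 : |netPart Q k| ≤ I.x₀ k := by
          rcases hQpin k (Finset.mem_compl.1 hk) with h | h
          · rw [h, abs_zero]
            exact hx k
          · rw [h, abs_of_nonneg (hx k)]
        rw [abs_mul]
        calc _ ≤ 1 * I.x₀ k := mul_le_mul h2 h3 (abs_nonneg _) zero_le_one
          _ = _ := one_mul _
      have h2 : I.x₀ j + ∑ k ∈ Bᶜ, I.x₀ k ≤ ∑ k, I.x₀ k := by
        rw [← Finset.sum_add_sum_compl B]
        have := Finset.single_le_sum (f := I.x₀) (fun k _ => hx k) hj
        linarith
      have h3 := sum_x₀_le hx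
      have h4 := abs_sub (netPart Q j) (I.x₀ j)
      rw [abs_of_nonneg hxj] at h4
      constructor <;> linarith
    · rcases hQpin j hj with h | h
      · rw [h, zero_sub, abs_neg, abs_zero, abs_of_nonneg hxj]
        exact ⟨hxj.trans hle, hle⟩
      · rw [h, sub_self, abs_zero, abs_of_nonneg hxj]
        exact ⟨hle, hxj.trans hle⟩
  have hM : (0 : ℝ) ≤ I.Jbar.card * I.xMax :=
    (Finset.sum_nonneg fun k _ => hx k).trans (sum_x₀_le hx)
  obtain ⟨-, hPs⟩ := stdMatrix_mulVec_eq_iff.1 hCP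
  obtain ⟨-, hQs⟩ := stdMatrix_mulVec_eq_iff.1 hCQ
  refine ⟨P, Q, ?_, ?_, ?_, fun z X => ?_⟩
  · rintro ((j | j) | (j | j))
    · obtain ⟨k, hk⟩ := hPint j
      rcases netPart_cases hS.1 hP j with ⟨h, -⟩ | ⟨h, -⟩
      exacts [⟨k, h.trans hk⟩, ⟨0, by simpa using h⟩]
    · obtain ⟨k, hk⟩ := hPint j
      rcases netPart_cases hS.1 hP j with ⟨-, h⟩ | ⟨-, h⟩
      exacts [⟨0, by simpa using h⟩, ⟨-k, by rw [h, hk]; push_cast; rfl⟩]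
    · obtain ⟨k, hk⟩ := hPint j
      obtain ⟨k', hk'⟩ := hI.integral_d j
      exact ⟨k' + k, by rw [(hPs j).1, hk, hk']; push_cast; rfl⟩
    · obtain ⟨k, hk⟩ := hPint j
      obtain ⟨k', hk'⟩ := hu₀ j
      exact ⟨k' - k, by rw [(hPs j).2, hk, hk']; push_cast; rfl⟩
  · rintro ((j | j) | (j | j))
    · obtain ⟨k, hk⟩ := hQint j
      rcases netPart_cases hS.1 hQ j with ⟨h, -⟩ | ⟨h, -⟩
      exacts [⟨k, h.trans hk⟩, ⟨0, by simpa using h⟩]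
    · obtain ⟨k, hk⟩ := hQint j
      rcases netPart_cases hS.1 hQ j with ⟨-, h⟩ | ⟨-, h⟩
      exacts [⟨0, by simpa using h⟩, ⟨-k, by rw [h, hk]; push_cast; rfl⟩]
    · obtain ⟨k, hk⟩ := hQint j
      obtain ⟨k', hk'⟩ := hI.integral_x₀ j
      exact ⟨-k' + k, by rw [(hQs j).1, hk, Pi.neg_apply, hk']; push_cast; rfl⟩
    · obtain ⟨k, hk⟩ := hQint j
      obtain ⟨k', hk'⟩ := hI.integral_x₀ j
      exact ⟨k' - k, by rw [(hQs j).2, hk, hk']; push_cast; rfl⟩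
  · rintro ((j | j) | (j | j))
    · rcases netPart_cases hS.1 hQ j with ⟨h, -⟩ | ⟨h, -⟩ <;> rw [h]
      exacts [(hQle j).1, by rwa [abs_zero]]
    · rcases netPart_cases hS.1 hQ j with ⟨-, h⟩ | ⟨-, h⟩ <;> rw [h]
      exacts [by rwa [abs_zero], by rw [abs_neg]; exact (hQle j).1]
    · rw [(hQs j).1, Pi.neg_apply, neg_add_eq_sub]
      exact (hQle j).2
    · rw [(hQs j).2, abs_sub_comm]
      exact (hQle j).2
  · have hrhs : I.stdMatrix *ᵥ (P + z • Q) = I.stdRhs z := by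
      rw [Matrix.mulVec_add, Matrix.mulVec_smul, hCP, hCQ]
      ext (i | j | j)
      · simp [stdRhs]
      · simp only [stdRhs, Pi.add_apply, Pi.smul_apply, smul_eq_mul, Sum.elim_inl, Sum.elim_inr,
          Pi.neg_apply]
        ring
      · simp only [stdRhs, Pi.add_apply, Pi.smul_apply, smul_eq_mul, Sum.elim_inr, u₀]
        split_ifs with h
        · rw [h, mul_zero, add_zero]
        · ring
    have hsupp : ∀ i, i ∉ S → (P + z • Q) i = 0 := fun i hi => by
      simp only [Pi.add_apply, Pi.smul_apply, smul_eq_mul, hP i hi, hQ i hi, mul_zero, add_zero]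
    constructor
    · rintro ⟨h1, h2⟩
      refine sub_eq_zero.1 (linearIndepOn_col_iff.1 hS.1 _ (fun i hi => ?_) ?_)
      · rw [Pi.sub_apply, h1 i hi, hsupp i hi, sub_zero]
      · rw [Matrix.mulVec_sub, h2, hrhs, sub_self]
    · rintro rfl
      exact ⟨hsupp, hrhs⟩

end Basis

/-! ### The value function and its break points -/

/-- `(D^z)` is feasible. -/
def FeasibleAt (I : Data m n) (z : ℝ) : Prop := ∃ y, I.DFeasible z y

/-- The optimal value `ψ(z)` of `(D^z)`; meaningful where `(D^z)` is feasible. -/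
def value (I : Data m n) (z : ℝ) : ℝ := ⨆ y : {y // I.DFeasible z y}, I.c ⬝ᵥ y.1

/-- `g` is a supergradient at `z` of the value function on its domain. -/
def IsSupergradient (I : Data m n) (z g : ℝ) : Prop :=
  ∀ w, I.FeasibleAt w → I.value w ≤ I.value z + g * (w - z)

/-- The rational numbers with denominator at most `|J̄| x⁰_max`. They contain all break points of
the value function. -/
def breakGrid (I : Data m n) : Set ℝ :=
  {r | ∃ p q : ℤ, q ≠ 0 ∧ |(q : ℝ)| ≤ I.Jbar.card * I.xMax ∧ r * q = p}

theorem DOptimal.value_eq {z : ℝ} {y : Fin n → ℝ} (h : I.DOptimal z y) :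
    I.value z = I.c ⬝ᵥ y := by
  have : Nonempty {y // I.DFeasible z y} := ⟨⟨y, h.1⟩⟩
  refine le_antisymm (ciSup_le fun y' => h.2 y'.1 y'.2) ?_
  exact le_ciSup (f := fun y : {y // I.DFeasible z y} => I.c ⬝ᵥ y.1)
    ⟨I.c ⬝ᵥ y, by rintro _ ⟨y', rfl⟩; exact h.2 y'.1 y'.2⟩ ⟨y, h.1⟩

theorem FeasibleAt.exists_dOptimal (hI : I.Regular) {z : ℝ} (h : I.FeasibleAt z) :
    ∃ y, I.DOptimal z y :=
  h.elim fun _ hy => hy.exists_dOptimal hI.mem.2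

theorem DFeasible.le_value (hI : I.Regular) {z : ℝ} {y : Fin n → ℝ} (h : I.DFeasible z y) :
    I.c ⬝ᵥ y ≤ I.value z := by
  obtain ⟨y', hy'⟩ := h.exists_dOptimal hI.mem.2
  rw [hy'.value_eq]
  exact hy'.2 y h

theorem DualOf.isSupergradient (hI : I.Regular) {z : ℝ} {y : Fin n → ℝ} {p : DualPoint m n}
    (hy : I.DOptimal z y) (hp : I.DualOf z y p) :
    I.IsSupergradient z (∑ j ∈ I.Jbar, (p.β j - p.α j) * I.x₀ j) := by
  intro w hw
  obtain ⟨y', hy'⟩ := hw.exists_dOptimal hI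
  rw [hy'.value_eq, hy.value_eq, sum_Jbar hI.mem.2 fun j => p.β j - p.α j]
  exact hp.dotProduct_le hI.mem.2 hy.1 hy'.1

theorem FeasibleAt.exists_isSupergradient (hI : I.Regular) {z : ℝ} (h : I.FeasibleAt z) :
    ∃ g, I.IsSupergradient z g := by
  obtain ⟨y, hy⟩ := h.exists_dOptimal hI
  obtain ⟨p, hp⟩ := hy.exists_dualOf hI.d_pos hI.mem.2
  exact ⟨_, hp.isSupergradient hI hy⟩

namespace Regular

theorem exists_one_le_x₀ (hI : I.Regular) : ∃ j, 1 ≤ I.x₀ j := by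
  obtain ⟨j, hj⟩ := Function.ne_iff.1 hI.ne_zero
  obtain ⟨k, hk⟩ := hI.integral_x₀ j
  have h0 := hI.mem.2 j
  simp only [Pi.zero_apply] at hj h0
  refine ⟨j, ?_⟩
  rw [hk] at hj h0 ⊢
  norm_cast at *
  omega

theorem one_le_d (hI : I.Regular) (j : Fin n) : 1 ≤ I.d j := by
  obtain ⟨k, hk⟩ := hI.integral_d j
  have h0 := hI.d_pos j
  rw [hk] at h0 ⊢
  norm_cast at *

theorem one_le_xMax (hI : I.Regular) : 1 ≤ I.xMax := by
  obtain ⟨j, hj⟩ := hI.exists_one_le_x₀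
  exact hj.trans (le_xMax j)

theorem one_le_dMax (hI : I.Regular) : 1 ≤ I.dMax :=
  (hI.one_le_d ⟨0, by have := hI.lt; omega⟩).trans (le_dMax _)

theorem one_le_card_mul (hI : I.Regular) : 1 ≤ (I.Jbar.card : ℝ) * I.xMax := by
  obtain ⟨j, hj⟩ := hI.exists_one_le_x₀
  refine le_trans ?_ (sum_x₀_le hI.mem.2)
  exact hj.trans (Finset.single_le_sum (fun k _ => hI.mem.2 k) (Finset.mem_univ j))

theorem four_mul_Δ (hI : I.Regular) :
    4 * I.Δ * ((I.Jbar.card * I.xMax) * (I.Jbar.card * I.xMax)) = 1 := by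
  have := hI.one_le_card_mul
  unfold Δ
  rw [mul_assoc 2]
  generalize (I.Jbar.card : ℝ) * I.xMax = M at *
  have : M ≠ 0 := by linarith
  field_simp
  norm_num

theorem Δ_pos (hI : I.Regular) : 0 < I.Δ := by
  have h1 := hI.four_mul_Δ
  have h2 := hI.one_le_card_mul
  by_contra! h
  have h3 : 0 ≤ (I.Jbar.card * I.xMax) * (I.Jbar.card * I.xMax) := by positivity
  nlinarith

/-- Distinct points of the grid have distance at least `4 Δ`. -/
theorem breakGrid_separated (hI : I.Regular) {r s : ℝ} (hr : r ∈ I.breakGrid)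
    (hs : s ∈ I.breakGrid) (hrs : r ≠ s) : 4 * I.Δ ≤ |r - s| := by
  obtain ⟨p, q, hq, hqM, hp⟩ := hr
  obtain ⟨p', q', hq', hqM', hp'⟩ := hs
  have hM := hI.one_le_card_mul
  set M : ℝ := I.Jbar.card * I.xMax
  have hq0 : (q : ℝ) ≠ 0 := by exact_mod_cast hq
  have hq0' : (q' : ℝ) ≠ 0 := by exact_mod_cast hq'
  have e : (r - s) * (q * q') = ((p * q' - p' * q : ℤ) : ℝ) := by
    push_cast
    rw [← hp, ← hp']
    ring
  have hne : (p * q' - p' * q : ℤ) ≠ 0 := by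
    intro h
    rw [h, Int.cast_zero] at e
    exact mul_ne_zero (sub_ne_zero.2 hrs) (mul_ne_zero hq0 hq0') e
  have h1 : (1 : ℝ) ≤ |r - s| * (|(q : ℝ)| * |(q' : ℝ)|) := by
    rw [← abs_mul, ← abs_mul, e]
    exact_mod_cast Int.one_le_abs hne
  have h2 : |(q : ℝ)| * |(q' : ℝ)| ≤ M * M :=
    mul_le_mul hqM hqM' (abs_nonneg _) (by linarith)
  have h3 : 1 ≤ |r - s| * (M * M) :=
    h1.trans (mul_le_mul_of_nonneg_left h2 (abs_nonneg _))
  have h4 : 4 * I.Δ * (M * M) = 1 := hI.four_mul_Δ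
  have h5 : 0 < M * M := by positivity
  exact le_of_mul_le_mul_right (by rw [h4]; exact h3) h5

theorem exists_pos_le_abs_sub (hI : I.Regular) {z : ℝ} (hz : z ∉ I.breakGrid) :
    ∃ ε > 0, ∀ r ∈ I.breakGrid, ε ≤ |r - z| := by
  have hΔ := hI.Δ_pos
  by_cases h : ∃ r ∈ I.breakGrid, |r - z| < 2 * I.Δ
  · obtain ⟨r, hr, hrz⟩ := h
    refine ⟨|r - z|, abs_pos.2 (sub_ne_zero.2 fun h => hz (h ▸ hr)), fun s hs => ?_⟩
    by_contra! hlt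
    have hne : r ≠ s := by
      rintro rfl
      exact lt_irrefl _ hlt
    have h1 := hI.breakGrid_separated hr hs hne
    have h2 := abs_sub_le r z s
    rw [abs_sub_comm z s] at h2
    linarith
  · push Not at h
    exact ⟨2 * I.Δ, by linarith, h⟩

end Regular

/-- An affine function with integer coefficients bounded as in `breakGrid` keeps its sign
as long as no grid point is passed. -/
theorem nonneg_of_forall_notMem_uIoo {z w P Q : ℝ} (hP : ∃ k : ℤ, P = k) (hQ : ∃ k : ℤ, Q = k)
    (hQM : |Q| ≤ I.Jbar.card * I.xMax) (hz : z ∉ I.breakGrid)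
    (hvis : ∀ r ∈ I.breakGrid, r ∉ Set.uIoo z w) (h : 0 ≤ P + z * Q) : 0 ≤ P + w * Q := by
  by_contra! hneg
  have hQ0 : Q ≠ 0 := by
    rintro rfl
    linarith
  have hr : -P / Q ∈ I.breakGrid := by
    obtain ⟨p, rfl⟩ := hP
    obtain ⟨q, rfl⟩ := hQ
    exact ⟨-p, q, by exact_mod_cast hQ0, hQM, by rw [div_mul_cancel₀ _ hQ0]; push_cast; rfl⟩
  have hrz : -P / Q ≠ z := fun h => hz (h ▸ hr)
  have hP' : P = -(-P / Q) * Q := by field_simp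
  refine hvis _ hr ?_
  generalize -P / Q = r at *
  rw [hP'] at h hneg
  have h1 : 0 ≤ (z - r) * Q := by linarith
  have h2 : (w - r) * Q < 0 := by linarith
  rcases lt_or_gt_of_ne hQ0 with hQ0 | hQ0
  · have h3 : z ≤ r := by
      by_contra! hc
      nlinarith
    have h4 : r < w := by
      by_contra! hc
      nlinarith
    exact Set.mem_uIoo_of_lt (lt_of_le_of_ne h3 hrz.symm) h4
  · have h3 : r ≤ z := by
      by_contra! hc
      nlinarith
    have h4 : w < r := by
      by_contra! hc
      nlinarith
    exact Set.mem_uIoo_of_gt h4 (lt_of_le_of_ne h3 hrz)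

/-- Between grid points an optimal basis stays optimal, and the value function is affine: its
slope is any supergradient. -/
theorem IsOptimalBasic.extend (hI : I.Regular) {S : Finset ((Fin n ⊕ Fin n) ⊕ (Fin n ⊕ Fin n))}
    {z w g : ℝ} {X : (Fin n ⊕ Fin n) ⊕ (Fin n ⊕ Fin n) → ℝ} (hX : I.IsOptimalBasic S z X)
    (hz : z ∉ I.breakGrid) (hg : I.IsSupergradient z g)
    (hvis : ∀ r ∈ I.breakGrid, r ∉ Set.uIoo z w) :
    I.value w = I.value z + g * (w - z) ∧ ∃ X', I.IsOptimalBasic S w X' := by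
  obtain ⟨hS, hXS, hXf, hXo⟩ := hX
  obtain ⟨P, Q, hP, hQ, hQM, hiff⟩ := hS.exists_affine hI
  obtain rfl := (hiff z X).1 ⟨hXS, hXf.1⟩
  have hval : I.value z = I.stdCost ⬝ᵥ (P + z • Q) := by
    have : I.DOptimal z (netPart (P + z • Q)) := by
      refine ⟨hXf.dFeasible hI.d_pos, fun y' hy' => ?_⟩
      obtain ⟨X', hX', rfl⟩ := hy'.exists_stdFeasible hI.mem.2
      rw [← stdCost_dotProduct, ← stdCost_dotProduct]
      exact hXo X' hX'
    rw [this.value_eq, stdCost_dotProduct]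
  have hcost : ∀ w, I.stdCost ⬝ᵥ (P + w • Q) = I.value z + (I.stdCost ⬝ᵥ Q) * (w - z) := by
    intro w
    rw [hval, dotProduct_add, dotProduct_add, dotProduct_smul, dotProduct_smul, smul_eq_mul,
      smul_eq_mul]
    ring
  have hfeas : ∀ w, (∀ r ∈ I.breakGrid, r ∉ Set.uIoo z w) → I.StdFeasible w (P + w • Q) := by
    intro w hw
    refine ⟨((hiff w _).2 rfl).2, fun i => ?_⟩
    exact nonneg_of_forall_notMem_uIoo (hP i) (hQ i) (hQM i) hz hw (hXf.2 i)
  have hle : ∀ w, (∀ r ∈ I.breakGrid, r ∉ Set.uIoo z w) →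
      I.FeasibleAt w ∧ I.value z + (I.stdCost ⬝ᵥ Q) * (w - z) ≤ I.value w := by
    intro w hw
    have := (hfeas w hw).dFeasible hI.d_pos
    refine ⟨⟨_, this⟩, ?_⟩
    rw [← hcost w, stdCost_dotProduct]
    exact this.le_value hI
  -- The supergradient equals the slope because `z` lies inside an interval without grid points.
  have hs : I.stdCost ⬝ᵥ Q = g := by
    obtain ⟨ε, hε, hfar⟩ := hI.exists_pos_le_abs_sub hz
    have h1 := hle (z + ε) fun r hr hm => by
      rw [Set.uIoo_of_lt (by linarith)] at hm
      have := hfar r hr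
      rw [abs_of_pos (by linarith [hm.1])] at this
      linarith [hm.2]
    have h2 := hle (z - ε) fun r hr hm => by
      rw [Set.uIoo_of_gt (by linarith)] at hm
      have := hfar r hr
      rw [abs_of_neg (by linarith [hm.2])] at this
      linarith [hm.1]
    have h3 := h1.2.trans (hg _ h1.1)
    have h4 := h2.2.trans (hg _ h2.1)
    have h5 : (I.stdCost ⬝ᵥ Q - g) * ε ≤ 0 := by linarith
    have h6 : 0 ≤ (I.stdCost ⬝ᵥ Q - g) * ε := by linarith
    rcases mul_eq_zero.1 (le_antisymm h5 h6) with h | h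
    · linarith
    · exact absurd h hε.ne'
  obtain ⟨hwf, hwv⟩ := hle w hvis
  have hvw : I.value w = I.value z + g * (w - z) :=
    le_antisymm (hg w hwf) (by rw [← hs]; exact hwv)
  refine ⟨hvw, P + w • Q, hS, ((hiff w _).2 rfl).1, hfeas w hvis, fun X' hX' => ?_⟩
  rw [hcost w, hs, ← hvw, stdCost_dotProduct]
  exact (hX'.dFeasible hI.d_pos).le_value hI

/-- The value function is affine between grid points. -/
theorem IsSupergradient.value_eq (hI : I.Regular) {z w g : ℝ} (hf : I.FeasibleAt z)
    (hz : z ∉ I.breakGrid) (hg : I.IsSupergradient z g)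
    (hvis : ∀ r ∈ I.breakGrid, r ∉ Set.uIoo z w) :
    I.FeasibleAt w ∧ I.value w = I.value z + g * (w - z) := by
  obtain ⟨y, hy⟩ := hf
  obtain ⟨S, X, hX⟩ := hy.exists_isOptimalBasic hI.d_pos hI.mem.2
  obtain ⟨h, X', hX'⟩ := hX.extend hI hz hg hvis
  exact ⟨⟨_, hX'.2.2.1.dFeasible hI.d_pos⟩, h⟩

/-- A supergradient remains a supergradient where its affine bound is attained. -/
theorem IsSupergradient.of_value_eq {z w g : ℝ} (hg : I.IsSupergradient z g)
    (h : I.value w = I.value z + g * (w - z)) : I.IsSupergradient w g := by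
  intro x hx
  rw [h]
  linarith [hg x hx]

theorem IsSupergradient.of_le_of_le {z g₁ g₂ g : ℝ} (h₁ : I.IsSupergradient z g₁)
    (h₂ : I.IsSupergradient z g₂) (hg₁ : g₁ ≤ g) (hg₂ : g ≤ g₂) : I.IsSupergradient z g := by
  intro w hw
  rcases le_total z w with h | h
  · refine (h₁ w hw).trans ?_
    have := mul_le_mul_of_nonneg_right hg₁ (sub_nonneg.2 h)
    linarith
  · refine (h₂ w hw).trans ?_
    have := mul_le_mul_of_nonpos_right hg₂ (sub_nonpos.2 h)
    linarith

/-- Off the grid the value function has a unique supergradient. -/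
theorem IsSupergradient.unique (hI : I.Regular) {z g g' : ℝ} (hf : I.FeasibleAt z)
    (hz : z ∉ I.breakGrid) (hg : I.IsSupergradient z g) (hg' : I.IsSupergradient z g') :
    g = g' := by
  obtain ⟨ε, hε, hfar⟩ := hI.exists_pos_le_abs_sub hz
  have hvis : ∀ r ∈ I.breakGrid, r ∉ Set.uIoo z (z + ε) := fun r hr hm => by
    rw [Set.uIoo_of_lt (by linarith)] at hm
    have := hfar r hr
    rw [abs_of_pos (by linarith [hm.1])] at this
    linarith [hm.2]
  have h1 := (hg.value_eq hI hf hz hvis).2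
  have h2 := (hg'.value_eq hI hf hz hvis).2
  have : (g - g') * ε = 0 := by linarith
  rcases mul_eq_zero.1 this with h | h
  · linarith
  · exact absurd h hε.ne'

/-- If `δ` is a supergradient at `z`, the linear programming form of the inverse problem has a
solution that is complementary to any optimal solution of `(D^z)`. -/
theorem IsSupergradient.exists_primalOf (hI : I.Regular) {z : ℝ} {y : Fin n → ℝ}
    (hδ : I.IsSupergradient z I.δ) (hy : I.DOptimal z y) : ∃ p, I.PrimalOf z y p := by
  refine exists_primalOf_of_forall_le hI.d_pos hI.mem.2 hy.1 fun w y' hy' => ?_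
  have h1 := hδ w ⟨y', hy'⟩
  have h2 := hy'.le_value hI
  rw [hy.value_eq] at h1
  linarith

/-! ### The domain of the value function -/

/-- For small `z` the point `0` is feasible. -/
theorem feasibleAt_of_abs_mul_le (hI : I.Regular) {z : ℝ} (hz : |z| * I.xMax ≤ 1) :
    I.FeasibleAt z := by
  have : ∀ j, |I.x₀ j * z| ≤ I.d j := by
    intro j
    rw [abs_mul, abs_of_nonneg (hI.mem.2 j), mul_comm]
    exact ((mul_le_mul_of_nonneg_left (le_xMax j) (abs_nonneg z)).trans hz).trans (hI.one_le_d j)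
  refine ⟨0, Matrix.mulVec_zero _, fun j _ => ?_, fun j _ => ?_⟩
  · have := hI.d_pos j
    simp only [Pi.zero_apply]
    exact ⟨by linarith, by linarith, le_rfl⟩
  · have := abs_le.1 (this j)
    simp only [Pi.zero_apply]
    exact ⟨by linarith, by linarith⟩

theorem FeasibleAt.of_mem_Icc {u v z : ℝ} (hu : I.FeasibleAt u) (hv : I.FeasibleAt v)
    (hz : z ∈ Set.Icc u v) : I.FeasibleAt z := by
  obtain ⟨y, hy⟩ := hu
  obtain ⟨y', hy'⟩ := hv
  rw [← segment_eq_Icc (hz.1.trans hz.2)] at hz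
  obtain ⟨a, b, ha, hb, hab, rfl⟩ := hz
  refine ⟨a • y + b • y', ?_, fun j h0 => ?_, fun j h0 => ?_⟩
  · rw [Matrix.mulVec_add, Matrix.mulVec_smul, Matrix.mulVec_smul, hy.1, hy'.1, smul_zero,
      smul_zero, add_zero]
  · obtain ⟨h1, h2, h3⟩ := hy.2.1 j h0
    obtain ⟨k1, k2, k3⟩ := hy'.2.1 j h0
    simp only [Pi.add_apply, Pi.smul_apply, smul_eq_mul]
    have e : I.d j = a * I.d j + b * I.d j := by rw [← add_mul, hab, one_mul]
    have p1 := mul_le_mul_of_nonneg_left h1 ha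
    have p2 := mul_le_mul_of_nonneg_left h2 ha
    have p3 := mul_le_mul_of_nonneg_left h3 ha
    have q1 := mul_le_mul_of_nonneg_left k1 hb
    have q2 := mul_le_mul_of_nonneg_left k2 hb
    have q3 := mul_le_mul_of_nonneg_left k3 hb
    exact ⟨by linarith, by linarith, by linarith⟩
  · obtain ⟨h1, h2⟩ := hy.2.2 j h0
    obtain ⟨k1, k2⟩ := hy'.2.2 j h0
    simp only [Pi.add_apply, Pi.smul_apply, smul_eq_mul]
    have e : I.d j = a * I.d j + b * I.d j := by rw [← add_mul, hab, one_mul]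
    have p1 := mul_le_mul_of_nonneg_left h1 ha
    have p2 := mul_le_mul_of_nonneg_left h2 ha
    have q1 := mul_le_mul_of_nonneg_left k1 hb
    have q2 := mul_le_mul_of_nonneg_left k2 hb
    exact ⟨by linarith, by linarith⟩

/-- If `b ≠ 0`, the domain of the value function is bounded. -/
theorem FeasibleAt.abs_le (hI : I.Regular) (hb : I.b ≠ 0) {z : ℝ} (h : I.FeasibleAt z) :
    |z| ≤ n * I.dMax := by
  classical
  obtain ⟨y, hy⟩ := h
  obtain ⟨B, t, -, ht, hker⟩ := hI.unimodular.exists_reduction (F := ∅) (by simp)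
  have hx : ¬ I.A *ᵥ I.x₀ = 0 := by
    rw [hI.mem.1]
    exact hb
  rw [hker] at hx
  push Not at hx
  obtain ⟨j, hj, hne⟩ := hx
  -- The reduced row `j` maps `x₀` to a nonzero integer, and `y - z x₀` to `-z` times it.
  have h1 : 1 ≤ |I.x₀ j + ∑ k ∈ Bᶜ, t j k * I.x₀ k| := by
    choose a ha using hI.integral_x₀
    have e : I.x₀ j + ∑ k ∈ Bᶜ, t j k * I.x₀ k = ((a j + ∑ k ∈ Bᶜ, t j k * a k : ℤ) : ℝ) := by
      push_cast
      simp only [ha]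
    rw [e] at hne ⊢
    exact_mod_cast Int.one_le_abs (by exact_mod_cast hne)
  have h2 : (I.x₀ j + ∑ k ∈ Bᶜ, t j k * I.x₀ k) * z =
      -((y j - I.x₀ j * z) + ∑ k ∈ Bᶜ, t j k * (y k - I.x₀ k * z)) := by
    have := (hker y).1 hy.1 j hj
    simp only [mul_sub, Finset.sum_sub_distrib, add_mul, Finset.sum_mul]
    simp only [← mul_assoc] at *
    linarith
  have h3 : |(y j - I.x₀ j * z) + ∑ k ∈ Bᶜ, t j k * (y k - I.x₀ k * z)| ≤ ∑ k, I.d k := by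
    refine (abs_add_le _ _).trans ?_
    have e1 : |∑ k ∈ Bᶜ, t j k * (y k - I.x₀ k * z)| ≤ ∑ k ∈ Bᶜ, I.d k := by
      refine (Finset.abs_sum_le_sum_abs _ _).trans (Finset.sum_le_sum fun k _ => ?_)
      have : |(t j k : ℝ)| ≤ 1 := by exact_mod_cast ht j k
      rw [abs_mul]
      calc _ ≤ 1 * I.d k := mul_le_mul this (hy.abs_sub_le hI.mem.2 k) (abs_nonneg _) zero_le_one
        _ = _ := one_mul _
    have e2 := hy.abs_sub_le hI.mem.2 j
    have e3 := Finset.single_le_sum (f := I.d) (fun k _ => (hI.d_pos k).le) hj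
    rw [← Finset.sum_add_sum_compl B]
    linarith
  have h4 : ∑ k, I.d k ≤ n * I.dMax := by
    have := Finset.sum_le_card_nsmul Finset.univ I.d I.dMax fun k _ => le_dMax k
    rwa [Finset.card_univ, Fintype.card_fin, nsmul_eq_mul] at this
  calc |z| ≤ |I.x₀ j + ∑ k ∈ Bᶜ, t j k * I.x₀ k| * |z| := le_mul_of_one_le_left (abs_nonneg _) h1
    _ = |(y j - I.x₀ j * z) + ∑ k ∈ Bᶜ, t j k * (y k - I.x₀ k * z)| := by
        rw [← abs_mul, h2, abs_neg]
    _ ≤ n * I.dMax := h3.trans h4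

/-- The domain of the value function is the interval `[zl, zr]` with end points on the grid. -/
structure IsDomain (I : Data m n) (zl zr : ℝ) : Prop where
  feasibleAt_iff : ∀ z, I.FeasibleAt z ↔ z ∈ Set.Icc zl zr
  left_mem : zl ∈ I.breakGrid
  right_mem : zr ∈ I.breakGrid
  left_neg : zl < 0
  right_pos : 0 < zr
  neg_Z_lt : -I.Z < zl
  lt_Z : zr < I.Z

theorem exists_isDomain (hI : I.Regular) (hb : I.b ≠ 0) : ∃ zl zr, I.IsDomain zl zr := by
  have hx1 := hI.one_le_xMax
  have hbd : ∀ z, I.FeasibleAt z → -I.Z < z ∧ z < I.Z := by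
    intro z hz
    rw [← abs_lt]
    refine (hz.abs_le hI hb).trans_lt ?_
    unfold Z
    have := mul_nonneg (Nat.cast_nonneg (α := ℝ) I.Jbar.card) (zero_le_one.trans hI.one_le_dMax)
    linarith
  have hcomp : IsCompact {z | I.FeasibleAt z} := by
    have h1 : IsCompact {p : ℝ × (Fin n → ℝ) | I.DFeasible p.1 p.2} := by
      have hbox := (isCompact_Icc (a := -I.Z) (b := I.Z)).prod (isCompact_Icc
        (a := fun j => -(I.d j + I.x₀ j * I.Z)) (b := fun j => I.d j + I.x₀ j * I.Z))
      refine hbox.of_isClosed_subset isClosed_dFeasible ?_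
      rintro ⟨z, y⟩ hy
      have hz := hbd z ⟨y, hy⟩
      refine ⟨⟨hz.1.le, hz.2.le⟩, fun j => ?_, fun j => ?_⟩ <;>
      · have h2 := abs_le.1 (hy.abs_sub_le hI.mem.2 j)
        have h3 := mul_le_mul_of_nonneg_left hz.1.le (hI.mem.2 j)
        have h4 := mul_le_mul_of_nonneg_left hz.2.le (hI.mem.2 j)
        dsimp only at h2 ⊢
        linarith
    have h2 := h1.image continuous_fst
    convert h2 using 1
    ext z
    simp [FeasibleAt]
  have hne : {z | I.FeasibleAt z}.Nonempty := ⟨0, feasibleAt_of_abs_mul_le hI (by simp)⟩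
  obtain ⟨zl, hzl, hmin⟩ := hcomp.exists_isLeast hne
  obtain ⟨zr, hzr, hmax⟩ := hcomp.exists_isGreatest hne
  have hsmall : ∀ s : ℝ, |s| = 1 → I.FeasibleAt (s / I.xMax) := by
    intro s hs
    refine feasibleAt_of_abs_mul_le hI ?_
    rw [abs_div, hs, abs_of_pos (by linarith), div_mul_cancel₀ _ (by linarith)]
  have hoff : ∀ z, I.FeasibleAt z → z ∉ I.breakGrid →
      (∃ w < z, I.FeasibleAt w) ∧ (∃ w > z, I.FeasibleAt w) := by
    intro z hz hzg
    obtain ⟨ε, hε, hfar⟩ := hI.exists_pos_le_abs_sub hzg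
    obtain ⟨g, hg⟩ := hz.exists_isSupergradient hI
    constructor
    · refine ⟨z - ε, by linarith, (hg.value_eq hI hz hzg fun r hr hm => ?_).1⟩
      rw [Set.uIoo_of_gt (by linarith)] at hm
      have := hfar r hr
      rw [abs_of_neg (by linarith [hm.2])] at this
      linarith [hm.1]
    · refine ⟨z + ε, by linarith, (hg.value_eq hI hz hzg fun r hr hm => ?_).1⟩
      rw [Set.uIoo_of_lt (by linarith)] at hm
      have := hfar r hr
      rw [abs_of_pos (by linarith [hm.1])] at this
      linarith [hm.2]
  refine ⟨zl, zr, fun z => ⟨fun h => ⟨hmin h, hmax h⟩, FeasibleAt.of_mem_Icc hzl hzr⟩, ?_, ?_, ?_,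
    ?_, (hbd zl hzl).1, (hbd zr hzr).2⟩
  · by_contra hcon
    obtain ⟨⟨w, hw, hfw⟩, -⟩ := hoff zl hzl hcon
    exact absurd (hmin hfw) (not_le.2 hw)
  · by_contra hcon
    obtain ⟨-, ⟨w, hw, hfw⟩⟩ := hoff zr hzr hcon
    exact absurd (hmax hfw) (not_le.2 hw)
  · refine (hmin (hsmall (-1) (by simp))).trans_lt ?_
    exact div_neg_of_neg_of_pos (by norm_num) (by linarith)
  · refine lt_of_lt_of_le ?_ (hmax (hsmall 1 (by simp)))
    exact div_pos one_pos (by linarith)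

theorem IsDomain.sub_ge (hI : I.Regular) {zl zr : ℝ} (h : I.IsDomain zl zr) :
    4 * I.Δ ≤ zr - zl := by
  have hlt := h.left_neg.trans h.right_pos
  have := hI.breakGrid_separated h.right_mem h.left_mem hlt.ne'
  rwa [abs_of_pos (by linarith)] at this

end Data

/-! ### Terminating computations -/

/-- The computation `c` terminates with the result `a` after solving `k` subproblems. -/
def Computes {α : Type} (c : Comp α) (a : α) (k : ℕ) : Prop := ∀ t, (a, t + k) ∈ c t

namespace Computes

variable {α β σ : Type}

theorem pure (a : α) : Computes (pure a) a 0 := fun _ => Part.mem_some _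

theorem charge (k : ℕ) (a : α) : Computes (charge k a) a k := fun _ => Part.mem_some _

theorem bind {c : Comp α} {f : α → Comp β} {a : α} {b : β} {k l : ℕ} (h : Computes c a k)
    (h' : Computes (f a) b l) : Computes (c >>= f) b (k + l) := by
  intro t
  refine Part.mem_bind (f := c t) (g := fun p => f p.1 p.2) (h t) ?_
  have := h' (t + k)
  rwa [add_assoc] at this

theorem congr {c : Comp α} {a : α} {k l : ℕ} (h : Computes c a k) (e : k = l) :
    Computes c a l := e ▸ h

theorem whileLoop_of_not {cond : σ → Prop} {body : σ → Comp σ} {s : σ} (h : ¬ cond s) :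
    Computes (whileLoop cond body s) s 0 := by
  intro t
  refine PFun.mem_fix_iff.2 (Or.inl ?_)
  simp only [if_neg h]
  exact Part.mem_some _

theorem whileLoop_of {cond : σ → Prop} {body : σ → Comp σ} {s s' s'' : σ} {k l : ℕ} (h : cond s)
    (hb : Computes (body s) s' k) (hl : Computes (whileLoop cond body s') s'' l) :
    Computes (whileLoop cond body s) s'' (k + l) := by
  intro t
  refine PFun.mem_fix_iff.2 (Or.inr ⟨(s', t + k), ?_, ?_⟩)
  · simp only [if_pos h]
    exact Part.mem_map Sum.inr (hb t)
  · have := hl (t + k)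
    rwa [add_assoc] at this

/-- A loop that halves a length in each iteration and stops when the length falls below `D`
takes a logarithmic number of iterations. -/
theorem exists_whileLoop {cond : σ → Prop} {body : σ → Comp σ} (P : σ → Prop) (len : σ → ℝ)
    (D : ℝ) (c₀ : ℕ) (hlen : ∀ s, P s → cond s → D ≤ len s)
    (hstep : ∀ s, P s → cond s → ∃ s' k, Computes (body s) s' k ∧ k ≤ c₀ ∧ P s' ∧
      (cond s' → len s' ≤ len s / 2)) (N : ℕ) :
    ∀ s, P s → (cond s → len s < 2 ^ N * D) →
      ∃ s' k, Computes (whileLoop cond body s) s' k ∧ P s' ∧ ¬ cond s' ∧ k ≤ c₀ * N := by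
  induction N with
  | zero =>
    intro s hs hN
    have hc : ¬ cond s := fun hc => by
      have h1 := hlen s hs hc
      have h2 := hN hc
      rw [pow_zero, one_mul] at h2
      exact absurd h1 (not_le.2 h2)
    exact ⟨s, 0, whileLoop_of_not hc, hs, hc, le_rfl⟩
  | succ N ih =>
    intro s hs hN
    by_cases hc : cond s
    · obtain ⟨s', k, hb, hk, hs', hl⟩ := hstep s hs hc
      have hN' := hN hc
      rw [pow_succ] at hN'
      obtain ⟨s'', k', hw, hs'', hc'', hk'⟩ := ih s' hs' fun hc' => by
        have := hl hc'
        linarith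
      refine ⟨s'', k + k', whileLoop_of hc hb hw, hs'', hc'', ?_⟩
      rw [mul_add_one]
      omega
    · exact ⟨s, 0, whileLoop_of_not hc, hs, hc, Nat.zero_le _⟩

end Computes

/-! ### The turning points of a line of solutions -/

namespace Data

variable {m n : ℕ} {I : Data m n}

/-- The point at parameter `z` of the line through `(z₀, y⁰)` and `(z₁, y¹)`. -/
def linePoint (z₀ z₁ : ℝ) (y : (Fin n → ℝ) × (Fin n → ℝ)) (z : ℝ) : Fin n → ℝ :=
  fun j => y.1 j + (y.1 j - y.2 j) / (z₀ - z₁) * (z - z₀)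

/-- The constraints that bound `z` from below along the line are those collected in `leftTurn`; the
others stay satisfied to the left of a feasible point. -/
theorem leftTurn_eq (hI : I.Regular) {z₀ z₁ zl : ℝ} {y : (Fin n → ℝ) × (Fin n → ℝ)}
    (hA : ∀ z, I.A *ᵥ linePoint z₀ z₁ y z = 0) (hl : I.DFeasible zl (linePoint z₀ z₁ y zl))
    (hlt : ∀ z < zl, ¬ I.FeasibleAt z) : Oracle.leftTurn I z₀ z₁ y = zl := by
  have hl1 := hl.2.1
  have hl2 := hl.2.2
  simp only [linePoint] at hl1 hl2
  apply le_antisymm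
  · simp only [Oracle.leftTurn]
    refine sup_le (sup_le (sup_le ?_ ?_) ?_) ?_ <;> refine iSup_le fun ⟨j, hj, hk⟩ => ?_ <;>
      rw [EReal.coe_le_coe_iff] <;> dsimp only at hk ⊢
    · obtain ⟨h1, -, h3⟩ := hl1 j hj
      rw [div_le_iff₀ hk]
      linarith
    · obtain ⟨h1, -, h3⟩ := hl1 j hj
      rw [div_le_iff_of_neg hk]
      linarith
    · obtain ⟨h1, h2⟩ := hl2 j hj
      rw [div_le_iff₀ (by linarith)]
      linarith
    · obtain ⟨h1, h2⟩ := hl2 j hj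
      rw [div_le_iff_of_neg (by linarith)]
      linarith
  · by_contra! hcon
    obtain ⟨z, hz1, hz2⟩ := EReal.lt_iff_exists_real_btwn.1 hcon
    rw [EReal.coe_lt_coe_iff] at hz2
    simp only [Oracle.leftTurn, sup_lt_iff] at hz1
    obtain ⟨⟨⟨t1, t2⟩, t3⟩, t4⟩ := hz1
    refine hlt z hz2 ⟨linePoint z₀ z₁ y z, hA z, fun j hj => ?_, fun j hj => ?_⟩
    · have hd := hI.d_pos j
      obtain ⟨h1, -, h3⟩ := hl1 j hj
      have u1 : 0 < (y.1 j - y.2 j) / (z₀ - z₁) →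
          ((y.1 j - y.2 j) / (z₀ - z₁) * z₀ - I.d j - y.1 j) / ((y.1 j - y.2 j) / (z₀ - z₁)) < z :=
        fun hk => EReal.coe_lt_coe_iff.1 (lt_of_le_of_lt (le_iSup_of_le ⟨j, hj, hk⟩ le_rfl) t1)
      have u2 : (y.1 j - y.2 j) / (z₀ - z₁) < 0 →
          ((y.1 j - y.2 j) / (z₀ - z₁) * z₀ - y.1 j) / ((y.1 j - y.2 j) / (z₀ - z₁)) < z :=
        fun hk => EReal.coe_lt_coe_iff.1 (lt_of_le_of_lt (le_iSup_of_le ⟨j, hj, hk⟩ le_rfl) t2)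
      simp only [linePoint]
      generalize (y.1 j - y.2 j) / (z₀ - z₁) = k at *
      have : -(y.1 j + k * (z - z₀)) ≤ I.d j ∧ y.1 j + k * (z - z₀) ≤ 0 := by
        rcases lt_trichotomy k 0 with hk | hk | hk
        · have := u2 hk
          rw [div_lt_iff_of_neg hk] at this
          have := mul_lt_mul_of_neg_left hz2 hk
          constructor <;> linarith
        · subst hk
          constructor <;> linarith
        · have := u1 hk
          rw [div_lt_iff₀ hk] at this
          have := mul_lt_mul_of_pos_left hz2 hk
          constructor <;> linarith
      exact ⟨this.1, by linarith, this.2⟩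
    · obtain ⟨h1, h3⟩ := hl2 j hj
      have u1 : I.x₀ j < (y.1 j - y.2 j) / (z₀ - z₁) →
          ((y.1 j - y.2 j) / (z₀ - z₁) * z₀ - I.d j - y.1 j) /
            ((y.1 j - y.2 j) / (z₀ - z₁) - I.x₀ j) < z :=
        fun hk => EReal.coe_lt_coe_iff.1 (lt_of_le_of_lt (le_iSup_of_le ⟨j, hj, hk⟩ le_rfl) t3)
      have u2 : (y.1 j - y.2 j) / (z₀ - z₁) < I.x₀ j →
          ((y.1 j - y.2 j) / (z₀ - z₁) * z₀ + I.d j - y.1 j) /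
            ((y.1 j - y.2 j) / (z₀ - z₁) - I.x₀ j) < z :=
        fun hk => EReal.coe_lt_coe_iff.1 (lt_of_le_of_lt (le_iSup_of_le ⟨j, hj, hk⟩ le_rfl) t4)
      simp only [linePoint]
      generalize (y.1 j - y.2 j) / (z₀ - z₁) = k at *
      rcases lt_trichotomy k (I.x₀ j) with hk | hk | hk
      · have := u2 hk
        rw [div_lt_iff_of_neg (by linarith)] at this
        have := mul_lt_mul_of_neg_left hz2 (sub_neg.2 hk)
        constructor <;> linarith
      · subst hk
        constructor <;> linarith
      · have := u1 hk
        rw [div_lt_iff₀ (by linarith)] at this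
        have := mul_lt_mul_of_pos_left hz2 (sub_pos.2 hk)
        constructor <;> linarith

theorem rightTurn_eq (hI : I.Regular) {z₀ z₁ zr : ℝ} {y : (Fin n → ℝ) × (Fin n → ℝ)}
    (hA : ∀ z, I.A *ᵥ linePoint z₀ z₁ y z = 0) (hr : I.DFeasible zr (linePoint z₀ z₁ y zr))
    (hgt : ∀ z > zr, ¬ I.FeasibleAt z) : Oracle.rightTurn I z₀ z₁ y = zr := by
  have hl1 := hr.2.1
  have hl2 := hr.2.2
  simp only [linePoint] at hl1 hl2
  apply le_antisymm
  · by_contra! hcon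
    obtain ⟨z, hz2, hz1⟩ := EReal.lt_iff_exists_real_btwn.1 hcon
    rw [EReal.coe_lt_coe_iff] at hz2
    simp only [Oracle.rightTurn, lt_inf_iff] at hz1
    obtain ⟨⟨⟨t1, t2⟩, t3⟩, t4⟩ := hz1
    refine hgt z hz2 ⟨linePoint z₀ z₁ y z, hA z, fun j hj => ?_, fun j hj => ?_⟩
    · have hd := hI.d_pos j
      obtain ⟨h1, -, h3⟩ := hl1 j hj
      have u1 : 0 < (y.1 j - y.2 j) / (z₀ - z₁) →
          z < ((y.1 j - y.2 j) / (z₀ - z₁) * z₀ - y.1 j) / ((y.1 j - y.2 j) / (z₀ - z₁)) :=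
        fun hk => EReal.coe_lt_coe_iff.1 (lt_of_lt_of_le t1 (iInf_le_of_le ⟨j, hj, hk⟩ le_rfl))
      have u2 : (y.1 j - y.2 j) / (z₀ - z₁) < 0 →
          z < ((y.1 j - y.2 j) / (z₀ - z₁) * z₀ - I.d j - y.1 j) / ((y.1 j - y.2 j) / (z₀ - z₁)) :=
        fun hk => EReal.coe_lt_coe_iff.1 (lt_of_lt_of_le t2 (iInf_le_of_le ⟨j, hj, hk⟩ le_rfl))
      simp only [linePoint]
      generalize (y.1 j - y.2 j) / (z₀ - z₁) = k at *
      have : -(y.1 j + k * (z - z₀)) ≤ I.d j ∧ y.1 j + k * (z - z₀) ≤ 0 := by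
        rcases lt_trichotomy k 0 with hk | hk | hk
        · have := u2 hk
          rw [lt_div_iff_of_neg hk] at this
          have := mul_lt_mul_of_neg_left hz2 hk
          constructor <;> linarith
        · subst hk
          constructor <;> linarith
        · have := u1 hk
          rw [lt_div_iff₀ hk] at this
          have := mul_lt_mul_of_pos_left hz2 hk
          constructor <;> linarith
      exact ⟨this.1, by linarith, this.2⟩
    · obtain ⟨h1, h3⟩ := hl2 j hj
      have u1 : I.x₀ j < (y.1 j - y.2 j) / (z₀ - z₁) →
          z < ((y.1 j - y.2 j) / (z₀ - z₁) * z₀ + I.d j - y.1 j) /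
            ((y.1 j - y.2 j) / (z₀ - z₁) - I.x₀ j) :=
        fun hk => EReal.coe_lt_coe_iff.1 (lt_of_lt_of_le t3 (iInf_le_of_le ⟨j, hj, hk⟩ le_rfl))
      have u2 : (y.1 j - y.2 j) / (z₀ - z₁) < I.x₀ j →
          z < ((y.1 j - y.2 j) / (z₀ - z₁) * z₀ - I.d j - y.1 j) /
            ((y.1 j - y.2 j) / (z₀ - z₁) - I.x₀ j) :=
        fun hk => EReal.coe_lt_coe_iff.1 (lt_of_lt_of_le t4 (iInf_le_of_le ⟨j, hj, hk⟩ le_rfl))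
      simp only [linePoint]
      generalize (y.1 j - y.2 j) / (z₀ - z₁) = k at *
      rcases lt_trichotomy k (I.x₀ j) with hk | hk | hk
      · have := u2 hk
        rw [lt_div_iff_of_neg (by linarith)] at this
        have := mul_lt_mul_of_neg_left hz2 (sub_neg.2 hk)
        constructor <;> linarith
      · subst hk
        constructor <;> linarith
      · have := u1 hk
        rw [lt_div_iff₀ (by linarith)] at this
        have := mul_lt_mul_of_pos_left hz2 (sub_pos.2 hk)
        constructor <;> linarith
  · simp only [Oracle.rightTurn]
    refine le_inf (le_inf (le_inf ?_ ?_) ?_) ?_ <;> refine le_iInf fun ⟨j, hj, hk⟩ => ?_ <;>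
      rw [EReal.coe_le_coe_iff] <;> dsimp only at hk ⊢
    · obtain ⟨h1, -, h3⟩ := hl1 j hj
      rw [le_div_iff₀ hk]
      linarith
    · obtain ⟨h1, -, h3⟩ := hl1 j hj
      rw [le_div_iff_of_neg hk]
      linarith
    · obtain ⟨h1, h2⟩ := hl2 j hj
      rw [le_div_iff₀ (by linarith)]
      linarith
    · obtain ⟨h1, h2⟩ := hl2 j hj
      rw [le_div_iff_of_neg (by linarith)]
      linarith

theorem FeasibleAt.exists_optimalPair (hI : I.Regular) {z₀ z₁ : ℝ} (h₁ : I.FeasibleAt z₁)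
    (hz₁ : z₁ ∉ I.breakGrid) (hvis : ∀ r ∈ I.breakGrid, r ∉ Set.uIoo z₁ z₀) :
    ∃ y, I.OptimalPair z₀ z₁ y := by
  obtain ⟨g, hg⟩ := h₁.exists_isSupergradient hI
  obtain ⟨y, hy⟩ := h₁
  obtain ⟨S, X₁, hX₁⟩ := hy.exists_isOptimalBasic hI.d_pos hI.mem.2
  obtain ⟨-, X₀, hX₀⟩ := hX₁.extend hI hz₁ hg hvis
  exact ⟨(netPart X₀, netPart X₁), S, X₀, X₁, hX₀, hX₁, fun _ => rfl, fun _ => rfl⟩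

/-- The line through a pair of solutions with a common basis consists of the solutions of this
basis, which are feasible as long as no grid point is passed. -/
theorem OptimalPair.linePoint_spec (hI : I.Regular) {z₀ z₁ : ℝ}
    {y : (Fin n → ℝ) × (Fin n → ℝ)} (h : I.OptimalPair z₀ z₁ y) (hne : z₀ ≠ z₁)
    (hz₁ : z₁ ∉ I.breakGrid) :
    (∀ w, I.A *ᵥ linePoint z₀ z₁ y w = 0) ∧
      ∀ w, (∀ r ∈ I.breakGrid, r ∉ Set.uIoo z₁ w) → I.DFeasible w (linePoint z₀ z₁ y w) := by
  obtain ⟨S, X₀, X₁, ⟨hS, h0S, h0f, -⟩, ⟨-, h1S, h1f, -⟩, hy0, hy1⟩ := h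
  obtain ⟨P, Q, hP, hQ, hQM, hiff⟩ := hS.exists_affine hI
  obtain rfl := (hiff z₀ X₀).1 ⟨h0S, h0f.1⟩
  obtain rfl := (hiff z₁ X₁).1 ⟨h1S, h1f.1⟩
  have hline : ∀ w, linePoint z₀ z₁ y w = netPart (P + w • Q) := by
    intro w
    have hne' := sub_ne_zero.2 hne
    ext j
    simp only [linePoint, hy0, hy1, netPart, Pi.add_apply, Pi.smul_apply, smul_eq_mul]
    field_simp
    ring
  have hmul : ∀ w, I.stdMatrix *ᵥ (P + w • Q) = I.stdRhs w := fun w => ((hiff w _).2 rfl).2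
  refine ⟨fun w => ?_, fun w hw => ?_⟩
  · rw [hline]
    exact (stdMatrix_mulVec_eq_iff.1 (hmul w)).1
  · rw [hline]
    refine StdFeasible.dFeasible hI.d_pos ⟨hmul w, fun i => ?_⟩
    exact nonneg_of_forall_notMem_uIoo (hP i) (hQ i) (hQM i) hz₁ hw (h1f.2 i)

theorem Regular.eq_of_abs_sub_lt (hI : I.Regular) {r s : ℝ} (hr : r ∈ I.breakGrid)
    (hs : s ∈ I.breakGrid) (h : |r - s| < 4 * I.Δ) : r = s := by
  by_contra hne
  exact absurd (hI.breakGrid_separated hr hs hne) (not_le.2 h)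

/-- Close to the right of a grid point there is no other one. -/
theorem Regular.notMem_of_lt (hI : I.Regular) {r s : ℝ} (hr : r ∈ I.breakGrid) (h : r < s)
    (h' : s < r + 4 * I.Δ) : s ∉ I.breakGrid := fun hs =>
  h.ne (hI.eq_of_abs_sub_lt hr hs (by rw [abs_of_neg (by linarith)]; linarith))

/-- Close to the left of a grid point there is no other one. -/
theorem Regular.notMem_of_gt (hI : I.Regular) {r s : ℝ} (hr : r ∈ I.breakGrid) (h : s < r)
    (h' : r < s + 4 * I.Δ) : s ∉ I.breakGrid := fun hs =>
  h.ne' (hI.eq_of_abs_sub_lt hr hs (by rw [abs_of_pos (by linarith)]; linarith))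

end Data

/-! ### The break point procedures -/

namespace Oracle

variable {m n : ℕ} {I : Data m n} (O : Oracle I)

theorem computes_lbp (hI : I.Regular) {zl zr : ℝ} (hD : I.IsDomain zl zr) {N : ℕ}
    (hN : 2 * I.Z < 2 ^ N * (I.Δ / 2)) : ∃ k, Computes O.lbp (zl : EReal) k ∧ k ≤ N + 3 := by
  classical
  have hΔ := hI.Δ_pos
  have hZ : 0 < I.Z := by linarith [hD.neg_Z_lt, hD.left_neg]
  have hgap := hD.sub_ge hI
  obtain ⟨s, k, hw, ⟨hs1, hs2, hs3⟩, hc, hk⟩ := Computes.exists_whileLoop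
    (cond := fun s : ℝ × ℝ => I.Δ / 2 ≤ s.2 - s.1)
    (body := fun s => do
        let z := (s.1 + s.2) / 2
        if (← test I z) then return (s.1, z) else return (z, s.2))
    (fun s => s.1 < zl ∧ zl ≤ s.2 ∧ s.2 ≤ zr) (fun s => s.2 - s.1) (I.Δ / 2) 1
    (fun s _ h => h) (by
      rintro ⟨a, b⟩ ⟨h1, h2, h3⟩ hc
      dsimp only at h1 h2 h3 hc ⊢
      by_cases hz : zl ≤ (a + b) / 2
      · refine ⟨(a, (a + b) / 2), 1 + 0, Computes.bind (Computes.charge 1 _) ?_, le_rfl,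
          ⟨h1, hz, by dsimp only; linarith⟩, fun _ => by dsimp only; linarith⟩
        have : ∃ y, I.DFeasible ((a + b) / 2) y :=
          (hD.feasibleAt_iff _).2 ⟨hz, by linarith⟩
        rw [decide_eq_true this]
        exact Computes.pure _
      · refine ⟨((a + b) / 2, b), 1 + 0, Computes.bind (Computes.charge 1 _) ?_, le_rfl,
          ⟨not_le.1 hz, h2, h3⟩, fun _ => by dsimp only; linarith⟩
        have : ¬ ∃ y, I.DFeasible ((a + b) / 2) y := fun h =>
          hz ((hD.feasibleAt_iff _).1 h).1
        rw [decide_eq_false this]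
        exact Computes.pure _) N (-I.Z, 0)
    ⟨hD.neg_Z_lt, hD.left_neg.le, hD.right_pos.le⟩ (fun _ => by dsimp only; linarith)
  rw [not_le] at hc
  have hz₁ : s.2 + I.Δ / 2 ∉ I.breakGrid :=
    hI.notMem_of_lt hD.left_mem (by linarith) (by linarith)
  have hvis : ∀ w, zl ≤ w → w ≤ s.2 + I.Δ / 2 →
      ∀ r ∈ I.breakGrid, r ∉ Set.uIoo (s.2 + I.Δ / 2) w := by
    intro w hw hw' r hr hm
    rw [Set.uIoo_of_ge hw'] at hm
    exact hI.notMem_of_lt hD.left_mem (hw.trans_lt hm.1) (by linarith [hm.2]) hr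
  have hpair := O.solvePair_spec s.2 (s.2 + I.Δ / 2) (Data.FeasibleAt.exists_optimalPair hI
    ((hD.feasibleAt_iff _).2 ⟨by linarith, by linarith⟩) hz₁ (hvis _ hs2 (by linarith)))
  obtain ⟨hA, hline⟩ := hpair.linePoint_spec hI (by linarith) hz₁
  have hturn := Data.leftTurn_eq hI hA (hline zl (hvis zl le_rfl (by linarith)))
    fun z hz h => absurd ((hD.feasibleAt_iff z).1 h).1 (not_le.2 hz)
  refine ⟨1 + (k + (2 + 0)), Computes.bind (Computes.charge 1 _) ?_, by omega⟩
  have : ¬ ∃ y, I.DFeasible (-I.Z) y := fun h =>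
    absurd ((hD.feasibleAt_iff _).1 h).1 (not_le.2 hD.neg_Z_lt)
  rw [decide_eq_false this]
  refine Computes.bind hw (Computes.bind (Computes.charge 2 _) ?_)
  rw [← hturn]
  exact Computes.pure _

theorem computes_rbp (hI : I.Regular) {zl zr : ℝ} (hD : I.IsDomain zl zr) {N : ℕ}
    (hN : 2 * I.Z < 2 ^ N * (I.Δ / 2)) : ∃ k, Computes O.rbp (zr : EReal) k ∧ k ≤ N + 3 := by
  classical
  have hΔ := hI.Δ_pos
  have hZ : 0 < I.Z := by linarith [hD.neg_Z_lt, hD.left_neg]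
  have hgap := hD.sub_ge hI
  obtain ⟨s, k, hw, ⟨hs1, hs2, hs3⟩, hc, hk⟩ := Computes.exists_whileLoop
    (cond := fun s : ℝ × ℝ => I.Δ / 2 ≤ s.2 - s.1)
    (body := fun s => do
        let z := (s.1 + s.2) / 2
        if (← test I z) then return (z, s.2) else return (s.1, z))
    (fun s => zr < s.2 ∧ s.1 ≤ zr ∧ zl ≤ s.1) (fun s => s.2 - s.1) (I.Δ / 2) 1
    (fun s _ h => h) (by
      rintro ⟨a, b⟩ ⟨h1, h2, h3⟩ hc
      dsimp only at h1 h2 h3 hc ⊢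
      by_cases hz : (a + b) / 2 ≤ zr
      · refine ⟨((a + b) / 2, b), 1 + 0, Computes.bind (Computes.charge 1 _) ?_, le_rfl,
          ⟨h1, hz, by dsimp only; linarith⟩, fun _ => by dsimp only; linarith⟩
        have : ∃ y, I.DFeasible ((a + b) / 2) y :=
          (hD.feasibleAt_iff _).2 ⟨by linarith, hz⟩
        rw [decide_eq_true this]
        exact Computes.pure _
      · refine ⟨(a, (a + b) / 2), 1 + 0, Computes.bind (Computes.charge 1 _) ?_, le_rfl,
          ⟨not_le.1 hz, h2, h3⟩, fun _ => by dsimp only; linarith⟩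
        have : ¬ ∃ y, I.DFeasible ((a + b) / 2) y := fun h =>
          hz ((hD.feasibleAt_iff _).1 h).2
        rw [decide_eq_false this]
        exact Computes.pure _) N (0, I.Z)
    ⟨hD.lt_Z, hD.right_pos.le, hD.left_neg.le⟩ (fun _ => by dsimp only; linarith)
  rw [not_le] at hc
  have hz₁ : s.1 - I.Δ / 2 ∉ I.breakGrid :=
    hI.notMem_of_gt hD.right_mem (by linarith) (by linarith)
  have hvis : ∀ w, w ≤ zr → s.1 - I.Δ / 2 ≤ w →
      ∀ r ∈ I.breakGrid, r ∉ Set.uIoo (s.1 - I.Δ / 2) w := by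
    intro w hw hw' r hr hm
    rw [Set.uIoo_of_le hw'] at hm
    exact hI.notMem_of_gt hD.right_mem (hm.2.trans_le hw) (by linarith [hm.1]) hr
  have hpair := O.solvePair_spec s.1 (s.1 - I.Δ / 2) (Data.FeasibleAt.exists_optimalPair hI
    ((hD.feasibleAt_iff _).2 ⟨by linarith, by linarith⟩) hz₁ (hvis _ hs2 (by linarith)))
  obtain ⟨hA, hline⟩ := hpair.linePoint_spec hI (by linarith) hz₁
  have hturn := Data.rightTurn_eq hI hA (hline zr (hvis zr le_rfl (by linarith)))
    fun z hz h => absurd ((hD.feasibleAt_iff z).1 h).2 (not_le.2 hz)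
  refine ⟨1 + (k + (2 + 0)), Computes.bind (Computes.charge 1 _) ?_, by omega⟩
  have : ¬ ∃ y, I.DFeasible I.Z y := fun h =>
    absurd ((hD.feasibleAt_iff _).1 h).2 (not_le.2 hD.lt_Z)
  rw [decide_eq_false this]
  refine Computes.bind hw (Computes.bind (Computes.charge 2 _) ?_)
  rw [← hturn]
  exact Computes.pure _

end Oracle

/-! ### Locating the critical value -/

namespace Data

variable {m n : ℕ} {I : Data m n}

/-- If the value function has slope `k` between `z` and both `z + h` and `z + 2 h`, then `k` is a
supergradient at `z`: the supergradient at the middle point is `k`. -/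
theorem isSupergradient_of_collinear (hI : I.Regular) {z h k : ℝ} (hh : h ≠ 0)
    (hf : I.FeasibleAt z) (hf₁ : I.FeasibleAt (z + h)) (hf₂ : I.FeasibleAt (z + 2 * h))
    (e₁ : I.value (z + h) = I.value z + k * h)
    (e₂ : I.value (z + 2 * h) = I.value z + k * (2 * h)) : I.IsSupergradient z k := by
  obtain ⟨g, hg⟩ := hf₁.exists_isSupergradient hI
  have h1 := hg z hf
  have h2 := hg _ hf₂
  have h3 : (g - k) * h = 0 := by
    apply le_antisymm <;> linarith
  obtain rfl : g = k := by
    rcases mul_eq_zero.1 h3 with h | h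
    · linarith
    · exact absurd h hh
  exact hg.of_value_eq (by linarith)

/-- Where the value function has two supergradients there is a grid point. -/
theorem IsSupergradient.mem_breakGrid (hI : I.Regular) {z g g' : ℝ} (hf : I.FeasibleAt z)
    (hg : I.IsSupergradient z g) (hg' : I.IsSupergradient z g') (hne : g ≠ g') :
    z ∈ I.breakGrid := by
  by_contra hz
  exact hne (hg.unique hI hf hz hg')

/-- If supergradients on both sides of `δ` are known at the ends of an interval shorter than `Δ`,
the corresponding lines meet above the only grid point of this interval, and `δ` is a
supergradient there. -/
theorem isSupergradient_of_intersection (hI : I.Regular) {lo hi kl kh δ : ℝ} (hle : lo ≤ hi)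
    (hlt : hi - lo < I.Δ) (hlo : I.FeasibleAt lo) (hhi : I.FeasibleAt hi)
    (hkl : I.IsSupergradient lo kl) (hkh : I.IsSupergradient hi kh) (h₁ : δ ≤ kl) (h₂ : kh < δ) :
    I.FeasibleAt ((I.value hi - I.value lo - kh * hi + kl * lo) / (kl - kh)) ∧
      I.IsSupergradient ((I.value hi - I.value lo - kh * hi + kl * lo) / (kl - kh)) δ := by
  have hΔ := hI.Δ_pos
  obtain ⟨r, hr, hlr, hrh⟩ : ∃ r ∈ I.breakGrid, lo ≤ r ∧ r ≤ hi := by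
    by_contra! hno
    have hlog : lo ∉ I.breakGrid := fun h => absurd (hno lo h le_rfl) (not_lt.2 hle)
    have hhig : hi ∉ I.breakGrid := fun h => lt_irrefl _ (hno hi h hle)
    have h := (hkl.value_eq hI hlo hlog (w := hi) fun r hr hm => by
      rw [Set.uIoo_of_le hle] at hm
      exact absurd (hno r hr hm.1.le) (not_lt.2 hm.2.le)).2
    have := (hkl.of_value_eq h).unique hI hhi hhig hkh
    linarith
  have el : I.value r = I.value lo + kl * (r - lo) := by
    rcases hlr.eq_or_lt with rfl | hlt'
    · ring
    · refine (hkl.value_eq hI hlo (hI.notMem_of_gt hr hlt' (by linarith)) fun s hs hm => ?_).2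
      rw [Set.uIoo_of_le hlr] at hm
      exact hI.notMem_of_gt hr hm.2 (by linarith [hm.1]) hs
  have eh : I.value r = I.value hi + kh * (r - hi) := by
    rcases hrh.eq_or_lt with rfl | hlt'
    · ring
    · refine (hkh.value_eq hI hhi (hI.notMem_of_lt hr hlt' (by linarith)) fun s hs hm => ?_).2
      rw [Set.uIoo_of_ge hrh] at hm
      exact hI.notMem_of_lt hr hm.1 (by linarith [hm.2]) hs
  have er : (I.value hi - I.value lo - kh * hi + kl * lo) / (kl - kh) = r := by
    rw [div_eq_iff (by linarith)]
    linarith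
  rw [er]
  exact ⟨hlo.of_mem_Icc hhi ⟨hlr, hrh⟩,
    (hkh.of_value_eq eh).of_le_of_le (hkl.of_value_eq el) h₂.le h₁⟩

end Data

namespace Oracle

variable {m n : ℕ} {I : Data m n} (O : Oracle I)

theorem dOptimal_solve (hI : I.Regular) {z : ℝ} (hz : I.FeasibleAt z) :
    I.DOptimal z (O.solve z) :=
  O.solve_spec z (hz.exists_dOptimal hI)

theorem dualOf_dual (hI : I.Regular) {z : ℝ} (hz : I.FeasibleAt z) :
    I.DualOf z (O.solve z) (O.dual z (O.solve z)) :=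
  O.dual_spec z _ ((O.dOptimal_solve hI hz).exists_dualOf hI.d_pos hI.mem.2)

theorem computes_psi (hI : I.Regular) {z : ℝ} (hz : I.FeasibleAt z) :
    Computes (O.psi z) (I.value z) 1 := by
  rw [(O.dOptimal_solve hI hz).value_eq]
  exact (Computes.charge 1 _).bind (Computes.pure _)

open Classical in
/-- The parameter at which the slope procedure solves its subproblem. -/
def slopeArg (I : Data m n) (zl zr : EReal) (z : ℝ) : ℝ :=
  if (z : EReal) = zl then z + I.Δ / 2 else if (z : EReal) = zr then z - I.Δ / 2 else z

/-- The number returned by the slope procedure at `z`. -/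
def slopeValue (zl zr : EReal) (z : ℝ) : ℝ :=
  ∑ j ∈ I.Jbar, ((O.dual (slopeArg I zl zr z) (O.solve (slopeArg I zl zr z))).β j -
    (O.dual (slopeArg I zl zr z) (O.solve (slopeArg I zl zr z))).α j) * I.x₀ j

theorem computes_slope (zl zr : EReal) (z : ℝ) :
    Computes (O.slope zl zr z) (O.slopeValue zl zr z) 1 :=
  (Computes.charge 1 _).bind (Computes.pure _)

theorem slopeValue_isSupergradient (hI : I.Regular) {zl zr z : ℝ} (hD : I.IsDomain zl zr)
    (hz : I.FeasibleAt z) : I.IsSupergradient z (O.slopeValue zl zr z) := by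
  have hΔ := hI.Δ_pos
  have hgap := hD.sub_ge hI
  have key : ∀ z', I.FeasibleAt z' → slopeArg I zl zr z = z' →
      I.IsSupergradient z' (O.slopeValue zl zr z) := by
    rintro z' hz' rfl
    exact (O.dualOf_dual hI hz').isSupergradient hI (O.dOptimal_solve hI hz')
  by_cases h1 : (z : EReal) = zl
  · obtain rfl := EReal.coe_eq_coe_iff.1 h1
    have hf : I.FeasibleAt (z + I.Δ / 2) := (hD.feasibleAt_iff _).2 ⟨by linarith, by linarith⟩
    have hk := key _ hf (if_pos rfl)
    refine hk.of_value_eq (hk.value_eq hI hf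
      (hI.notMem_of_lt hD.left_mem (by linarith) (by linarith)) fun r hr hm => ?_).2
    rw [Set.uIoo_of_ge (by linarith)] at hm
    exact hI.notMem_of_lt hD.left_mem hm.1 (by linarith [hm.2]) hr
  · by_cases h2 : (z : EReal) = zr
    · obtain rfl := EReal.coe_eq_coe_iff.1 h2
      have hf : I.FeasibleAt (z - I.Δ / 2) := (hD.feasibleAt_iff _).2 ⟨by linarith, by linarith⟩
      have hk := key _ hf (by rw [slopeArg, if_neg h1, if_pos rfl])
      refine hk.of_value_eq (hk.value_eq hI hf
        (hI.notMem_of_gt hD.right_mem (by linarith) (by linarith)) fun r hr hm => ?_).2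
      rw [Set.uIoo_of_le (by linarith)] at hm
      exact hI.notMem_of_gt hD.right_mem hm.2 (by linarith [hm.1]) hr
    · exact key _ hz (by rw [slopeArg, if_neg h1, if_neg h2])

/-- The possible results of one iteration of the search. -/
theorem computes_searchStep (hI : I.Regular) (zl zr : EReal) (s : SearchState) {z : ℝ}
    (hz : (s.hi + s.lo) / 2 = z) (hf : I.FeasibleAt z) (hf₁ : I.FeasibleAt (z - I.Δ / 2))
    (hf₂ : I.FeasibleAt (z - I.Δ / 4)) (hf₃ : I.FeasibleAt (z + I.Δ / 4))
    (hf₄ : I.FeasibleAt (z + I.Δ / 2)) :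
    ∃ s' k, Computes (O.searchStep zl zr s) s' k ∧ k ≤ 6 ∧
      ((∃ k k', k ≠ k' ∧ I.value (z - I.Δ / 2) = I.value z - k * (I.Δ / 2) ∧
          I.value (z - I.Δ / 4) = I.value z - k * (I.Δ / 4) ∧
          I.value (z + I.Δ / 4) = I.value z + k' * (I.Δ / 4) ∧
          I.value (z + I.Δ / 2) = I.value z + k' * (I.Δ / 2) ∧
          ((I.δ ≤ k' ∧ s' = { s with lo := z + I.Δ / 2 }) ∨
            (k < I.δ ∧ s' = { s with hi := z - I.Δ / 2 }) ∨
            (k' < I.δ ∧ I.δ ≤ k ∧ s' = { s with zstar := some z }))) ∨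
        (I.δ ≤ O.slopeValue zl zr z ∧ s' = { s with lo := z }) ∨
        (O.slopeValue zl zr z < I.δ ∧ s' = { s with hi := z })) := by
  classical
  subst hz
  set z := (s.hi + s.lo) / 2 with hz
  have hΔ := hI.Δ_pos
  set k1 := (I.value z - I.value (z - I.Δ / 2)) / (z - (z - I.Δ / 2)) with hk1
  set k2 := (I.value z - I.value (z - I.Δ / 4)) / (z - (z - I.Δ / 4)) with hk2
  set k3 := (I.value z - I.value (z + I.Δ / 4)) / (z - (z + I.Δ / 4)) with hk3
  set k4 := (I.value z - I.value (z + I.Δ / 2)) / (z - (z + I.Δ / 2)) with hk4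
  have main : ∀ (s' : SearchState) (l : ℕ), Computes
      (if k1 = k2 ∧ k3 = k4 ∧ k2 ≠ k3 then
        if I.δ ≤ k4 then return { s with lo := z + I.Δ / 2 }
        else if k1 < I.δ then return { s with hi := z - I.Δ / 2 }
        else return { s with zstar := some z }
      else do
        let k ← O.slope zl zr z
        if I.δ ≤ k then return { s with lo := z } else return { s with hi := z }) s' l →
      Computes (O.searchStep zl zr s) s' (1 + (1 + (1 + (1 + (1 + l))))) := fun s' l h =>
    (O.computes_psi hI hf).bind ((O.computes_psi hI hf₁).bind ((O.computes_psi hI hf₂).bind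
      ((O.computes_psi hI hf₃).bind ((O.computes_psi hI hf₄).bind h))))
  by_cases hsp : k1 = k2 ∧ k3 = k4 ∧ k2 ≠ k3
  · have q1 : k1 * (z - (z - I.Δ / 2)) = _ := div_mul_cancel₀ _ (by linarith)
    have q2 : k2 * (z - (z - I.Δ / 4)) = _ := div_mul_cancel₀ _ (by linarith)
    have q3 : k3 * (z - (z + I.Δ / 4)) = _ := div_mul_cancel₀ _ (by linarith)
    have q4 : k4 * (z - (z + I.Δ / 2)) = _ := div_mul_cancel₀ _ (by linarith)
    rw [← hsp.1] at q2
    rw [hsp.2.1] at q3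
    have e1 : I.value (z - I.Δ / 2) = I.value z - k1 * (I.Δ / 2) := by linarith
    have e2 : I.value (z - I.Δ / 4) = I.value z - k1 * (I.Δ / 4) := by linarith
    have e3 : I.value (z + I.Δ / 4) = I.value z + k4 * (I.Δ / 4) := by linarith
    have e4 : I.value (z + I.Δ / 2) = I.value z + k4 * (I.Δ / 2) := by linarith
    have hne : k1 ≠ k4 := by
      rw [hsp.1, ← hsp.2.1]
      exact hsp.2.2
    simp only [if_pos hsp] at main
    by_cases h4 : I.δ ≤ k4
    · simp only [if_pos h4] at main
      exact ⟨_, _, main _ _ (Computes.pure _), by norm_num,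
        Or.inl ⟨k1, k4, hne, e1, e2, e3, e4, Or.inl ⟨h4, rfl⟩⟩⟩
    · simp only [if_neg h4] at main
      by_cases h1 : k1 < I.δ
      · simp only [if_pos h1] at main
        exact ⟨_, _, main _ _ (Computes.pure _), by norm_num,
          Or.inl ⟨k1, k4, hne, e1, e2, e3, e4, Or.inr (Or.inl ⟨h1, rfl⟩)⟩⟩
      · simp only [if_neg h1] at main
        exact ⟨_, _, main _ _ (Computes.pure _), by norm_num, Or.inl ⟨k1, k4, hne, e1, e2, e3, e4,
          Or.inr (Or.inr ⟨not_le.1 h4, not_lt.1 h1, rfl⟩)⟩⟩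
  · simp only [if_neg hsp] at main
    by_cases h : I.δ ≤ O.slopeValue zl zr z
    · refine ⟨_, _, main { s with lo := z } (1 + 0) ((O.computes_slope zl zr z).bind ?_),
        by norm_num, Or.inr (Or.inl ⟨h, rfl⟩)⟩
      rw [if_pos h]
      exact Computes.pure _
    · refine ⟨_, _, main { s with hi := z } (1 + 0) ((O.computes_slope zl zr z).bind ?_),
        by norm_num, Or.inr (Or.inr ⟨not_le.1 h, rfl⟩)⟩
      rw [if_neg h]
      exact Computes.pure _

/-- The invariant of the search on a bounded domain: a value that has been found is critical;
otherwise the slopes at the ends of the interval enclose `δ`. -/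
structure SearchInvariant (zl zr : ℝ) (s : SearchState) : Prop where
  found : ∀ z, s.zstar = some z → I.FeasibleAt z ∧ I.IsSupergradient z I.δ
  le_lo : s.zstar = none → zl ≤ s.lo
  lo_le_hi : s.zstar = none → s.lo ≤ s.hi
  hi_le : s.zstar = none → s.hi ≤ zr
  le_slope : s.zstar = none → I.δ ≤ O.slopeValue zl zr s.lo
  slope_lt : s.zstar = none → O.slopeValue zl zr s.hi < I.δ

theorem SearchInvariant.searchStep (hI : I.Regular) {zl zr : ℝ} (hD : I.IsDomain zl zr)
    {s : SearchState} (hs : O.SearchInvariant zl zr s) (hc : I.Δ ≤ s.hi - s.lo ∧ s.zstar = none) :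
    ∃ s' k, Computes (O.searchStep zl zr s) s' k ∧ k ≤ 6 ∧ O.SearchInvariant zl zr s' ∧
      (I.Δ ≤ s'.hi - s'.lo ∧ s'.zstar = none → s'.hi - s'.lo ≤ (s.hi - s.lo) / 2) := by
  have hΔ := hI.Δ_pos
  obtain ⟨hlen, hnone⟩ := hc
  have b1 := hs.le_lo hnone
  have b3 := hs.hi_le hnone
  have b4 := hs.le_slope hnone
  have b5 := hs.slope_lt hnone
  obtain ⟨lo, hi, zs⟩ := s
  dsimp only at *
  subst hnone
  set z := (hi + lo) / 2 with hz
  have hf : ∀ w, z - I.Δ / 2 ≤ w → w ≤ z + I.Δ / 2 → I.FeasibleAt w := fun w h1 h2 =>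
    (hD.feasibleAt_iff _).2 ⟨by linarith, by linarith⟩
  have f0 := hf z (by linarith) (by linarith)
  have f1 := hf (z - I.Δ / 2) (by linarith) (by linarith)
  have f2 := hf (z - I.Δ / 4) (by linarith) (by linarith)
  have f3 := hf (z + I.Δ / 4) (by linarith) (by linarith)
  have f4 := hf (z + I.Δ / 2) (by linarith) (by linarith)
  obtain ⟨s', k, hcomp, hk, h⟩ := O.computes_searchStep hI zl zr ⟨lo, hi, none⟩ hz.symm
    f0 f1 f2 f3 f4
  refine ⟨s', k, hcomp, hk, ?_⟩
  rcases h with ⟨k, k', hne, e1, e2, e3, e4, h⟩ | ⟨h, rfl⟩ | ⟨h, rfl⟩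
  · -- Both difference quotients are supergradients at `z`, which is therefore a break point,
    -- and the value function is smooth at the other four points.
    have hsk : I.IsSupergradient z k := by
      refine Data.isSupergradient_of_collinear hI (h := -(I.Δ / 4)) (by linarith) f0 f2 ?_ ?_ ?_
      · convert f1 using 1
        ring
      · rw [← sub_eq_add_neg, e2]
        ring
      · have : z + 2 * -(I.Δ / 4) = z - I.Δ / 2 := by ring
        rw [this, e1]
        ring
    have hsk' : I.IsSupergradient z k' := by
      refine Data.isSupergradient_of_collinear hI (h := I.Δ / 4) (by linarith) f0 f3 ?_ e3 ?_
      · convert f4 using 1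
        ring
      · have : z + 2 * (I.Δ / 4) = z + I.Δ / 2 := by ring
        rw [this, e4]
        ring
    have hzg := hsk.mem_breakGrid hI f0 hsk' hne
    rcases h with ⟨h, rfl⟩ | ⟨h, rfl⟩ | ⟨h, h', rfl⟩
    · have hv := ((O.slopeValue_isSupergradient hI hD f4).value_eq hI f4
        (hI.notMem_of_lt hzg (by linarith) (by linarith)) (w := z) fun r hr hm => by
          rw [Set.uIoo_of_ge (by linarith)] at hm
          exact hI.notMem_of_lt hzg hm.1 (by linarith [hm.2]) hr).2
      have hk' : O.slopeValue zl zr (z + I.Δ / 2) = k' := by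
        have : (O.slopeValue zl zr (z + I.Δ / 2) - k') * (I.Δ / 2) = 0 := by linarith
        rcases mul_eq_zero.1 this with h | h <;> linarith
      exact ⟨⟨fun _ h => (by simp at h), fun _ => by dsimp only; linarith,
        fun _ => by dsimp only; linarith, fun _ => b3, fun _ => by dsimp only; linarith,
        fun _ => b5⟩, fun _ => by dsimp only; linarith⟩
    · have hv := ((O.slopeValue_isSupergradient hI hD f1).value_eq hI f1
        (hI.notMem_of_gt hzg (by linarith) (by linarith)) (w := z) fun r hr hm => by
          rw [Set.uIoo_of_le (by linarith)] at hm
          exact hI.notMem_of_gt hzg hm.2 (by linarith [hm.1]) hr).2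
      have hk' : O.slopeValue zl zr (z - I.Δ / 2) = k := by
        have : (O.slopeValue zl zr (z - I.Δ / 2) - k) * (I.Δ / 2) = 0 := by linarith
        rcases mul_eq_zero.1 this with h | h <;> linarith
      exact ⟨⟨fun _ h => (by simp at h), fun _ => b1, fun _ => by dsimp only; linarith,
        fun _ => by dsimp only; linarith, fun _ => b4, fun _ => by dsimp only; linarith⟩,
        fun _ => by dsimp only; linarith⟩
    · refine ⟨⟨?_, fun h => by simp at h, fun h => by simp at h, fun h => by simp at h,
        fun h => by simp at h, fun h => by simp at h⟩, fun h => by simp at h⟩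
      rintro _ ⟨⟩
      exact ⟨f0, hsk'.of_le_of_le hsk h.le h'⟩
  · exact ⟨⟨fun _ h => (by simp at h), fun _ => by dsimp only; linarith,
      fun _ => by dsimp only; linarith, fun _ => b3, fun _ => h, fun _ => b5⟩,
      fun _ => by dsimp only; linarith⟩
  · exact ⟨⟨fun _ h => (by simp at h), fun _ => b1, fun _ => by dsimp only; linarith,
      fun _ => by dsimp only; linarith, fun _ => b4, fun _ => h⟩,
      fun _ => by dsimp only; linarith⟩

theorem computes_criticalValue (hI : I.Regular) {zl zr : ℝ} (hD : I.IsDomain zl zr) {N : ℕ}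
    (hN : 2 * I.Z < 2 ^ N * (I.Δ / 2)) {s : SearchState} (hs : O.SearchInvariant zl zr s) :
    ∃ z k, Computes (O.criticalValue zl zr s) z k ∧ k ≤ 6 * N + 4 ∧ I.FeasibleAt z ∧
      I.IsSupergradient z I.δ := by
  have hΔ := hI.Δ_pos
  obtain ⟨s', k, hw, hs', hc, hk⟩ := Computes.exists_whileLoop
    (cond := fun s : SearchState => I.Δ ≤ s.hi - s.lo ∧ s.zstar = none)
    (body := O.searchStep zl zr) (O.SearchInvariant zl zr) (fun s => s.hi - s.lo) I.Δ 6
    (fun s _ h => h.1) (fun s hs hc => hs.searchStep O hI hD hc) N s hs (by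
      rintro ⟨-, hnone⟩
      have h1 := hs.le_lo hnone
      have h2 := hs.hi_le hnone
      have h3 := hD.neg_Z_lt
      have h4 := hD.lt_Z
      have : 0 < (2 : ℝ) ^ N * I.Δ := by positivity
      linarith)
  obtain ⟨lo, hi, zs⟩ := s'
  cases zs with
  | some z =>
    obtain ⟨hf, hg⟩ := hs'.found z rfl
    exact ⟨z, k + 0, hw.bind (Computes.pure _), by omega, hf, hg⟩
  | none =>
    have b1 := hs'.le_lo rfl
    have b2 := hs'.lo_le_hi rfl
    have b3 := hs'.hi_le rfl
    have b4 := hs'.le_slope rfl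
    have b5 := hs'.slope_lt rfl
    dsimp only at *
    have hlt : hi - lo < I.Δ := by
      by_contra! h
      exact hc ⟨h, rfl⟩
    have flo : I.FeasibleAt lo := (hD.feasibleAt_iff _).2 ⟨b1, b2.trans b3⟩
    have fhi : I.FeasibleAt hi := (hD.feasibleAt_iff _).2 ⟨b1.trans b2, b3⟩
    obtain ⟨hf, hg⟩ := Data.isSupergradient_of_intersection hI b2 hlt flo fhi
      (O.slopeValue_isSupergradient hI hD flo) (O.slopeValue_isSupergradient hI hD fhi) b4 b5
    exact ⟨_, k + (1 + (1 + (1 + (1 + 0)))), hw.bind ((O.computes_slope zl zr lo).bind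
      ((O.computes_slope zl zr hi).bind ((O.computes_psi hI fhi).bind
      ((O.computes_psi hI flo).bind (Computes.pure _))))), by omega, hf, hg⟩

/-- The last steps of the algorithm turn a critical value into an optimal solution. -/
theorem isOptimal_primal (hI : I.Regular) {z : ℝ} (hz : I.FeasibleAt z)
    (h : ∃ p, I.PrimalOf z (O.solve z) p) :
    I.IsOptimal (I.c + (O.primal z (O.solve z)).α - (O.primal z (O.solve z)).β) :=
  (O.primal_spec z _ h).isOptimal hI.d_pos hI.mem (O.dOptimal_solve hI hz).1

/-! ### The algorithm for `b ≠ 0` -/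

theorem algorithm_of_ne_zero (hI : I.Regular) (hb : I.b ≠ 0) {N : ℕ}
    (hN : 2 * I.Z < 2 ^ N * (I.Δ / 2)) :
    ∃ out k, Computes O.algorithm out k ∧ I.Correct out ∧ k ≤ 8 * N + 13 := by
  classical
  obtain ⟨zl, zr, hD⟩ := Data.exists_isDomain hI hb
  obtain ⟨kl, hl, hkl⟩ := O.computes_lbp hI hD hN
  obtain ⟨kr, hr, hkr⟩ := O.computes_rbp hI hD hN
  have hlr : zl ≤ zr := (hD.left_neg.trans hD.right_pos).le
  have fl : I.FeasibleAt zl := (hD.feasibleAt_iff _).2 ⟨le_rfl, hlr⟩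
  have fr : I.FeasibleAt zr := (hD.feasibleAt_iff _).2 ⟨hlr, le_rfl⟩
  have hsl := O.slopeValue_isSupergradient hI hD fl
  have hsr := O.slopeValue_isSupergradient hI hD fr
  set sl := O.slopeValue zl zr zl with hsl'
  set sr := O.slopeValue zl zr zr with hsr'
  have hinl : Computes (O.initLeft zl zr)
      (some (zl, if sl ≤ I.δ then some zl else none)) (1 + 0) := by
    unfold initLeft
    rw [if_neg (EReal.coe_ne_bot zl)]
    exact (O.computes_slope _ _ _).bind (Computes.pure _)
  have hinr : ∀ zs, Computes (O.initRight zl zr zs)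
      (some (zr, if I.δ ≤ sr then some zr else zs)) (1 + 0) := by
    intro zs
    unfold initRight
    rw [if_neg (EReal.coe_ne_top zr)]
    exact (O.computes_slope _ _ _).bind (Computes.pure _)
  have hinv : O.SearchInvariant zl zr
      ⟨zl, zr, if I.δ ≤ sr then some zr else if sl ≤ I.δ then some zl else none⟩ := by
    by_cases h1 : I.δ ≤ sr
    · rw [if_pos h1]
      refine ⟨?_, fun h => by simp at h, fun h => by simp at h, fun h => by simp at h,
        fun h => by simp at h, fun h => by simp at h⟩
      rintro _ ⟨⟩
      refine ⟨fr, fun w hw => (hsr w hw).trans ?_⟩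
      have := mul_le_mul_of_nonpos_right h1 (sub_nonpos.2 ((hD.feasibleAt_iff w).1 hw).2)
      linarith
    · rw [if_neg h1]
      by_cases h2 : sl ≤ I.δ
      · rw [if_pos h2]
        refine ⟨?_, fun h => by simp at h, fun h => by simp at h, fun h => by simp at h,
          fun h => by simp at h, fun h => by simp at h⟩
        rintro _ ⟨⟩
        refine ⟨fl, fun w hw => (hsl w hw).trans ?_⟩
        have := mul_le_mul_of_nonneg_right h2 (sub_nonneg.2 ((hD.feasibleAt_iff w).1 hw).1)
        linarith
      · rw [if_neg h2]
        exact ⟨fun _ h => (by simp at h), fun _ => le_rfl, fun _ => hlr, fun _ => le_rfl,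
          fun _ => (not_le.1 h2).le, fun _ => not_le.1 h1⟩
  obtain ⟨z, kc, hcv, hkc, hf, hg⟩ := O.computes_criticalValue hI hD hN hinv
  have hopt := O.isOptimal_primal hI hf (hg.exists_primalOf hI (O.dOptimal_solve hI hf))
  exact ⟨.solution _, kl + (kr + ((1 + 0) + ((1 + 0) + (kc + (1 + 0))))),
    hl.bind (hr.bind (hinl.bind ((hinr _).bind (hcv.bind
      ((Computes.charge 1 _).bind (Computes.pure _)))))), hopt, by omega⟩

end Oracle

namespace Data

variable {m n : ℕ} {I : Data m n}

/-! ### The case `b = 0` and the number of iterations -/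

theorem feasibleAt_of_eq_zero (hI : I.Regular) (hb : I.b = 0) (z : ℝ) : I.FeasibleAt z := by
  refine ⟨z • I.x₀, ?_, fun j h0 => ?_, fun j h0 => ?_⟩
  · rw [Matrix.mulVec_smul, hI.mem.1, hb, smul_zero]
  · have := hI.d_pos j
    simp only [Pi.smul_apply, h0, smul_zero, neg_zero]
    exact ⟨this.le, this.le, le_rfl⟩
  · have := hI.d_pos j
    simp only [Pi.smul_apply, smul_eq_mul]
    constructor <;> linarith

/-- If `A x₀ = 0`, all dual solutions give the same slope. -/
theorem PFeasible.sum_eq (hI : I.Regular) (hb : I.b = 0) {p : DualPoint m n}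
    (hp : I.PFeasible p) : ∑ j ∈ I.Jbar, (p.β j - p.α j) * I.x₀ j = I.c ⬝ᵥ I.x₀ := by
  rw [sum_Jbar hI.mem.2 fun j => p.β j - p.α j]
  have h0 : ∑ j, (p.π ᵥ* I.A) j * I.x₀ j = 0 := by
    have : p.π ⬝ᵥ (I.A *ᵥ I.x₀) = 0 := by rw [hI.mem.1, hb, dotProduct_zero]
    rwa [Matrix.dotProduct_mulVec] at this
  rw [← add_zero (∑ j, _), ← h0, ← Finset.sum_add_distrib]
  refine Finset.sum_congr rfl fun j _ => ?_
  rcases (hI.mem.2 j).eq_or_lt with h | h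
  · simp only [Pi.zero_apply] at h
    rw [← h]
    ring
  · rw [← hp.2.1 j h]
    ring

/-- If `A x₀ = 0`, the feasible region of the linear program is a cone. -/
theorem Feasible.K_eq_zero (hI : I.Regular) (hb : I.b = 0) {c' : Fin n → ℝ}
    (h : I.Feasible c') : I.K = 0 := by
  have h0 := h.1.2 ⟨0, ⟨by rw [Matrix.mulVec_zero, hb], le_rfl⟩, rfl⟩
  have h2 := h.1.2 ⟨(2 : ℝ) • I.x₀, ⟨by rw [Matrix.mulVec_smul, hI.mem.1, hb, smul_zero],
    smul_nonneg zero_le_two hI.mem.2⟩, rfl⟩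
  simp only [dotProduct_zero, dotProduct_smul, h.2, smul_eq_mul] at h0 h2
  linarith

/-- Logarithmically many halvings suffice for every loop. -/
theorem exists_pow_bound (hI : I.Regular) :
    ∃ N : ℕ, 2 * I.Z < 2 ^ N * (I.Δ / 2) ∧
      ((8 * N + 13 : ℕ) : ℝ) ≤ 117 / Real.log 2 * Real.log I.L := by
  have hd := hI.one_le_dMax
  have hx := hI.one_le_xMax
  have hn : 2 ≤ n := by
    have := hI.pos
    have := hI.lt
    omega
  have hL2 : (2 : ℝ) ≤ I.L := le_trans (by exact_mod_cast hn) (le_max_right _ _)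
  have hLd : I.dMax ≤ I.L := (le_max_left _ _).trans (le_max_left _ _)
  have hLx : I.xMax ≤ I.L := (le_max_right _ _).trans (le_max_left _ _)
  have hLn : (n : ℝ) ≤ I.L := le_max_right _ _
  have hcard : (I.Jbar.card : ℝ) ≤ I.L := by
    refine le_trans ?_ hLn
    have := Finset.card_le_univ I.Jbar
    rw [Fintype.card_fin] at this
    exact_mod_cast this
  set L := I.L with hLdef
  have hM : I.Jbar.card * I.xMax ≤ L * L :=
    mul_le_mul hcard hLx (by linarith) (by linarith)
  have hM1 := hI.one_le_card_mul
  have h4 := hI.four_mul_Δ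
  have hΔ := hI.Δ_pos
  have hZ : I.Z ≤ 3 * (L * L) := by
    have h1 : ((n : ℝ) + I.Jbar.card) * I.dMax ≤ (L + L) * L :=
      mul_le_mul (by linarith) hLd (by linarith) (by linarith)
    have h2 : (1 : ℝ) ≤ L * L := by nlinarith
    unfold Z
    linarith
  have hM2 : (I.Jbar.card * I.xMax) * (I.Jbar.card * I.xMax) ≤ (L * L) * (L * L) :=
    mul_le_mul hM hM (by linarith) (by positivity)
  generalize (I.Jbar.card : ℝ) * I.xMax = M at *
  -- The ratio `4 Z / Δ` is at most `48 L ^ 6`, hence at most `L ^ 12`.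
  have hV : 4 * I.Z ≤ L ^ 12 * I.Δ := by
    have h1 : 1 ≤ 4 * I.Δ * ((L * L) * (L * L)) := by
      rw [← h4]
      exact mul_le_mul_of_nonneg_left hM2 (by linarith)
    have h2 : (2 : ℝ) ^ 6 ≤ L ^ 6 := pow_le_pow_left₀ (by norm_num) hL2 6
    calc 4 * I.Z ≤ 12 * (L * L) * 1 := by linarith
      _ ≤ 12 * (L * L) * (4 * I.Δ * ((L * L) * (L * L))) :=
          mul_le_mul_of_nonneg_left h1 (by positivity)
      _ = 48 * (L ^ 6 * I.Δ) := by ring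
      _ ≤ L ^ 6 * (L ^ 6 * I.Δ) := mul_le_mul_of_nonneg_right (by linarith) (by positivity)
      _ = L ^ 12 * I.Δ := by ring
  have hlog2 : 0 < Real.log 2 := Real.log_pos (by norm_num)
  have hlogL : Real.log 2 ≤ Real.log L := Real.log_le_log (by norm_num) hL2
  set q := Real.log L / Real.log 2 with hq
  have hq1 : 1 ≤ q := (one_le_div hlog2).2 hlogL
  refine ⟨⌊12 * q⌋₊ + 1, ?_, ?_⟩
  · have h1 : 12 * q < ((⌊12 * q⌋₊ + 1 : ℕ) : ℝ) := by
      push_cast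
      exact Nat.lt_floor_add_one _
    have h2 : L ^ 12 < 2 ^ (⌊12 * q⌋₊ + 1) := by
      rw [← Real.log_lt_log_iff (by positivity) (by positivity), Real.log_pow, Real.log_pow]
      have : Real.log L = q * Real.log 2 := by rw [hq, div_mul_cancel₀ _ hlog2.ne']
      rw [this]
      push_cast at h1 ⊢
      nlinarith
    have := mul_lt_mul_of_pos_right h2 hΔ
    linarith
  · have h1 : (⌊12 * q⌋₊ : ℝ) ≤ 12 * q := Nat.floor_le (by linarith)
    have h2 : 117 / Real.log 2 * Real.log L = 117 * q := by
      rw [hq]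
      ring
    rw [h2]
    push_cast
    linarith

end Data

namespace Oracle

variable {m n : ℕ} {I : Data m n} (O : Oracle I)

/-! ### The algorithm for `b = 0` -/

theorem slopeValue_of_eq_zero (hI : I.Regular) (hb : I.b = 0) (z : ℝ) :
    O.slopeValue ⊥ ⊤ z = I.c ⬝ᵥ I.x₀ :=
  (O.dualOf_dual hI (Data.feasibleAt_of_eq_zero hI hb _)).1.sum_eq hI hb

/-- On an unbounded domain the search terminates; its result is irrelevant, since the value
function is affine. -/
theorem computes_criticalValue_of_eq_zero (hI : I.Regular) (hb : I.b = 0) {N : ℕ}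
    (hN : 2 * I.Z < 2 ^ N * (I.Δ / 2)) :
    ∃ z k, Computes (O.criticalValue ⊥ ⊤ ⟨-I.Z, I.Z, none⟩) z k ∧ k ≤ 6 * N + 4 := by
  have hΔ := hI.Δ_pos
  have hf := Data.feasibleAt_of_eq_zero hI hb
  obtain ⟨s', k, hw, -, -, hk⟩ := Computes.exists_whileLoop
    (cond := fun s : SearchState => I.Δ ≤ s.hi - s.lo ∧ s.zstar = none)
    (body := O.searchStep ⊥ ⊤) (fun _ => True) (fun s => s.hi - s.lo) I.Δ 6
    (fun s _ h => h.1) (fun s _ hc => by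
      obtain ⟨s', k, hcomp, hk, h⟩ := O.computes_searchStep hI ⊥ ⊤ s rfl
        (hf _) (hf _) (hf _) (hf _) (hf _)
      refine ⟨s', k, hcomp, hk, trivial, fun hc' => ?_⟩
      rcases h with ⟨_, _, -, -, -, -, -, ⟨-, rfl⟩ | ⟨-, rfl⟩ | ⟨-, -, rfl⟩⟩ | ⟨-, rfl⟩ | ⟨-, rfl⟩
      · dsimp only
        linarith
      · dsimp only
        linarith
      · exact absurd hc'.2 (by simp)
      · dsimp only
        linarith
      · dsimp only
        linarith) N ⟨-I.Z, I.Z, none⟩ trivial (by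
      rintro -
      have : 0 < (2 : ℝ) ^ N * I.Δ := by positivity
      dsimp only
      linarith)
  obtain ⟨lo, hi, zs⟩ := s'
  cases zs with
  | some z => exact ⟨z, k + 0, hw.bind (Computes.pure _), by omega⟩
  | none =>
    -- Here the denominator of the final quotient is `0`.
    exact ⟨_, k + (1 + (1 + (1 + (1 + 0)))), hw.bind ((O.computes_slope _ _ lo).bind
      ((O.computes_slope _ _ hi).bind ((O.computes_psi hI (hf hi)).bind
      ((O.computes_psi hI (hf lo)).bind (Computes.pure _))))), by omega⟩

theorem algorithm_of_eq_zero (hI : I.Regular) (hb : I.b = 0) {N : ℕ}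
    (hN : 2 * I.Z < 2 ^ N * (I.Δ / 2)) :
    ∃ out k, Computes O.algorithm out k ∧ I.Correct out ∧ k ≤ 8 * N + 13 := by
  classical
  have hf := Data.feasibleAt_of_eq_zero hI hb
  have hs := O.slopeValue_of_eq_zero hI hb
  have hδ := Data.δ_eq (I := I) hI.mem.2
  have hl : Computes O.lbp ⊥ (1 + 0) := by
    refine (Computes.charge 1 _).bind ?_
    rw [decide_eq_true (show ∃ y, I.DFeasible (-I.Z) y from hf _)]
    exact Computes.pure _
  have hr : Computes O.rbp ⊤ (1 + 0) := by
    refine (Computes.charge 1 _).bind ?_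
    rw [decide_eq_true (show ∃ y, I.DFeasible I.Z y from hf _)]
    exact Computes.pure _
  have hinl : Computes (O.initLeft ⊥ ⊤)
      (if I.c ⬝ᵥ I.x₀ < I.δ then none else some (-I.Z, none)) (1 + 0) := by
    unfold initLeft
    rw [if_pos rfl, ← hs (-I.Z)]
    exact (O.computes_slope _ _ _).bind (Computes.pure _)
  have hinr : Computes (O.initRight ⊥ ⊤ none)
      (if I.δ < I.c ⬝ᵥ I.x₀ then none else some (I.Z, none)) (1 + 0) := by
    unfold initRight
    rw [if_pos rfl, ← hs I.Z]
    exact (O.computes_slope _ _ _).bind (Computes.pure _)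
  by_cases h1 : I.c ⬝ᵥ I.x₀ < I.δ
  · rw [if_pos h1] at hinl
    refine ⟨.infeasible, (1 + 0) + ((1 + 0) + ((1 + 0) + 0)),
      hl.bind (hr.bind (hinl.bind (Computes.pure _))), ?_, by omega⟩
    rintro ⟨c', hc'⟩
    have := hc'.K_eq_zero hI hb
    linarith
  rw [if_neg h1] at hinl
  by_cases h2 : I.δ < I.c ⬝ᵥ I.x₀
  · rw [if_pos h2] at hinr
    refine ⟨.infeasible, (1 + 0) + ((1 + 0) + ((1 + 0) + ((1 + 0) + 0))),
      hl.bind (hr.bind (hinl.bind (hinr.bind (Computes.pure _)))), ?_, by omega⟩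
    rintro ⟨c', hc'⟩
    have := hc'.K_eq_zero hI hb
    linarith
  rw [if_neg h2] at hinr
  obtain ⟨z, kc, hcv, hkc⟩ := O.computes_criticalValue_of_eq_zero hI hb hN
  have hp := O.dualOf_dual hI (hf z)
  have hsum := hp.1.sum_eq hI hb
  rw [Data.sum_Jbar hI.mem.2 fun j =>
    (O.dual z (O.solve z)).β j - (O.dual z (O.solve z)).α j] at hsum
  have hopt := O.isOptimal_primal hI (hf z)
    ⟨_, Data.primalOf_of_dualOf hI.mem.2 hp (hsum.trans (le_antisymm (not_lt.1 h2) (not_lt.1 h1)))⟩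
  exact ⟨.solution _, (1 + 0) + ((1 + 0) + ((1 + 0) + ((1 + 0) + (kc + (1 + 0))))),
    hl.bind (hr.bind (hinl.bind (hinr.bind (hcv.bind
      ((Computes.charge 1 _).bind (Computes.pure _)))))), hopt, by omega⟩

end Oracle

end InverseLP

end

theorem mainTheorem1 :
    ∃ C : ℝ, 0 < C ∧
      ∀ (m n : ℕ) (I : InverseLP.Data m n),
        0 < m → m < n →
        InverseLP.IsUnimodular I.A →
        InverseLP.IsIntegral I.x₀ → InverseLP.IsIntegral I.d →
        (∀ j, 0 < I.d j) →
        I.x₀ ∈ I.lpRegion → I.x₀ ≠ 0 →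
        ∀ O : InverseLP.Oracle I,
          ∃ (out : InverseLP.Outcome n) (calls : ℕ),
            (out, calls) ∈ O.algorithm 0 ∧
            I.Correct out ∧
            (calls : ℝ) ≤ C * Real.log I.L := by
  refine ⟨117 / Real.log 2, div_pos (by norm_num) (Real.log_pos (by norm_num)), ?_⟩
  intro m n I hm hmn hA hx hd hpos hmem hne O
  have hI : I.Regular := ⟨hm, hmn, hA, hx, hd, hpos, hmem, hne⟩
  obtain ⟨N, hN, hbound⟩ := InverseLP.Data.exists_pow_bound hI
  obtain ⟨out, k, hcomp, hcorrect, hk⟩ : ∃ out k, InverseLP.Computes O.algorithm out k ∧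
      I.Correct out ∧ k ≤ 8 * N + 13 := by
    by_cases hb : I.b = 0
    · exact O.algorithm_of_eq_zero hI hb hN
    · exact O.algorithm_of_ne_zero hI hb hN
  refine ⟨out, k, by simpa using hcomp 0, hcorrect, le_trans ?_ hbound⟩
  exact_mod_cast hk
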